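/- Let $N\ge 2$ and let $\|\cdot\|$ be the Euclidean norm on $\mathbb R^N$. **Obstacle.** A star-shaped obstacle is given by a reference point $\xi^r$, a constant $d_0>0$ and a continuous distance function $\Gamma:\mathbb R^N\to[0,\infty)$, $C^1$ on $\mathbb R^N\setminus\{\xi^r\}$, with $\Gamma(\xi^r)<1$, such that $\{\Gamma\le 1\}$ is star-shaped with respect to $\xi^r$, $\Gamma$ is strictly increasing along every ray from $\xi^r$, every such ray contains a point with $\Gamma=1$, and $\Gamma(\xi)=\|\xi-\xi^b(\xi)\|/d_0+1$ whenever $\Gamma(\xi)>1$, where $\xi^b(\xi)$ is the point with $\Gamma=1$ on the ray from $\xi^r$ through $\xi$. Free space is $\mathcal X^f=\{\Gamma>1\}$, the surface is $\mathcal X^b=\{\Gamma=1\}$. Put $n=\nabla\Gamma/\|\nabla\Gamma\|$ and $r(\xi)=(\xi^r-\xi)/\|\xi^r-\xi\|$. **Direction space.** For unit vectors $b,v$ with $v\ne -b$ let $k(b,v)\in b^\perp\cong\mathbb R^{N-1}$ be the vector of length $\arccos\langle b,v\rangle$ in the direction of $v-\langle b,v\rangle b$ (and $0$ if $v=b$);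 $k(b,-b)$ is any vector of length $\pi$ in $b^\perp$. Its inverse is $\bar k(b,w)=\cos\|w\|\,b+\sin\|w\|\,w/\|w\|$, $\bar k(b,0)=b$. Nonzero vectors are normalized before they are inserted. **Dynamics.** Let $f,c:\mathbb R^N\to\mathbb R^N$ (initial and convergence dynamics) be $C^1$ with $\langle f(\xi),c(\xi)\rangle\neq-\|f(\xi)\|\,\|c(\xi)\|$ whenever $f(\xi)\ne0$; thus $c\ne 0$ wherever $f\neq 0$. Fix $R^e\in[\pi/2,\pi]$ and $s>0$. Let $$\Delta k=\|k(-n,r)-k(-n,c)\|,\qquad R^r=\min\bigl(R^e-\|k(-n,r)\|,\ \tfrac{\pi}{2}\bigr).$$ The pseudo-tangent $e$ is $c/\|c\|$ if $\|k(-n,c)\|\ge R^e$; otherwise, if $\Delta k\ne0$, it is given by $k(-n,e)=(1-b)\,k(-n,r)+b\,k(-n,c)$ with the unique $b>0$ for which this vector has length $R^e$. Let $$\lambda=\Bigl(\frac1\Gamma\Bigr)^{q},\quad q=\max\Bigl(1,\frac{R^r}{\Delta k}\Bigr)^{s}\quad(\lambda=0\text{ if }\Delta k=0),\qquad h=\min\Bigl(1,\Bigl(\frac{\Delta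 k}{R^r}\Bigr)^2+\Bigl(1-\frac1\Gamma\Bigr)^2\Bigr),$$ $$F(\xi)=h\,\|f\|\;\bar k\bigl(c,\ (1-\lambda)\,k(c,f)+\lambda\,k(c,e)\bigr),$$ with $F(\xi)=0$ where $f(\xi)=0$. The field is considered on $\mathcal X^f\cup\mathcal X^b$. **Claims.** 1. Let $T\ge0$ and let $x:[0,T]\to\mathbb R^N$ be continuous with $\dot x(t)=F(x(t))$ for $0\le t<T$ and $x(0)\in\mathcal X^f$. Then $x(t)\in\mathcal X^f$ for all $t\in[0,T]$. 2. If $f(\xi)=0$ then $F(\xi)=0$, and for $\xi\in\mathcal X^f$ conversely $F(\xi)=0$ implies $f(\xi)=0$. 3. Call $c$ *straight* on a set $S$ if either $c(\xi)=q(\xi)(a-\xi)$ on $S$ for some $a\in\mathcal X^f$, or $c(\xi)=q(\xi)v$ on $S$ for some fixed $v\ne0$, with $q:S\to\mathbb R\setminus\{0\}$ continuous. Suppose $c$ is straight on $\mathcal X^b$. Then there is a point $p\in\mathcal X^b$ such that: $p$ is the only point of $\mathcal X^b$ with $\Delta k=0$; $p$ is the only zero of $h$ in $\mathcal X^f\cup\mathcal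 X^b$, and $h(\xi)\to0$ as $\xi\to p$ in $\mathcal X^f\cup\mathcal X^b$; for $\xi\in\mathcal X^f\cup\mathcal X^b$, $F(\xi)=0$ if and only if $f(\xi)=0$ or $\xi=p$. Moreover, if $R^e=\pi/2$, then $p$ is a saddle in the following sense. (a) If $f(p)\neq0$, then along the surface $F$ points away from the line through $\xi^r$ and $p$: for all $\xi\in\mathcal X^b\setminus\{p\}$ close to $p$, $F(\xi)$ has a positive inner product with the component of $\xi-p$ orthogonal to $r(p)$. (b) If on a neighbourhood $U$ of $p$ the field $f$ is a pointwise positive multiple of $c$, and $c$ is straight on $\mathcal X^b\cup U$, then a single trajectory converges to $p$ from free space: there is a trajectory $x:[0,\infty)\to\mathcal X^f$ of $F$ with $x(t)\to p$ as $t\to\infty$, and any two such trajectories $x,y$ eventually coincide up to a time shift, i.e. $x(t_1+t)=y(t_2+t)$ for some $t_1,t_2\ge0$ and all $t\ge0$. -/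

import Mathlib

open Set Filter Topology

noncomputable section

namespace ROAM

/-- The state space, with the Euclidean norm. -/
abbrev E (N : ℕ) := EuclideanSpace ℝ (Fin N)

variable {N : ℕ}

/-- The unit vector with the direction of `v` (and `0` if `v = 0`). -/
def unitDir (v : E N) : E N := ‖v‖⁻¹ • v

/-! ### Direction space -/

/-- Some unit vector orthogonal to `b` (one exists if `2 ≤ N`). -/
def perpUnit (b : E N) : E N :=
  Classical.epsilon fun u : E N => ‖u‖ = 1 ∧ inner ℝ b u = 0

/-- The direction space vector `k(b, v)` of the unit vector `v` with respect to the unit vector `b`: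
its length is the angle between `b` and `v`, its direction is that of the part of `v` orthogonal
to `b`. If `B` is an orthonormal matrix with first column `b`, the last `N - 1` columns of `B` are
an orthonormal basis of the orthogonal complement of `b`; instead of the `N - 1` coordinates in that
basis, `k(b, v)` is here the vector of the complement with those coordinates, so that nothing
depends on the choice of `B`.
The vector `v = -b` has no unique direction; it gets angle `π` and an arbitrary direction. -/
def toDirSpace (b v : E N) : E N :=
  if inner ℝ b v = -1 then Real.pi • perpUnit b
  else Real.arccos (inner ℝ b v) • unitDir (v - (inner ℝ b v) • b)

/-- The inverse map: the unit vector at angle `‖w‖` from `b` in the direction of `w`, for `w`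
orthogonal to `b`. -/
def ofDirSpace (b w : E N) : E N :=
  Real.cos ‖w‖ • b + Real.sin ‖w‖ • unitDir w

/-! ### Obstacles -/

/-- A star-shaped obstacle, given by its distance function `Γ`: the obstacle is `{Γ ≤ 1}`. -/
structure StarObstacle (N : ℕ) where
  /-- the distance function -/
  Γ : E N → ℝ
  /-- the reference point -/
  ref : E N
  /-- the scaling factor of the distance function -/
  d₀ : ℝ
  d₀_pos : 0 < d₀
  nonneg : ∀ ξ, 0 ≤ Γ ξ
  continuous : Continuous Γ
  contDiffOn : ContDiffOn ℝ 1 Γ {ref}ᶜ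
  ref_inside : Γ ref < 1
  /-- the reference point is in the kernel of the obstacle -/
  star : StarConvex ℝ ref {ξ | Γ ξ ≤ 1}
  /-- `Γ` increases along every ray that starts at the reference point -/
  radial_mono : ∀ u : E N, u ≠ 0 → StrictMonoOn (fun t : ℝ => Γ (ref + t • u)) (Ici 0)
  /-- every such ray has a boundary point -/
  exists_boundary : ∀ u : E N, u ≠ 0 → ∃ b : ℝ, 0 < b ∧ Γ (ref + b • u) = 1
  /-- outside the obstacle, `Γ ξ = ‖ξ - ξᵇ‖ / d₀ + 1`, where `ξᵇ` is the boundary point on the ray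
  from the reference point through `ξ` -/
  dist_eq : ∀ ξ, 1 < Γ ξ → ∀ b : ℝ, 0 < b → Γ (ref + b • (ξ - ref)) = 1 →
    Γ ξ = ‖ξ - (ref + b • (ξ - ref))‖ / d₀ + 1

namespace StarObstacle

variable (O : StarObstacle N)

/-- The free space. -/
def free : Set (E N) := {ξ | 1 < O.Γ ξ}

/-- The boundary of the obstacle. -/
def boundary : Set (E N) := {ξ | O.Γ ξ = 1}

/-- The unit outward normal direction, the direction of the gradient of `Γ`. -/
def normal (ξ : E N) : E N := unitDir (gradient O.Γ ξ)

/-- The reference direction, the unit vector from `ξ` to the reference point; outside the obstacle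
it has an angle less than `π / 2` with `-n`. -/
def refDir (ξ : E N) : E N := unitDir (O.ref - ξ)

end StarObstacle

/-! ### Convergence dynamics -/

/-- The vector field `c` is straight on `S`, with an attractor in `A` or an attractor at infinity:
on `S` it is a continuous nonvanishing multiple of `a - ξ` for some point `a ∈ A`, or of a fixed
nonzero vector `v` (collinear dynamics). -/
def StraightOn (c : E N → E N) (S A : Set (E N)) : Prop :=
  (∃ a ∈ A, ∃ q : E N → ℝ, ContinuousOn q S ∧ ∀ ξ ∈ S, q ξ ≠ 0 ∧ c ξ = q ξ • (a - ξ)) ∨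
  (∃ v : E N, v ≠ 0 ∧ ∃ q : E N → ℝ, ContinuousOn q S ∧ ∀ ξ ∈ S, q ξ ≠ 0 ∧ c ξ = q ξ • v)

/-- `c` is nonzero and not anti-collinear to `f` wherever `f` does not vanish. -/
def NeverAnticollinear (f c : E N → E N) : Prop :=
  ∀ ξ, f ξ ≠ 0 → inner ℝ (f ξ) (c ξ) ≠ -(‖f ξ‖ * ‖c ξ‖)

/-! ### The rotated dynamics -/

section Dynamics

variable (O : StarObstacle N) (f c : E N → E N) (Re s : ℝ)

/-- The reference direction in direction space, `k(-n, r)`. -/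
def kRef (ξ : E N) : E N := toDirSpace (-O.normal ξ) (O.refDir ξ)

/-- The convergence direction in direction space, `k(-n, c)`. -/
def kConv (ξ : E N) : E N := toDirSpace (-O.normal ξ) (unitDir (c ξ))

/-- The distance `Δk(c) = ‖k(-n, r) - k(-n, c)‖`. -/
def deltaK (ξ : E N) : ℝ := ‖kRef O ξ - kConv O c ξ‖

/-- The point with parameter `b` on the line from `k(-n, r)` through `k(-n, c)`. -/
def kLine (ξ : E N) (b : ℝ) : E N := (1 - b) • kRef O ξ + b • kConv O c ξ

open Classical in
/-- The pseudo-tangent `e` for the tangent radius `Re`: the direction of `c` if it is at angle at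
least `Re` from `-n`; otherwise the direction at which the line from `k(-n, r)` through `k(-n, c)`
meets the sphere of radius `Re` at a parameter `b > 0`. Outside the obstacle there is exactly one
such `b`, unless `c` and `r` have the same direction, where `e` is not used. -/
def pseudoTangent (ξ : E N) : E N :=
  if Re ≤ ‖kConv O c ξ‖ then unitDir (c ξ)
  else if h : ∃ b : ℝ, 0 < b ∧ ‖kLine O c ξ b‖ = Re then
    ofDirSpace (-O.normal ξ) (kLine O c ξ h.choose)
  else 0

/-- The reference radius `Rʳ`. -/
def refRadius (ξ : E N) : ℝ := min (Re - ‖kRef O ξ‖) (Real.pi / 2)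

/-- The smoothing exponent `q` (for `Δk(c) ≠ 0`). -/
def smoothExp (ξ : E N) : ℝ := (max 1 (refRadius O Re ξ / deltaK O c ξ)) ^ s

/-- The rotation weight `λ = (1 / Γ) ^ q`; as `Δk(c) = 0` means `q = ∞`, it is then `0`. -/
def rotWeight (ξ : E N) : ℝ :=
  if deltaK O c ξ = 0 then 0 else (1 / O.Γ ξ) ^ smoothExp O c Re s ξ

/-- The direction of the rotated dynamics. -/
def rotDir (ξ : E N) : E N :=
  ofDirSpace (unitDir (c ξ))
    ((1 - rotWeight O c Re s ξ) • toDirSpace (unitDir (c ξ)) (unitDir (f ξ)) +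
      rotWeight O c Re s ξ • toDirSpace (unitDir (c ξ)) (pseudoTangent O c Re ξ))

/-- The magnitude scaling `h`. -/
def magScale (ξ : E N) : ℝ :=
  min 1 ((deltaK O c ξ / refRadius O Re ξ) ^ 2 + (1 - 1 / O.Γ ξ) ^ 2)

/-- The final dynamics: the direction of the rotated dynamics, with magnitude `h ‖f‖`. It is
meaningful on the free space and on the boundary. -/
def dynamics (ξ : E N) : E N := (magScale O c Re ξ * ‖f ξ‖) • rotDir O f c Re s ξ

end Dynamics

/-! ### Saddle points -/

/-- `x` is a trajectory of `F` for all times `t ≥ 0` that stays in `Ω` and converges to `p`. -/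
def ConvergesTo (F : E N → E N) (Ω : Set (E N)) (p : E N) (x : ℝ → E N) : Prop :=
  (∀ t ∈ Ici (0 : ℝ), x t ∈ Ω) ∧ IsIntegralCurveOn x (fun _ => F) (Ici 0) ∧
    Tendsto x atTop (𝓝 p)

/-- There is a trajectory of `F` in `Ω` that converges to `p`, and any two such trajectories
coincide eventually, up to a shift of time. -/
def SingleConvergentTrajectory (F : E N → E N) (Ω : Set (E N)) (p : E N) : Prop :=
  (∃ x, ConvergesTo F Ω p x) ∧
    ∀ x y, ConvergesTo F Ω p x → ConvergesTo F Ω p y →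
      ∃ t₁ t₂ : ℝ, 0 ≤ t₁ ∧ 0 ≤ t₂ ∧ ∀ t : ℝ, 0 ≤ t → x (t₁ + t) = y (t₂ + t)

/-- On `S`, near `p`, the field `F` points away from the line through `p` with unit direction `u`:
it has a positive inner product with the component of `ξ - p` orthogonal to `u`. -/
def PointsAwayOn (F : E N → E N) (S : Set (E N)) (p u : E N) : Prop :=
  ∀ᶠ ξ in 𝓝[S \ {p}] p, 0 < inner ℝ (F ξ) ((ξ - p) - (inner ℝ u (ξ - p)) • u)

end ROAM

end

namespace ROAM

variable {N : ℕ}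

/-! ### Unit directions -/

/-! Invariance. Look at the first time `τ` at which a motion reaches the surface, at a point `x τ`.
If `f` or `Δk` vanishes there, then `F` is `O(‖ξ - x τ‖)` near `x τ` from outside
(`isBigO_dynamics`), and such a field cannot reach `x τ` in finite time. Otherwise `Δk` stays away
from zero nearby, so the exponent `q` is bounded. The pseudo-tangent `e` makes an angle of at least
`π / 2` with `-n`, and the direction of `F` differs from `e` by at most a multiple of `1 - λ ≤ q (Γ
- 1)`. Hence `Γ - 1` satisfies `g' ≥ -C g` and stays positive (`exists_inner_gradient_dynamics_ge`).
Only these one-sided estimates are needed, not continuity or uniqueness for `F`.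

Zeros. Since `‖F‖ = h ‖f‖`, everything reduces to `h = 0`, which means `Δk = 0` and `Γ = 1`. For
straight `c` the coefficient has constant sign on the connected surface, and `c` has the direction
of `r` exactly on one ray from the reference point; that ray meets the surface once, at `p`.

Saddle, on the surface. There `F` has the direction of `e`. Let `u = r(p)` and let `y` be the part
of `ξ - p` orthogonal to `u`. To first order the directions of `c` and `r` differ by a positive
multiple of `y` (`StraightOn.local_form`). The line through the two direction space vectors
therefore leaves the ball of radius `π / 2` at a point with a positive component along `y`. This is
an inequality for the derivative of `k` (`hit_toDirSpaceDeriv_pos`), made uniform by compactness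
(`exists_inner_line_ge`).

Saddle, in free space. If `f` is parallel to `c`, the direction of `F` is a nonnegative combination
of `c` and `e`, which makes `‖y‖² exp(2C⟨u, ξ - p⟩)` nondecreasing along motions near `p`
(`exists_drift`). Along a motion that converges to `p` it tends to zero, so it vanishes: the motion
ends up on the axis. On the axis the equation is scalar, `z' = -φ(z)` with `0 < φ(z) ≤ K z`, and the
primitive of `-1 / φ` serves as a clock that gives existence, infinite duration and uniqueness up to
a time shift. -/

theorem norm_unitDir {v : E N} (hv : v ≠ 0) : ‖unitDir v‖ = 1 := by
  rw [unitDir, norm_smul, norm_inv, norm_norm, inv_mul_cancel₀ (norm_ne_zero_iff.mpr hv)]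

@[simp] theorem unitDir_zero : unitDir (0 : E N) = 0 := by simp [unitDir]

theorem norm_unitDir_le (v : E N) : ‖unitDir v‖ ≤ 1 := by
  rcases eq_or_ne v 0 with rfl | hv
  · simp
  · exact (norm_unitDir hv).le

theorem norm_smul_unitDir (v : E N) : ‖v‖ • unitDir v = v := by
  rcases eq_or_ne v 0 with rfl | hv
  · simp
  · rw [unitDir, smul_smul, mul_inv_cancel₀ (norm_ne_zero_iff.mpr hv), one_smul]

theorem unitDir_of_norm_eq_one {v : E N} (hv : ‖v‖ = 1) : unitDir v = v := by
  simp [unitDir, hv]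

theorem unitDir_smul_of_pos {a : ℝ} (ha : 0 < a) (v : E N) : unitDir (a • v) = unitDir v := by
  rw [unitDir, unitDir, norm_smul, Real.norm_of_nonneg ha.le, smul_smul]
  congr 1
  field_simp

theorem unitDir_smul_of_neg {a : ℝ} (ha : a < 0) (v : E N) :
    unitDir (a • v) = unitDir (-v) := by
  rw [← unitDir_smul_of_pos (neg_pos.mpr ha) (-v), smul_neg, neg_smul, neg_neg]

theorem unitDir_neg (v : E N) : unitDir (-v) = -unitDir v := by
  simp [unitDir]

theorem continuousAt_unitDir {v : E N} (hv : v ≠ 0) : ContinuousAt (unitDir : E N → E N) v :=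
  (continuous_norm.continuousAt.inv₀ (norm_ne_zero_iff.mpr hv)).smul continuousAt_id

theorem contDiffAt_unitDir {v : E N} (hv : v ≠ 0) : ContDiffAt ℝ 1 (unitDir : E N → E N) v :=
  ((contDiffAt_norm ℝ hv).inv (norm_ne_zero_iff.mpr hv)).smul contDiffAt_id

theorem unitDir_eq_iff {v w : E N} (hv : v ≠ 0) :
    unitDir v = unitDir w ↔ ∃ t : ℝ, 0 < t ∧ w = t • v := by
  constructor
  · intro h
    have hw : w ≠ 0 := by
      rintro rfl
      have := norm_unitDir hv
      simp [h] at this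
    refine ⟨‖w‖ * ‖v‖⁻¹, by positivity, ?_⟩
    rw [mul_smul, ← unitDir, h, norm_smul_unitDir]
  · rintro ⟨t, ht, rfl⟩
    rw [unitDir_smul_of_pos ht]

/-! ### The spherical exponential map and its inverse -/

theorem perpUnit_spec (hN : 2 ≤ N) (b : E N) :
    ‖perpUnit b‖ = 1 ∧ inner ℝ b (perpUnit b) = 0 := by
  apply Classical.epsilon_spec (p := fun u : E N => ‖u‖ = 1 ∧ inner ℝ b u = 0)
  have hlt : Module.finrank ℝ (Submodule.span ℝ {b}) < Module.finrank ℝ (E N) := by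
    have : Module.finrank ℝ (Submodule.span ℝ {b}) ≤ 1 := by
      simpa using finrank_span_le_card (R := ℝ) ({b} : Set (E N))
    rw [finrank_euclideanSpace_fin]
    omega
  have hne : (Submodule.span ℝ {b})ᗮ ≠ ⊥ := by
    intro h
    rw [Submodule.orthogonal_eq_bot_iff] at h
    rw [h, finrank_top] at hlt
    exact lt_irrefl _ hlt
  obtain ⟨u, hu, hu0⟩ := Submodule.exists_mem_ne_zero_of_ne_bot hne
  refine ⟨unitDir u, norm_unitDir hu0, ?_⟩
  rw [unitDir, inner_smul_right, Submodule.mem_orthogonal_singleton_iff_inner_right.mp hu,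
    mul_zero]

theorem norm_sub_inner_smul_sq {b v : E N} (hb : ‖b‖ = 1) (hv : ‖v‖ = 1) :
    ‖v - (inner ℝ b v) • b‖ ^ 2 = 1 - (inner ℝ b v) ^ 2 := by
  rw [norm_sub_sq_real, norm_smul, inner_smul_right, real_inner_comm, hb, hv]
  simp only [Real.norm_eq_abs, mul_one, sq_abs]
  ring

theorem inner_sub_inner_smul {b : E N} (hb : ‖b‖ = 1) (v : E N) :
    inner ℝ b (v - (inner ℝ b v) • b) = 0 := by
  rw [inner_sub_right, inner_smul_right, real_inner_self_eq_norm_sq, hb]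
  ring

theorem norm_sub_inner_smul {b v : E N} (hb : ‖b‖ = 1) (hv : ‖v‖ = 1) :
    ‖v - (inner ℝ b v) • b‖ = √(1 - (inner ℝ b v) ^ 2) := by
  rw [← norm_sub_inner_smul_sq hb hv, Real.sqrt_sq (norm_nonneg _)]

theorem inner_mem_Icc {b v : E N} (hb : ‖b‖ = 1) (hv : ‖v‖ = 1) :
    inner ℝ b v ∈ Icc (-1 : ℝ) 1 := by
  have := abs_real_inner_le_norm b v
  rw [hb, hv, mul_one] at this
  exact abs_le.mp this

theorem inner_unitDir_right (a v : E N) : inner ℝ a (unitDir v) = ‖v‖⁻¹ * inner ℝ a v := by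
  rw [unitDir, inner_smul_right]

theorem inner_toDirSpace (hN : 2 ≤ N) {b : E N} (hb : ‖b‖ = 1) (v : E N) :
    inner ℝ b (toDirSpace b v) = 0 := by
  rw [toDirSpace]
  split_ifs
  · rw [inner_smul_right, (perpUnit_spec hN b).2, mul_zero]
  · rw [inner_smul_right, inner_unitDir_right, inner_sub_inner_smul hb]
    simp

theorem norm_toDirSpace (hN : 2 ≤ N) {b v : E N} (hb : ‖b‖ = 1) (hv : ‖v‖ = 1) :
    ‖toDirSpace b v‖ = Real.arccos (inner ℝ b v) := by
  rw [toDirSpace]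
  split_ifs with h
  · rw [norm_smul, (perpUnit_spec hN b).1, h, Real.arccos_neg_one,
      Real.norm_of_nonneg Real.pi_nonneg, mul_one]
  · rw [norm_smul, Real.norm_of_nonneg (Real.arccos_nonneg _)]
    by_cases h0 : v - (inner ℝ b v) • b = 0
    · have h1 := norm_sub_inner_smul_sq hb hv
      rw [h0] at h1
      have h2 : (inner ℝ b v - 1) * (inner ℝ b v + 1) = 0 := by
        simp only [norm_zero] at h1
        linarith
      rcases mul_eq_zero.mp h2 with h3 | h3
      · rw [sub_eq_zero.mp h3]
        simp
      · exact absurd (eq_neg_of_add_eq_zero_left h3) h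
    · rw [norm_unitDir h0, mul_one]

theorem ofDirSpace_zero (b : E N) : ofDirSpace b 0 = b := by
  simp [ofDirSpace]

theorem toDirSpace_self {b : E N} (hb : ‖b‖ = 1) : toDirSpace b b = 0 := by
  rw [toDirSpace, real_inner_self_eq_norm_sq, hb]
  norm_num

theorem ofDirSpace_eq_sinc (b w : E N) :
    ofDirSpace b w = Real.cos ‖w‖ • b + Real.sinc ‖w‖ • w := by
  rcases eq_or_ne w 0 with rfl | hw
  · simp [ofDirSpace]
  · rw [ofDirSpace, unitDir, Real.sinc_of_ne_zero (norm_ne_zero_iff.mpr hw), smul_smul,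
      div_eq_mul_inv]

/-- The antipode is included: at angle `π` the sine vanishes, so the arbitrary direction of
`perpUnit` does not matter. -/
theorem ofDirSpace_toDirSpace (hN : 2 ≤ N) {b v : E N} (hb : ‖b‖ = 1) (hv : ‖v‖ = 1) :
    ofDirSpace b (toDirSpace b v) = v := by
  obtain ⟨h1, h2⟩ := inner_mem_Icc hb hv
  rw [ofDirSpace, norm_toDirSpace hN hb hv, Real.cos_arccos h1 h2, Real.sin_arccos]
  by_cases h : (inner ℝ b v : ℝ) = -1
  · have h0 := norm_sub_inner_smul_sq hb hv
    rw [h] at h0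
    have h3 : v = (-1 : ℝ) • b := by
      rw [← sub_eq_zero, ← norm_eq_zero]
      nlinarith
    rw [h, h3]
    simp
  · by_cases h0 : v - (inner ℝ b v) • b = 0
    · have h3 := norm_sub_inner_smul hb hv
      rw [← h3, h0]
      simp only [norm_zero, zero_smul, add_zero]
      exact (sub_eq_zero.mp h0).symm
    · rw [toDirSpace, if_neg h]
      have hpos : 0 < Real.arccos (inner ℝ b v) := by
        rw [Real.arccos_pos]
        refine lt_of_le_of_ne h2 fun h4 => h0 ?_
        rw [← norm_eq_zero, norm_sub_inner_smul hb hv, h4]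
        norm_num
      rw [unitDir_smul_of_pos hpos, unitDir_of_norm_eq_one (norm_unitDir h0),
        ← norm_sub_inner_smul hb hv, norm_smul_unitDir]
      abel

theorem norm_ofDirSpace {b w : E N} (hb : ‖b‖ = 1) (hw : inner ℝ b w = 0) :
    ‖ofDirSpace b w‖ = 1 := by
  rcases eq_or_ne w 0 with rfl | hw0
  · rw [ofDirSpace_zero, hb]
  · have h : ‖ofDirSpace b w‖ ^ 2 = 1 := by
      rw [ofDirSpace, norm_add_sq_real, inner_smul_left, inner_smul_right, inner_unitDir_right, hw,
        norm_smul, norm_smul, hb, norm_unitDir hw0]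
      simp only [Real.norm_eq_abs, mul_one, sq_abs, mul_zero, add_zero]
      exact Real.cos_sq_add_sin_sq _
    nlinarith [norm_nonneg (ofDirSpace b w)]

theorem inner_ofDirSpace {b w : E N} (hb : ‖b‖ = 1) (hw : inner ℝ b w = 0) :
    inner ℝ b (ofDirSpace b w) = Real.cos ‖w‖ := by
  rw [ofDirSpace, inner_add_right, inner_smul_right, inner_smul_right, inner_unitDir_right, hw,
    real_inner_self_eq_norm_sq, hb]
  ring

/-- The exponential map of the unit sphere does not increase distances. -/
theorem norm_ofDirSpace_sub_le {b w₁ w₂ : E N} (hb : ‖b‖ = 1) (h₁ : inner ℝ b w₁ = 0)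
    (h₂ : inner ℝ b w₂ = 0) : ‖ofDirSpace b w₁ - ofDirSpace b w₂‖ ≤ ‖w₁ - w₂‖ := by
  have hsq : ‖ofDirSpace b w₁ - ofDirSpace b w₂‖ ^ 2 ≤ ‖w₁ - w₂‖ ^ 2 := by
    set x := ‖w₁‖
    set y := ‖w₂‖
    set z := (inner ℝ (unitDir w₁) (unitDir w₂) : ℝ)
    -- The squared chord is `2 - 2 cos (x - y) + 2 sin x sin y (1 - z)`, to be compared with `(x -
    -- y)² + 2 x y (1 - z)`.
    have hz : z ≤ 1 := by
      refine (real_inner_le_norm _ _).trans ?_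
      exact mul_le_one₀ (norm_unitDir_le _) (norm_nonneg _) (norm_unitDir_le _)
    have hi : inner ℝ w₁ w₂ = x * y * z := by
      conv_lhs => rw [← norm_smul_unitDir w₁, ← norm_smul_unitDir w₂]
      rw [inner_smul_left, inner_smul_right]
      simp only [conj_trivial]
      ring
    have ho : inner ℝ (ofDirSpace b w₁) (ofDirSpace b w₂) =
        Real.cos x * Real.cos y + Real.sin x * Real.sin y * z := by
      have e1 : inner ℝ b (unitDir w₂) = 0 := by rw [inner_unitDir_right, h₂, mul_zero]
      have e2 : inner ℝ (unitDir w₁) b = 0 := by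
        rw [real_inner_comm, inner_unitDir_right, h₁, mul_zero]
      simp only [ofDirSpace, inner_add_left, inner_add_right, inner_smul_left, inner_smul_right,
        conj_trivial, e1, e2, real_inner_self_eq_norm_sq, hb]
      ring
    rw [norm_sub_sq_real, norm_sub_sq_real, hi, ho, norm_ofDirSpace hb h₁, norm_ofDirSpace hb h₂]
    have hx : 0 ≤ x := norm_nonneg _
    have hy : 0 ≤ y := norm_nonneg _
    have hs : Real.sin x * Real.sin y ≤ x * y := by
      have a1 := Real.abs_sin_le_abs (x := x)
      have a2 := Real.abs_sin_le_abs (x := y)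
      rw [abs_of_nonneg hx] at a1
      rw [abs_of_nonneg hy] at a2
      calc Real.sin x * Real.sin y ≤ |Real.sin x * Real.sin y| := le_abs_self _
        _ = |Real.sin x| * |Real.sin y| := abs_mul _ _
        _ ≤ x * y := mul_le_mul a1 a2 (abs_nonneg _) hx
    have hc : 1 - (x - y) ^ 2 / 2 ≤ Real.cos (x - y) := Real.one_sub_sq_div_two_le_cos
    rw [Real.cos_sub] at hc
    nlinarith [mul_nonneg (sub_nonneg.mpr hs) (sub_nonneg.mpr hz)]
  exact le_of_sq_le_sq hsq (norm_nonneg _)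

/-- Bounds `Δk` below by a distance of unit vectors that is continuous in `ξ`, so `Δk` can be kept
away from zero without continuity of `Δk` itself. -/
theorem norm_sub_le_norm_toDirSpace_sub (hN : 2 ≤ N) {b v w : E N} (hb : ‖b‖ = 1) (hv : ‖v‖ = 1)
    (hw : ‖w‖ = 1) : ‖v - w‖ ≤ ‖toDirSpace b v - toDirSpace b w‖ := by
  have := norm_ofDirSpace_sub_le hb (inner_toDirSpace hN hb v) (inner_toDirSpace hN hb w)
  rwa [ofDirSpace_toDirSpace hN hb hv, ofDirSpace_toDirSpace hN hb hw] at this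

/-! ### Regularity of the inverse of the exponential map -/

/-- The quotient `θ / sin θ` as a function of `x = cos θ`. -/
noncomputable def logFactor (x : ℝ) : ℝ := (Real.sinc (Real.arccos x))⁻¹

theorem arccos_lt_pi {x : ℝ} (hx : -1 < x) : Real.arccos x < Real.pi := by
  rw [Real.arccos]
  have := Real.neg_pi_div_two_lt_arcsin.mpr hx
  linarith

theorem sinc_arccos_pos {x : ℝ} (hx : -1 < x) : 0 < Real.sinc (Real.arccos x) := by
  rcases (Real.arccos_nonneg x).eq_or_lt with h | h
  · rw [← h, Real.sinc_zero]
    exact one_pos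
  · rw [Real.sinc_of_ne_zero h.ne']
    exact div_pos (Real.sin_pos_of_pos_of_lt_pi h (arccos_lt_pi hx)) h

theorem logFactor_of_lt_one {x : ℝ} (h1 : x < 1) :
    logFactor x = Real.arccos x / √(1 - x ^ 2) := by
  rw [logFactor, Real.sinc_of_ne_zero (Real.arccos_pos.mpr h1).ne', Real.sin_arccos, inv_div]

theorem logFactor_one : logFactor 1 = 1 := by
  simp [logFactor]

theorem one_le_logFactor {x : ℝ} (hx : -1 < x) : 1 ≤ logFactor x := by
  rw [logFactor]
  exact (one_le_inv₀ (sinc_arccos_pos hx)).mpr (Real.sinc_le_one _)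

theorem logFactor_pos {x : ℝ} (hx : -1 < x) : 0 < logFactor x :=
  inv_pos.mpr (sinc_arccos_pos hx)

theorem continuousAt_logFactor {x : ℝ} (hx : -1 < x) : ContinuousAt logFactor x :=
  (Real.continuous_sinc.comp Real.continuous_arccos).continuousAt.inv₀ (sinc_arccos_pos hx).ne'

/-- This form has no normalization that degenerates at `v = b`; the regularity of `k` is reduced to
that of the scalar function `logFactor`. -/
theorem toDirSpace_eq_logFactor {b v : E N} (hb : ‖b‖ = 1) (hv : ‖v‖ = 1)
    (h : -1 < (inner ℝ b v : ℝ)) :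
    toDirSpace b v = logFactor (inner ℝ b v) • (v - (inner ℝ b v) • b) := by
  rw [toDirSpace, if_neg h.ne']
  rcases (inner_mem_Icc hb hv).2.eq_or_lt with h1 | h1
  · have h0 : v - (inner ℝ b v) • b = 0 := by
      rw [← norm_eq_zero, norm_sub_inner_smul hb hv, h1]
      norm_num
    rw [h0]
    simp
  · rw [logFactor_of_lt_one h1, unitDir, norm_sub_inner_smul hb hv, smul_smul, div_eq_mul_inv]

theorem hasStrictDerivAt_logFactor {x : ℝ} (h0 : -1 < x) (h1 : x < 1) :
    HasStrictDerivAt logFactor ((x * logFactor x - 1) / (1 - x ^ 2)) x := by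
  have hp : 0 < 1 - x ^ 2 := by nlinarith
  have h2 : HasStrictDerivAt (fun y : ℝ => 1 - y ^ 2) (-(2 * x)) x := by
    simpa using ((hasStrictDerivAt_id x).pow 2).const_sub 1
  have h3 := (Real.hasStrictDerivAt_arccos h0.ne' h1.ne).div (h2.sqrt hp.ne')
    (Real.sqrt_pos.mpr hp).ne'
  have h4 := h3.congr_of_eventuallyEq (f₁ := logFactor) (by
    filter_upwards [gt_mem_nhds h1] with y hy
    simp [logFactor_of_lt_one hy])
  refine h4.congr_deriv ?_
  rw [logFactor_of_lt_one h1]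
  have hs := Real.sqrt_pos.mpr hp
  have hss : √(1 - x ^ 2) ^ 2 = 1 - x ^ 2 := Real.sq_sqrt hp.le
  rw [hss]
  field_simp
  ring

/-- With `x = cos θ` this is `θ cos θ ≤ sin θ`, that is `θ ≤ tan θ`. -/
theorem mul_logFactor_le_one {x : ℝ} (h0 : 0 ≤ x) (h1 : x ≤ 1) : x * logFactor x ≤ 1 := by
  rcases h1.eq_or_lt with rfl | h1
  · rw [logFactor_one, mul_one]
  · have hs : 0 < √(1 - x ^ 2) := Real.sqrt_pos.mpr (by nlinarith)
    rw [logFactor_of_lt_one h1, mul_div_assoc', div_le_one hs, ← Real.sin_arccos]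
    nth_rw 1 [← Real.cos_arccos (by linarith : -1 ≤ x) h1.le]
    set θ := Real.arccos x
    have hθ : 0 ≤ θ := Real.arccos_nonneg x
    have hθ2 : θ ≤ Real.pi / 2 := Real.arccos_le_pi_div_two.mpr h0
    rcases hθ2.eq_or_lt with h | h
    · rw [h, Real.cos_pi_div_two, Real.sin_pi_div_two]
      norm_num
    · have hc : 0 < Real.cos θ := Real.cos_pos_of_mem_Ioo ⟨by linarith [Real.pi_pos], h⟩
      have := Real.le_tan hθ h
      rw [Real.tan_eq_sin_div_cos, le_div_iff₀ hc] at this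
      linarith

theorem logFactor_le {x : ℝ} (h0 : 0 ≤ x) : logFactor x ≤ 2 := by
  rcases le_or_gt 1 x with h1 | h1
  · rw [logFactor, Real.arccos_of_one_le h1]
    norm_num
  · have hs : 0 < √(1 - x ^ 2) := Real.sqrt_pos.mpr (by nlinarith)
    rw [logFactor_of_lt_one h1, div_le_iff₀ hs, ← Real.sin_arccos]
    have h2 := Real.mul_le_sin (Real.arccos_nonneg x) (Real.arccos_le_pi_div_two.mpr h0)
    have h3 : 1 / 2 ≤ 2 / Real.pi := by
      rw [div_le_div_iff₀ two_pos Real.pi_pos]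
      linarith [Real.pi_le_four]
    nlinarith [Real.arccos_nonneg x]

theorem neg_two_le_deriv_logFactor {x : ℝ} (h0 : 0 ≤ x) (h1 : x < 1) :
    -2 ≤ (x * logFactor x - 1) / (1 - x ^ 2) := by
  have hp : 0 < 1 - x ^ 2 := by nlinarith
  have hs : 0 < √(1 - x ^ 2) := Real.sqrt_pos.mpr hp
  rw [le_div_iff₀ hp, logFactor_of_lt_one h1]
  have hss : 1 - x ^ 2 = Real.sin (Real.arccos x) ^ 2 := by
    rw [Real.sin_arccos, Real.sq_sqrt hp.le]
  have hc := Real.cos_arccos (by linarith : -1 ≤ x) h1.le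
  rw [← Real.sin_arccos] at hs ⊢
  rw [hss]
  have h2 := Real.mul_le_sin (Real.arccos_nonneg x) (Real.arccos_le_pi_div_two.mpr h0)
  have h4 := Real.sin_le (Real.arccos_nonneg x)
  have h5 := Real.one_sub_sq_div_two_le_cos (x := Real.arccos x)
  rw [hc] at h5
  have h6 := Real.arccos_nonneg x
  generalize Real.arccos x = θ at *
  -- The claim is `θ cos θ - sin θ + 2 sin³ θ ≥ 0`. The bounds `cos θ ≥ 1 - θ² / 2` and `sin θ ≤ θ`
  -- make the first two terms at least `-θ³ / 2`, and `0.63` is just large enough that `2 · 0.63³ ≥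
  -- 1 / 2`.
  have h3 : (0.63 : ℝ) ≤ 2 / Real.pi := by
    rw [le_div_iff₀ Real.pi_pos]
    linarith [Real.pi_lt_d2]
  have h7 : 0.63 * θ ≤ Real.sin θ := (mul_le_mul_of_nonneg_right h3 h6).trans h2
  have h8 : (0.63 * θ) ^ 3 ≤ Real.sin θ ^ 3 := pow_le_pow_left₀ (by positivity) h7 3
  rw [← sub_nonneg]
  have : x * (θ / Real.sin θ) - 1 - -2 * Real.sin θ ^ 2 =
      (x * θ - Real.sin θ + 2 * Real.sin θ ^ 3) / Real.sin θ := by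
    field_simp
    ring
  rw [this]
  apply div_nonneg _ hs.le
  nlinarith [mul_le_mul_of_nonneg_right h5 h6, pow_nonneg h6 3]

/-- On `[0, 1]` the function decreases with slope at least `-2`. The endpoint `1`, where `logFactor`
is not differentiable, is included by continuity. -/
theorem abs_logFactor_sub_le {x y : ℝ} (hx : x ∈ Icc (0 : ℝ) 1) (hy : y ∈ Icc (0 : ℝ) 1) :
    |logFactor x - logFactor y| ≤ 2 * |x - y| := by
  have hcont : ContinuousOn logFactor (Icc 0 1) := fun z hz =>
    (continuousAt_logFactor (by linarith [hz.1])).continuousWithinAt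
  have hd : ∀ z ∈ interior (Icc (0 : ℝ) 1),
      HasDerivAt logFactor ((z * logFactor z - 1) / (1 - z ^ 2)) z := by
    intro z hz
    rw [interior_Icc] at hz
    exact (hasStrictDerivAt_logFactor (by linarith [hz.1]) hz.2).hasDerivAt
  have hanti : AntitoneOn logFactor (Icc 0 1) := by
    refine antitoneOn_of_deriv_nonpos (convex_Icc 0 1) hcont
      (fun z hz => (hd z hz).differentiableAt.differentiableWithinAt) fun z hz => ?_
    rw [(hd z hz).deriv]
    rw [interior_Icc] at hz
    exact div_nonpos_of_nonpos_of_nonneg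
      (by linarith [mul_logFactor_le_one hz.1.le hz.2.le]) (by nlinarith [hz.1, hz.2])
  have hmono : MonotoneOn (fun z => logFactor z + 2 * z) (Icc 0 1) := by
    have hd' : ∀ z ∈ interior (Icc (0 : ℝ) 1), HasDerivAt (fun z => logFactor z + 2 * z)
        ((z * logFactor z - 1) / (1 - z ^ 2) + 2 * 1) z := fun z hz =>
      (hd z hz).add ((hasDerivAt_id z).const_mul 2)
    refine monotoneOn_of_deriv_nonneg (convex_Icc 0 1) (hcont.add (by fun_prop))
      (fun z hz => (hd' z hz).differentiableAt.differentiableWithinAt) fun z hz => ?_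
    rw [(hd' z hz).deriv]
    rw [interior_Icc] at hz
    linarith [neg_two_le_deriv_logFactor hz.1.le hz.2]
  rcases le_total x y with h | h
  · have h1 := hanti hx hy h
    have h2 := hmono hx hy h
    simp only at h2
    rw [abs_of_nonneg (by linarith), abs_of_nonpos (by linarith)]
    linarith
  · have h1 := hanti hy hx h
    have h2 := hmono hy hx h
    simp only at h2
    rw [abs_of_nonpos (by linarith), abs_of_nonneg (by linarith)]
    linarith

theorem toDirSpace_sub_toDirSpace {b v w : E N} (hb : ‖b‖ = 1) (hv : ‖v‖ = 1) (hw : ‖w‖ = 1)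
    (h₁ : -1 < (inner ℝ b v : ℝ)) (h₂ : -1 < (inner ℝ b w : ℝ)) :
    toDirSpace b v - toDirSpace b w =
      logFactor (inner ℝ b w) • ((v - w) - (inner ℝ b (v - w)) • b) +
      (logFactor (inner ℝ b v) - logFactor (inner ℝ b w)) • (v - (inner ℝ b v) • b) := by
  rw [toDirSpace_eq_logFactor hb hv h₁, toDirSpace_eq_logFactor hb hw h₂, inner_sub_right]
  module

theorem norm_sub_inner_smul_le {b : E N} (hb : ‖b‖ = 1) (v : E N) :
    ‖v - (inner ℝ b v) • b‖ ≤ ‖v‖ := by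
  refine le_of_sq_le_sq ?_ (norm_nonneg _)
  rw [norm_sub_sq_real, norm_smul, inner_smul_right, real_inner_comm, hb]
  simp only [Real.norm_eq_abs, mul_one, sq_abs]
  nlinarith [sq_nonneg (inner ℝ b v)]

/-- The constant is `2 + 2`: the bound `logFactor ≤ 2` for the change of the vector, and the
Lipschitz constant `2` of `logFactor` for the change of the factor. The condition on the signs keeps
both vectors in the hemisphere around `b`. -/
theorem norm_toDirSpace_sub_le {b v w : E N} (hb : ‖b‖ = 1) (hv : ‖v‖ = 1) (hw : ‖w‖ = 1)
    (h₁ : 0 ≤ (inner ℝ b v : ℝ)) (h₂ : 0 ≤ (inner ℝ b w : ℝ)) :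
    ‖toDirSpace b v - toDirSpace b w‖ ≤ 4 * ‖v - w‖ := by
  rw [toDirSpace_sub_toDirSpace hb hv hw (by linarith) (by linarith)]
  have hi : |inner ℝ b v - inner ℝ b w| ≤ ‖v - w‖ := by
    rw [← inner_sub_right]
    simpa [hb] using abs_real_inner_le_norm b (v - w)
  have h3 := abs_logFactor_sub_le ⟨h₁, (inner_mem_Icc hb hv).2⟩ ⟨h₂, (inner_mem_Icc hb hw).2⟩
  refine (norm_add_le _ _).trans ?_
  rw [norm_smul, norm_smul, Real.norm_eq_abs, Real.norm_eq_abs,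
    abs_of_pos (logFactor_pos (by linarith : -1 < inner ℝ b w))]
  have h4 := norm_sub_inner_smul_le hb (v - w)
  have h5 := norm_sub_inner_smul_le hb v
  rw [hv] at h5
  have h6 := mul_le_mul (logFactor_le h₂) h4 (norm_nonneg _) zero_le_two
  have h7 := mul_le_mul h3 h5 (norm_nonneg _) (by positivity)
  linarith

namespace StarObstacle

variable (O : StarObstacle N)

/-! ### Star-shaped obstacles -/

theorem ne_ref {ξ : E N} (h : 1 ≤ O.Γ ξ) : ξ ≠ O.ref := by
  rintro rfl
  exact absurd O.ref_inside (not_lt.mpr h)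

theorem Γ_ray_lt {ξ : E N} (hξ : ξ ≠ O.ref) {s t : ℝ} (hs : 0 ≤ s) (hst : s < t) :
    O.Γ (O.ref + s • (ξ - O.ref)) < O.Γ (O.ref + t • (ξ - O.ref)) :=
  O.radial_mono _ (sub_ne_zero.mpr hξ) (mem_Ici.mpr hs) (mem_Ici.mpr (hs.trans hst.le)) hst

theorem Γ_ray_one (ξ : E N) : O.Γ (O.ref + (1 : ℝ) • (ξ - O.ref)) = O.Γ ξ := by
  rw [one_smul, add_sub_cancel]

theorem eq_of_Γ_ray_eq {ξ : E N} (hξ : ξ ≠ O.ref) {s t : ℝ} (hs : 0 ≤ s) (ht : 0 ≤ t)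
    (h : O.Γ (O.ref + s • (ξ - O.ref)) = O.Γ (O.ref + t • (ξ - O.ref))) : s = t :=
  (O.radial_mono _ (sub_ne_zero.mpr hξ)).injOn (mem_Ici.mpr hs) (mem_Ici.mpr ht) h

theorem Γ_ray_of_boundary {ξ : E N} (hξ : ξ ≠ O.ref) {b t : ℝ} (hb : 0 < b)
    (hb1 : O.Γ (O.ref + b • (ξ - O.ref)) = 1) (hbt : b ≤ t) :
    O.Γ (O.ref + t • (ξ - O.ref)) = 1 + (t - b) * (‖ξ - O.ref‖ / O.d₀) := by
  rcases hbt.eq_or_lt with rfl | hbt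
  · rw [hb1]
    ring
  · have h1 := O.Γ_ray_lt hξ hb.le hbt
    rw [hb1] at h1
    have ht : 0 < t := hb.trans hbt
    have h2 : O.ref + (b / t) • (O.ref + t • (ξ - O.ref) - O.ref) = O.ref + b • (ξ - O.ref) := by
      rw [add_sub_cancel_left, smul_smul, div_mul_cancel₀ _ ht.ne']
    rw [O.dist_eq _ h1 (b / t) (div_pos hb ht) (by rw [h2, hb1]), h2]
    have h3 : O.ref + t • (ξ - O.ref) - (O.ref + b • (ξ - O.ref)) = (t - b) • (ξ - O.ref) := by
      module
    rw [h3, norm_smul, Real.norm_of_nonneg (by linarith)]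
    ring

/-- All points further out on the ray have the same boundary point, so `dist_eq` makes `Γ` affine
there. -/
theorem Γ_ray {ξ : E N} (h : 1 ≤ O.Γ ξ) {t : ℝ} (ht : 1 ≤ t) :
    O.Γ (O.ref + t • (ξ - O.ref)) = O.Γ ξ + (t - 1) * (‖ξ - O.ref‖ / O.d₀) := by
  have hξ := O.ne_ref h
  obtain ⟨b, hb, hb1⟩ := O.exists_boundary _ (sub_ne_zero.mpr hξ)
  have hb2 : b ≤ 1 := by
    by_contra! hlt
    have := O.Γ_ray_lt hξ zero_le_one hlt
    rw [hb1, Γ_ray_one] at this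
    linarith
  have h1 := O.Γ_ray_of_boundary hξ hb hb1 hb2
  rw [Γ_ray_one] at h1
  rw [O.Γ_ray_of_boundary hξ hb hb1 (hb2.trans ht), h1]
  ring

theorem contDiffAt_Γ {ξ : E N} (hξ : ξ ≠ O.ref) : ContDiffAt ℝ 1 O.Γ ξ :=
  O.contDiffOn.contDiffAt (isOpen_compl_singleton.mem_nhds hξ)

theorem hasGradientAt_Γ {ξ : E N} (hξ : ξ ≠ O.ref) : HasGradientAt O.Γ (gradient O.Γ ξ) ξ :=
  ((O.contDiffAt_Γ hξ).differentiableAt one_ne_zero).hasGradientAt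

theorem continuousAt_gradient_Γ {ξ : E N} (hξ : ξ ≠ O.ref) : ContinuousAt (gradient O.Γ) ξ := by
  have h := (O.contDiffAt_Γ hξ).continuousAt_fderiv one_ne_zero
  exact (InnerProductSpace.toDual ℝ (E N)).symm.continuous.continuousAt.comp h

theorem hasDerivWithinAt_Γ_comp {x : ℝ → E N} {v : E N} {s : Set ℝ} {t : ℝ} (hξ : x t ≠ O.ref)
    (hx : HasDerivWithinAt x v s t) :
    HasDerivWithinAt (fun τ => O.Γ (x τ)) (inner ℝ (gradient O.Γ (x t)) v) s t := by
  exact (O.hasGradientAt_Γ hξ).hasFDerivAt.comp_hasDerivWithinAt t hx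

/-- The formula along the ray holds only outwards from `ξ`, so the derivative is compared from the
right; this suffices because `Γ` is differentiable at `ξ`. -/
theorem inner_gradient_Γ {ξ : E N} (h : 1 ≤ O.Γ ξ) :
    inner ℝ (gradient O.Γ ξ) (ξ - O.ref) = ‖ξ - O.ref‖ / O.d₀ := by
  have hx : HasDerivWithinAt (fun t : ℝ => O.ref + t • (ξ - O.ref)) (ξ - O.ref) (Ici 1) 1 := by
    simpa using (((hasDerivAt_id (1 : ℝ)).smul_const (ξ - O.ref)).const_add
      O.ref).hasDerivWithinAt (s := Ici 1)
  have hx1 : O.ref + (1 : ℝ) • (ξ - O.ref) = ξ := by simp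
  have h1 := O.hasDerivWithinAt_Γ_comp (by rw [hx1]; exact O.ne_ref h) hx
  rw [hx1] at h1
  have h2 : HasDerivWithinAt (fun t : ℝ => O.Γ ξ + (t - 1) * (‖ξ - O.ref‖ / O.d₀))
      (‖ξ - O.ref‖ / O.d₀) (Ici 1) 1 := by
    simpa using ((((hasDerivAt_id (1 : ℝ)).sub_const 1).mul_const (‖ξ - O.ref‖ / O.d₀)).const_add
      (O.Γ ξ)).hasDerivWithinAt (s := Ici 1)
  have h3 := h2.congr (f₁ := fun t : ℝ => O.Γ (O.ref + t • (ξ - O.ref)))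
    (fun t ht => O.Γ_ray h ht) (O.Γ_ray h le_rfl)
  exact (uniqueDiffWithinAt_Ici (1 : ℝ)).eq_deriv _ h1 h3

theorem gradient_Γ_ne_zero {ξ : E N} (h : 1 ≤ O.Γ ξ) : gradient O.Γ ξ ≠ 0 := by
  intro h0
  have h1 := O.inner_gradient_Γ h
  rw [h0, inner_zero_left] at h1
  have := div_pos (norm_pos_iff.mpr (sub_ne_zero.mpr (O.ne_ref h))) O.d₀_pos
  linarith

theorem norm_normal {ξ : E N} (h : 1 ≤ O.Γ ξ) : ‖O.normal ξ‖ = 1 :=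
  norm_unitDir (O.gradient_Γ_ne_zero h)

theorem norm_neg_normal {ξ : E N} (h : 1 ≤ O.Γ ξ) : ‖-O.normal ξ‖ = 1 := by
  rw [norm_neg, O.norm_normal h]

theorem norm_refDir {ξ : E N} (h : ξ ≠ O.ref) : ‖O.refDir ξ‖ = 1 :=
  norm_unitDir (sub_ne_zero.mpr h.symm)

/-- This is what keeps `k(-n, r)` inside the ball of radius `π / 2`. -/
theorem inner_neg_normal_refDir_pos {ξ : E N} (h : 1 ≤ O.Γ ξ) :
    0 < (inner ℝ (-O.normal ξ) (O.refDir ξ) : ℝ) := by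
  have h1 : O.refDir ξ = -unitDir (ξ - O.ref) := by rw [refDir, ← unitDir_neg, neg_sub]
  have h2 : ξ - O.ref ≠ 0 := sub_ne_zero.mpr (O.ne_ref h)
  have h3 := O.gradient_Γ_ne_zero h
  rw [h1, inner_neg_neg, inner_unitDir_right, normal, unitDir, inner_smul_left,
    O.inner_gradient_Γ h, conj_trivial]
  have := O.d₀_pos
  have := norm_pos_iff.mpr h2
  have := norm_pos_iff.mpr h3
  positivity

theorem continuousAt_normal {ξ : E N} (h : 1 ≤ O.Γ ξ) : ContinuousAt O.normal ξ :=
  (continuousAt_unitDir (O.gradient_Γ_ne_zero h)).comp (O.continuousAt_gradient_Γ (O.ne_ref h))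

theorem contDiffAt_refDir {ξ : E N} (h : ξ ≠ O.ref) : ContDiffAt ℝ 1 O.refDir ξ :=
  (contDiffAt_unitDir (sub_ne_zero.mpr h.symm)).comp ξ (contDiffAt_const.sub contDiffAt_id)

theorem one_le_of_mem {ξ : E N} (h : ξ ∈ O.free ∪ O.boundary) : 1 ≤ O.Γ ξ :=
  h.elim (fun h => le_of_lt h) (fun h => ge_of_eq h)

/-- The map is the radial projection. Its factor `b ξ` is continuous because `a < b ξ` means `Γ (ref
+ a • (ξ - ref)) < 1` for `a ≥ 0`, an open condition on `ξ`, and likewise for `b ξ < a`. -/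
theorem exists_continuousOn_boundary_param :
    ∃ g : E N → E N, ContinuousOn g {O.ref}ᶜ ∧ O.boundary = g '' {O.ref}ᶜ := by
  have hex : ∀ ξ : E N, ∃ b : ℝ, ξ ≠ O.ref → 0 < b ∧ O.Γ (O.ref + b • (ξ - O.ref)) = 1 := by
    intro ξ
    by_cases h : ξ = O.ref
    · exact ⟨0, fun h' => absurd h h'⟩
    · obtain ⟨b, hb⟩ := O.exists_boundary _ (sub_ne_zero.mpr h)
      exact ⟨b, fun _ => hb⟩
  choose b hb using hex
  have hmono : ∀ ξ ≠ O.ref, ∀ t : ℝ, 0 ≤ t → ((O.Γ (O.ref + t • (ξ - O.ref)) < 1 ↔ t < b ξ) ∧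
      (1 < O.Γ (O.ref + t • (ξ - O.ref)) ↔ b ξ < t)) := by
    intro ξ hξ t ht
    have h1 := O.radial_mono _ (sub_ne_zero.mpr hξ)
    have h2 := h1.lt_iff_lt (a := t) (b := b ξ) ht (hb ξ hξ).1.le
    have h3 := h1.lt_iff_lt (a := b ξ) (b := t) (hb ξ hξ).1.le ht
    simp only [(hb ξ hξ).2] at h2 h3
    exact ⟨h2, h3⟩
  have hΓc : ∀ t : ℝ, Continuous fun ξ : E N => O.Γ (O.ref + t • (ξ - O.ref)) := fun t =>
    O.continuous.comp (by fun_prop)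
  have hbc : ContinuousOn b {O.ref}ᶜ := by
    intro ξ hξ
    have hξ' : ξ ≠ O.ref := hξ
    have hne : ∀ᶠ η in 𝓝 ξ, η ≠ O.ref := isOpen_compl_singleton.mem_nhds hξ
    refine ContinuousAt.continuousWithinAt (tendsto_order.mpr ⟨fun a ha => ?_, fun a ha => ?_⟩)
    · rcases le_or_gt 0 a with h0 | h0
      · have := ((hmono ξ hξ' a h0).1.mpr ha)
        filter_upwards [(hΓc a).continuousAt.eventually_lt continuousAt_const this, hne]
          with η h1 h2
        exact (hmono η h2 a h0).1.mp h1
      · filter_upwards [hne] with η h2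
        exact h0.trans (hb η h2).1
    · have h0 : 0 ≤ a := ((hb ξ hξ').1.trans ha).le
      have := ((hmono ξ hξ' a h0).2.mpr ha)
      filter_upwards [continuousAt_const.eventually_lt (hΓc a).continuousAt this, hne]
        with η h1 h2
      exact (hmono η h2 a h0).2.mp h1
  refine ⟨fun ξ => O.ref + b ξ • (ξ - O.ref),
    continuousOn_const.add (hbc.smul (by fun_prop)), ?_⟩
  ext ξ
  constructor
  · intro h
    have hξ : ξ ≠ O.ref := O.ne_ref (ge_of_eq h)
    refine ⟨ξ, hξ, ?_⟩
    have : b ξ = 1 := O.eq_of_Γ_ray_eq hξ (hb ξ hξ).1.le zero_le_one (by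
      rw [(hb ξ hξ).2, Γ_ray_one]; exact h.symm)
    simp [this]
  · rintro ⟨η, hη, rfl⟩
    exact (hb η hη).2

theorem isPreconnected_boundary (hN : 2 ≤ N) : IsPreconnected O.boundary := by
  obtain ⟨g, hg, h⟩ := O.exists_continuousOn_boundary_param
  rw [h]
  refine IsPreconnected.image ?_ g hg
  apply IsConnected.isPreconnected
  apply isConnected_compl_singleton_of_one_lt_rank
  rw [← Module.finrank_eq_rank, finrank_euclideanSpace_fin]
  exact_mod_cast hN

theorem sign_of_continuousOn_boundary (hN : 2 ≤ N) {q : E N → ℝ} (hq : ContinuousOn q O.boundary)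
    (h0 : ∀ ξ ∈ O.boundary, q ξ ≠ 0) :
    (∀ ξ ∈ O.boundary, 0 < q ξ) ∨ (∀ ξ ∈ O.boundary, q ξ < 0) := by
  by_contra! h
  obtain ⟨⟨ξ, hξ, h1⟩, ⟨η, hη, h2⟩⟩ := h
  obtain ⟨ζ, hζ, h3⟩ := (O.isPreconnected_boundary hN).intermediate_value hξ hη hq ⟨h1, h2⟩
  exact h0 ζ hζ h3

end StarObstacle

/-! ### Elementary properties of the rotated dynamics -/

theorem NeverAnticollinear.ne_zero {f c : E N → E N} (hfc : NeverAnticollinear f c) {ξ : E N}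
    (h : f ξ ≠ 0) : c ξ ≠ 0 := by
  intro h0
  have := hfc ξ h
  rw [h0] at this
  simp at this

section Dynamics

variable (O : StarObstacle N) (f c : E N → E N) (Re s : ℝ) {ξ : E N}

theorem norm_kRef (hN : 2 ≤ N) (h : 1 ≤ O.Γ ξ) :
    ‖kRef O ξ‖ = Real.arccos (inner ℝ (-O.normal ξ) (O.refDir ξ)) :=
  norm_toDirSpace hN (O.norm_neg_normal h) (O.norm_refDir (O.ne_ref h))

theorem norm_kConv (hN : 2 ≤ N) (h : 1 ≤ O.Γ ξ) (hc : c ξ ≠ 0) :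
    ‖kConv O c ξ‖ = Real.arccos (inner ℝ (-O.normal ξ) (unitDir (c ξ))) :=
  norm_toDirSpace hN (O.norm_neg_normal h) (norm_unitDir hc)

theorem norm_kRef_lt (hN : 2 ≤ N) (h : 1 ≤ O.Γ ξ) : ‖kRef O ξ‖ < Real.pi / 2 := by
  rw [norm_kRef O hN h, Real.arccos_lt_pi_div_two]
  exact O.inner_neg_normal_refDir_pos h

theorem refRadius_pos (hN : 2 ≤ N) (hRe : Real.pi / 2 ≤ Re) (h : 1 ≤ O.Γ ξ) :
    0 < refRadius O Re ξ :=
  lt_min (by linarith [norm_kRef_lt O hN h]) (by linarith [Real.pi_pos])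

theorem inner_normal_kRef (hN : 2 ≤ N) (h : 1 ≤ O.Γ ξ) :
    inner ℝ (-O.normal ξ) (kRef O ξ) = 0 :=
  inner_toDirSpace hN (O.norm_neg_normal h) _

theorem inner_normal_kConv (hN : 2 ≤ N) (h : 1 ≤ O.Γ ξ) :
    inner ℝ (-O.normal ξ) (kConv O c ξ) = 0 :=
  inner_toDirSpace hN (O.norm_neg_normal h) _

theorem inner_normal_kLine (hN : 2 ≤ N) (h : 1 ≤ O.Γ ξ) (b : ℝ) :
    inner ℝ (-O.normal ξ) (kLine O c ξ b) = 0 := by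
  rw [kLine, inner_add_right, inner_smul_right, inner_smul_right, inner_normal_kRef O hN h,
    inner_normal_kConv O c hN h]
  ring

theorem norm_refDir_sub_le_deltaK (hN : 2 ≤ N) (h : 1 ≤ O.Γ ξ) (hc : c ξ ≠ 0) :
    ‖O.refDir ξ - unitDir (c ξ)‖ ≤ deltaK O c ξ :=
  norm_sub_le_norm_toDirSpace_sub hN (O.norm_neg_normal h) (O.norm_refDir (O.ne_ref h))
    (norm_unitDir hc)

theorem deltaK_nonneg : 0 ≤ deltaK O c ξ := norm_nonneg _

theorem deltaK_eq_zero_iff (hN : 2 ≤ N) (h : 1 ≤ O.Γ ξ) (hc : c ξ ≠ 0) :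
    deltaK O c ξ = 0 ↔ unitDir (c ξ) = O.refDir ξ := by
  constructor
  · intro h0
    have := norm_refDir_sub_le_deltaK O c hN h hc
    rw [h0] at this
    exact (sub_eq_zero.mp (norm_le_zero_iff.mp this)).symm
  · intro h0
    rw [deltaK, kRef, kConv, h0, sub_self, norm_zero]

theorem kLine_eq (b : ℝ) :
    kLine O c ξ b = kRef O ξ + b • (kConv O c ξ - kRef O ξ) := by
  rw [kLine]
  module

theorem exists_norm_kLine_eq (hN : 2 ≤ N) (hRe : Real.pi / 2 ≤ Re) (h : 1 ≤ O.Γ ξ)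
    (hk : deltaK O c ξ ≠ 0) : ∃ b : ℝ, 0 < b ∧ ‖kLine O c ξ b‖ = Re := by
  have hk0 : 0 < deltaK O c ξ := lt_of_le_of_ne (norm_nonneg _) hk.symm
  have hkr := norm_kRef_lt O hN h
  have hR : 0 < Re := lt_of_lt_of_le (by linarith [Real.pi_pos]) hRe
  have hcont : Continuous fun b : ℝ => ‖kLine O c ξ b‖ := by
    unfold kLine
    fun_prop
  -- At this parameter the triangle inequality already gives length at least `Re`, while at `0` the
  -- length is below `π / 2 ≤ Re`.
  set B := (Re + ‖kRef O ξ‖) / deltaK O c ξ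
  have hB : 0 ≤ B := by positivity
  have h1 : ‖kLine O c ξ 0‖ ≤ Re := by
    simp only [kLine, sub_zero, one_smul, zero_smul, add_zero]
    linarith
  have h2 : Re ≤ ‖kLine O c ξ B‖ := by
    have e1 : ‖B • (kConv O c ξ - kRef O ξ)‖ = Re + ‖kRef O ξ‖ := by
      rw [norm_smul, norm_sub_rev, Real.norm_of_nonneg hB]
      exact div_mul_cancel₀ _ hk
    have e2 := norm_sub_norm_le (B • (kConv O c ξ - kRef O ξ)) (-kRef O ξ)
    rw [norm_neg, sub_neg_eq_add, add_comm (B • _), ← kLine_eq, e1] at e2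
    linarith
  obtain ⟨b, hb, hb2⟩ := intermediate_value_Icc hB hcont.continuousOn ⟨h1, h2⟩
  refine ⟨b, lt_of_le_of_ne hb.1 ?_, hb2⟩
  rintro rfl
  simp only [kLine, sub_zero, one_smul, zero_smul, add_zero] at hb2
  linarith

theorem pseudoTangent_eq (hN : 2 ≤ N) (hRe : Real.pi / 2 ≤ Re) (h : 1 ≤ O.Γ ξ)
    (hk : deltaK O c ξ ≠ 0) (hlt : ‖kConv O c ξ‖ < Re) : ∃ b : ℝ, 0 < b ∧ ‖kLine O c ξ b‖ = Re ∧
      pseudoTangent O c Re ξ = ofDirSpace (-O.normal ξ) (kLine O c ξ b) := by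
  have hex := exists_norm_kLine_eq O c Re hN hRe h hk
  refine ⟨hex.choose, hex.choose_spec.1, hex.choose_spec.2, ?_⟩
  rw [pseudoTangent, if_neg (not_le.mpr hlt), dif_pos hex]

theorem pseudoTangent_spec (hN : 2 ≤ N) (hRe : Re ∈ Icc (Real.pi / 2) Real.pi) (h : 1 ≤ O.Γ ξ)
    (hc : c ξ ≠ 0) (hk : deltaK O c ξ ≠ 0) : ‖pseudoTangent O c Re ξ‖ = 1 ∧
      0 ≤ (inner ℝ (O.normal ξ) (pseudoTangent O c Re ξ) : ℝ) := by
  have hcos : ∀ x : ℝ, Re ≤ x → x ≤ Real.pi → Real.cos x ≤ 0 := fun x h1 h2 =>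
    Real.cos_nonpos_of_pi_div_two_le_of_le (hRe.1.trans h1) (by linarith [Real.pi_pos])
  rw [← neg_neg (O.normal ξ), inner_neg_left, Left.nonneg_neg_iff]
  rcases le_or_gt Re ‖kConv O c ξ‖ with hle | hlt
  · rw [pseudoTangent, if_pos hle]
    refine ⟨norm_unitDir hc, ?_⟩
    have hi := inner_mem_Icc (O.norm_neg_normal h) (norm_unitDir hc)
    rw [norm_kConv O c hN h hc] at hle
    rw [← Real.cos_arccos hi.1 hi.2]
    exact hcos _ hle (Real.arccos_le_pi _)
  · obtain ⟨b, -, hb, he⟩ := pseudoTangent_eq O c Re hN hRe.1 h hk hlt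
    rw [he]
    have h1 := inner_normal_kLine O c hN h b
    refine ⟨norm_ofDirSpace (O.norm_neg_normal h) h1, ?_⟩
    rw [inner_ofDirSpace (O.norm_neg_normal h) h1, hb]
    exact hcos _ le_rfl hRe.2

theorem one_le_smoothExp (hs : 0 < s) : 1 ≤ smoothExp O c Re s ξ :=
  Real.one_le_rpow (le_max_left _ _) hs.le

theorem rotWeight_mem (hs : 0 < s) (h : 1 ≤ O.Γ ξ) : rotWeight O c Re s ξ ∈ Icc (0 : ℝ) 1 := by
  rw [rotWeight]
  split_ifs
  · simp
  · have h0 : 0 < O.Γ ξ := by linarith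
    refine ⟨by positivity, Real.rpow_le_one (by positivity) ?_ ?_⟩
    · rw [div_le_one h0]
      exact h
    · linarith [one_le_smoothExp O c Re s (ξ := ξ) hs]

/-- Bernoulli's inequality for `(1 / Γ) ^ q`, followed by `1 - 1 / Γ ≤ Γ - 1`. -/
theorem one_sub_rotWeight_le (hs : 0 < s) (h : 1 ≤ O.Γ ξ) (hk : deltaK O c ξ ≠ 0) :
    1 - rotWeight O c Re s ξ ≤ smoothExp O c Re s ξ * (O.Γ ξ - 1) := by
  rw [rotWeight, if_neg hk]
  have h0 : 0 < O.Γ ξ := by linarith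
  have hq := one_le_smoothExp O c Re s (ξ := ξ) hs
  have h1 : 1 / O.Γ ξ = 1 + (1 / O.Γ ξ - 1) := by ring
  have h2 : 0 < 1 / O.Γ ξ := by positivity
  have h3 := one_add_mul_self_le_rpow_one_add (s := 1 / O.Γ ξ - 1) (by linarith) hq
  rw [← h1] at h3
  have h4 : 1 - 1 / O.Γ ξ ≤ O.Γ ξ - 1 := by
    rw [← sub_nonneg]
    have : O.Γ ξ - 1 - (1 - 1 / O.Γ ξ) = (O.Γ ξ - 1) ^ 2 / O.Γ ξ := by
      field_simp
    rw [this]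
    positivity
  nlinarith [mul_le_mul_of_nonneg_left h4 (by linarith : 0 ≤ smoothExp O c Re s ξ)]

theorem norm_rotDir (hN : 2 ≤ N) (hc : c ξ ≠ 0) : ‖rotDir O f c Re s ξ‖ = 1 := by
  refine norm_ofDirSpace (norm_unitDir hc) ?_
  rw [inner_add_right, inner_smul_right, inner_smul_right, inner_toDirSpace hN (norm_unitDir hc),
    inner_toDirSpace hN (norm_unitDir hc)]
  ring

theorem magScale_nonneg : 0 ≤ magScale O c Re ξ :=
  le_min zero_le_one (by positivity)

theorem magScale_le_one : magScale O c Re ξ ≤ 1 := min_le_left _ _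

theorem norm_dynamics (hN : 2 ≤ N) (hfc : NeverAnticollinear f c) :
    ‖dynamics O f c Re s ξ‖ = magScale O c Re ξ * ‖f ξ‖ := by
  rw [dynamics, norm_smul, Real.norm_of_nonneg (mul_nonneg (magScale_nonneg O c Re)
    (norm_nonneg _))]
  by_cases h : f ξ = 0
  · simp [h]
  · rw [norm_rotDir O f c Re s hN (hfc.ne_zero h), mul_one]

theorem magScale_eq_zero_iff (hN : 2 ≤ N) (hRe : Real.pi / 2 ≤ Re) (h : 1 ≤ O.Γ ξ) :
    magScale O c Re ξ = 0 ↔ deltaK O c ξ = 0 ∧ O.Γ ξ = 1 := by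
  have hR := refRadius_pos O Re hN hRe h
  have h0 : 0 < O.Γ ξ := by linarith
  constructor
  · intro h1
    have h2 : (deltaK O c ξ / refRadius O Re ξ) ^ 2 + (1 - 1 / O.Γ ξ) ^ 2 = 0 := by
      rcases min_choice 1 ((deltaK O c ξ / refRadius O Re ξ) ^ 2 + (1 - 1 / O.Γ ξ) ^ 2)
        with h3 | h3
      · rw [magScale, h3] at h1
        exact absurd h1 one_ne_zero
      · rwa [magScale, h3] at h1
    have h3 : deltaK O c ξ / refRadius O Re ξ = 0 := by
      rw [← sq_eq_zero_iff]
      nlinarith [sq_nonneg (deltaK O c ξ / refRadius O Re ξ), sq_nonneg (1 - 1 / O.Γ ξ)]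
    have h4 : 1 - 1 / O.Γ ξ = 0 := by
      rw [← sq_eq_zero_iff]
      nlinarith [sq_nonneg (deltaK O c ξ / refRadius O Re ξ), sq_nonneg (1 - 1 / O.Γ ξ)]
    refine ⟨(div_eq_zero_iff.mp h3).resolve_right hR.ne', ?_⟩
    field_simp at h4
    linarith
  · rintro ⟨h1, h2⟩
    simp [magScale, h1, h2]

theorem dynamics_eq_zero_iff (hN : 2 ≤ N) (hfc : NeverAnticollinear f c) :
    dynamics O f c Re s ξ = 0 ↔ f ξ = 0 ∨ magScale O c Re ξ = 0 := by
  rw [← norm_eq_zero, norm_dynamics O f c Re s hN hfc, mul_eq_zero, norm_eq_zero, or_comm]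

/-- Both vectors are images under the exponential map at `c`, which does not increase distances. The
preimages differ by `(1 - λ) (k(c, f) - k(c, e))`, and both vectors in this difference have length
at most `π`. -/
theorem norm_rotDir_sub_pseudoTangent_le (hN : 2 ≤ N) (hRe : Re ∈ Icc (Real.pi / 2) Real.pi)
    (hs : 0 < s) (h : 1 ≤ O.Γ ξ) (hf : f ξ ≠ 0) (hc : c ξ ≠ 0) (hk : deltaK O c ξ ≠ 0) :
    ‖rotDir O f c Re s ξ - pseudoTangent O c Re ξ‖ ≤
      (1 - rotWeight O c Re s ξ) * (2 * Real.pi) := by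
  have hb := norm_unitDir hc
  have he := (pseudoTangent_spec O c Re hN hRe h hc hk).1
  conv_lhs => rw [← ofDirSpace_toDirSpace hN hb he]
  have h1 := inner_toDirSpace hN hb (unitDir (f ξ))
  have h2 := inner_toDirSpace hN hb (pseudoTangent O c Re ξ)
  refine (norm_ofDirSpace_sub_le hb (by
    rw [inner_add_right, inner_smul_right, inner_smul_right, h1, h2]; ring) h2).trans ?_
  have h3 : ∀ (l : ℝ) (a b : E N), (1 - l) • a + l • b - b = (1 - l) • (a - b) := by
    intro l a b
    module
  have hl := rotWeight_mem O c Re s hs h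
  rw [h3, norm_smul, Real.norm_of_nonneg (by linarith [hl.2])]
  refine mul_le_mul_of_nonneg_left ((norm_sub_le _ _).trans ?_) (by linarith [hl.2])
  rw [norm_toDirSpace hN hb he, norm_toDirSpace hN hb (norm_unitDir hf), two_mul]
  exact add_le_add (Real.arccos_le_pi _) (Real.arccos_le_pi _)

end Dynamics

/-! ### Invariance of the free space -/

section Dynamics

variable (O : StarObstacle N) (f c : E N → E N) (Re s : ℝ) {ξ₀ : E N}

theorem continuousAt_unitDir_comp (hcd : ContDiff ℝ 1 c) (hc : c ξ₀ ≠ 0) :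
    ContinuousAt (fun ξ => unitDir (c ξ)) ξ₀ :=
  (continuousAt_unitDir hc).comp hcd.continuous.continuousAt

theorem continuousAt_inner_normal_refDir (h : 1 ≤ O.Γ ξ₀) :
    ContinuousAt (fun ξ => (inner ℝ (-O.normal ξ) (O.refDir ξ) : ℝ)) ξ₀ :=
  (O.continuousAt_normal h).neg.inner (𝕜 := ℝ) (O.contDiffAt_refDir (O.ne_ref h)).continuousAt

theorem continuousWithinAt_norm_kRef (hN : 2 ≤ N) (h : 1 ≤ O.Γ ξ₀) :
    ContinuousWithinAt (fun ξ => ‖kRef O ξ‖) {ξ | 1 ≤ O.Γ ξ} ξ₀ := by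
  have h1 : ContinuousWithinAt
      (fun ξ => Real.arccos (inner ℝ (-O.normal ξ) (O.refDir ξ))) {ξ | 1 ≤ O.Γ ξ} ξ₀ :=
    (Real.continuous_arccos.continuousAt.comp
      (continuousAt_inner_normal_refDir O h)).continuousWithinAt
  exact h1.congr (fun ξ hξ => norm_kRef O hN hξ) (norm_kRef O hN h)

/-- The normal is merely continuous, so `k(-n, r)` and `k(-n, c)` need not be differentiable. But
both use the same base `-n`, and `k` is Lipschitz on the hemisphere, so `Δk` is controlled by `r - c
/ ‖c‖`, which is `C¹` and vanishes at `ξ₀`. -/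
theorem isBigO_deltaK (hN : 2 ≤ N) (hcd : ContDiff ℝ 1 c) (h : 1 ≤ O.Γ ξ₀) (hc : c ξ₀ ≠ 0)
    (hk : deltaK O c ξ₀ = 0) :
    deltaK O c =O[𝓝[{ξ | 1 ≤ O.Γ ξ}] ξ₀] fun ξ => ‖ξ - ξ₀‖ := by
  have hcr := (deltaK_eq_zero_iff O c hN h hc).mp hk
  have h1 : ContDiffAt ℝ 1 (fun ξ => O.refDir ξ - unitDir (c ξ)) ξ₀ :=
    (O.contDiffAt_refDir (O.ne_ref h)).sub ((contDiffAt_unitDir hc).comp ξ₀ hcd.contDiffAt)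
  have h2 := (h1.differentiableAt one_ne_zero).isBigO_sub
  simp only [hcr, sub_self, sub_zero] at h2
  refine Asymptotics.IsBigO.trans ?_ (h2.norm_right.mono nhdsWithin_le_nhds)
  refine Asymptotics.IsBigO.of_bound 4 ?_
  have h3 : ContinuousAt (fun ξ => (inner ℝ (-O.normal ξ) (unitDir (c ξ)) : ℝ)) ξ₀ :=
    (O.continuousAt_normal h).neg.inner (𝕜 := ℝ) (continuousAt_unitDir_comp c hcd hc)
  have h4 : 0 < (inner ℝ (-O.normal ξ₀) (unitDir (c ξ₀)) : ℝ) := by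
    rw [hcr]
    exact O.inner_neg_normal_refDir_pos h
  filter_upwards [nhdsWithin_le_nhds (continuousAt_const.eventually_lt h3 h4),
    nhdsWithin_le_nhds (hcd.continuous.continuousAt.eventually_ne hc), self_mem_nhdsWithin]
    with ξ a1 a2 a3
  rw [Real.norm_of_nonneg (deltaK_nonneg O c)]
  exact norm_toDirSpace_sub_le (O.norm_neg_normal a3) (O.norm_refDir (O.ne_ref a3))
    (norm_unitDir a2) (O.inner_neg_normal_refDir_pos a3).le a1.le

theorem isBigO_magScale (hN : 2 ≤ N) (hRe : Real.pi / 2 ≤ Re) (hcd : ContDiff ℝ 1 c)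
    (h : O.Γ ξ₀ = 1) (hc : c ξ₀ ≠ 0) (hk : deltaK O c ξ₀ = 0) :
    magScale O c Re =O[𝓝[{ξ | 1 ≤ O.Γ ξ}] ξ₀] fun ξ => ‖ξ - ξ₀‖ ^ 2 := by
  have h' : 1 ≤ O.Γ ξ₀ := h.ge
  have h1 := isBigO_deltaK O c hN hcd h' hc hk
  have h2 : (fun ξ => (refRadius O Re ξ)⁻¹) =O[𝓝[{ξ | 1 ≤ O.Γ ξ}] ξ₀] fun _ => (1 : ℝ) := by
    refine Tendsto.isBigO_one ℝ (c := (refRadius O Re ξ₀)⁻¹) ?_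
    refine Tendsto.inv₀ ?_ (refRadius_pos O Re hN hRe h').ne'
    exact ((continuousWithinAt_norm_kRef O hN h').const_sub Re).min continuousWithinAt_const
  have h3 : (fun ξ => 1 - 1 / O.Γ ξ) =O[𝓝[{ξ | 1 ≤ O.Γ ξ}] ξ₀] fun ξ => ‖ξ - ξ₀‖ := by
    have hd : DifferentiableAt ℝ (fun ξ => 1 - 1 / O.Γ ξ) ξ₀ := by
      have := (O.contDiffAt_Γ (O.ne_ref h')).differentiableAt one_ne_zero
      have hne : O.Γ ξ₀ ≠ 0 := by rw [h]; exact one_ne_zero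
      simp only [one_div]
      exact (differentiableAt_const _).sub (this.inv hne)
    have := hd.isBigO_sub
    simp only [h, div_one, sub_self, sub_zero] at this
    exact (this.mono nhdsWithin_le_nhds).norm_right
  have h4 := ((h1.mul h2).pow 2).add (h3.pow 2 |>.trans (by
    simpa using Asymptotics.isBigO_refl (fun ξ => ‖ξ - ξ₀‖ ^ 2) _))
  simp only [mul_one] at h4
  refine Asymptotics.IsBigO.trans (Asymptotics.IsBigO.of_bound 1 ?_) h4
  filter_upwards with ξ
  rw [Real.norm_of_nonneg (magScale_nonneg O c Re), one_mul, ← div_eq_mul_inv]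
  exact (min_le_right _ _).trans (le_abs_self _)

theorem isBigO_dynamics (hN : 2 ≤ N) (hRe : Real.pi / 2 ≤ Re) (hfd : ContDiff ℝ 1 f)
    (hcd : ContDiff ℝ 1 c) (hfc : NeverAnticollinear f c) (h : O.Γ ξ₀ = 1)
    (h0 : f ξ₀ = 0 ∨ deltaK O c ξ₀ = 0) :
    dynamics O f c Re s =O[𝓝[{ξ | 1 ≤ O.Γ ξ}] ξ₀] fun ξ => ‖ξ - ξ₀‖ := by
  have hn : dynamics O f c Re s =O[𝓝[{ξ | 1 ≤ O.Γ ξ}] ξ₀]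
      fun ξ => magScale O c Re ξ * ‖f ξ‖ := by
    refine Asymptotics.IsBigO.of_bound 1 (Eventually.of_forall fun ξ => ?_)
    rw [norm_dynamics O f c Re s hN hfc, one_mul]
    exact le_abs_self _
  refine hn.trans ?_
  by_cases hf : f ξ₀ = 0
  · have h1 := (hfd.differentiable one_ne_zero ξ₀).isBigO_sub
    simp only [hf, sub_zero] at h1
    have h2 : magScale O c Re =O[𝓝[{ξ | 1 ≤ O.Γ ξ}] ξ₀] fun _ => (1 : ℝ) := by
      refine Asymptotics.IsBigO.of_bound 1 (Eventually.of_forall fun ξ => ?_)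
      rw [Real.norm_of_nonneg (magScale_nonneg O c Re)]
      simpa using magScale_le_one O c Re
    simpa using h2.mul ((h1.mono nhdsWithin_le_nhds).norm_left.norm_right)
  · have hk := h0.resolve_left hf
    have h1 := isBigO_magScale O c Re hN hRe hcd h (hfc.ne_zero hf) hk
    have h2 : (fun ξ => ‖f ξ‖) =O[𝓝[{ξ | 1 ≤ O.Γ ξ}] ξ₀] fun _ => (1 : ℝ) :=
      (hfd.continuous.norm.tendsto ξ₀).mono_left nhdsWithin_le_nhds |>.isBigO_one ℝ
    have h3 := h1.mul h2
    simp only [mul_one] at h3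
    refine h3.trans ?_
    have h4 : (fun ξ => ‖ξ - ξ₀‖) =O[𝓝[{ξ | 1 ≤ O.Γ ξ}] ξ₀] fun _ => (1 : ℝ) := by
      have : Continuous fun ξ : E N => ‖ξ - ξ₀‖ := by fun_prop
      exact (this.tendsto ξ₀).mono_left nhdsWithin_le_nhds |>.isBigO_one ℝ
    simpa [sq] using h4.mul (Asymptotics.isBigO_refl (fun ξ => ‖ξ - ξ₀‖) _)

theorem exists_inner_gradient_dynamics_ge (hN : 2 ≤ N) (hRe : Re ∈ Icc (Real.pi / 2) Real.pi)
    (hs : 0 < s) (hfd : ContDiff ℝ 1 f) (hcd : ContDiff ℝ 1 c) (hfc : NeverAnticollinear f c)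
    (h : 1 ≤ O.Γ ξ₀) (hf : f ξ₀ ≠ 0) (hk : deltaK O c ξ₀ ≠ 0) :
    ∃ C : ℝ, ∀ᶠ ξ in 𝓝[{ξ | 1 ≤ O.Γ ξ}] ξ₀,
      -(C * (O.Γ ξ - 1)) ≤ inner ℝ (gradient O.Γ ξ) (dynamics O f c Re s ξ) := by
  have hc := hfc.ne_zero hf
  have hne : 0 < ‖O.refDir ξ₀ - unitDir (c ξ₀)‖ := by
    rw [norm_sub_pos_iff]
    exact fun h1 => hk ((deltaK_eq_zero_iff O c hN h hc).mpr h1.symm)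
  -- `δ` bounds `Δk` below near `ξ₀`; since `Rʳ ≤ π / 2`, this bounds the exponent `q` by `Q`. The
  -- constant `M` bounds `‖∇Γ‖ ‖f‖`.
  obtain ⟨δ, hδ0, hδ⟩ := exists_between hne
  have hcont : ContinuousAt (fun ξ => ‖O.refDir ξ - unitDir (c ξ)‖) ξ₀ :=
    ((O.contDiffAt_refDir (O.ne_ref h)).continuousAt.sub
      (continuousAt_unitDir_comp c hcd hc)).norm
  have hM : ContinuousAt (fun ξ => ‖gradient O.Γ ξ‖ * ‖f ξ‖) ξ₀ :=
    (O.continuousAt_gradient_Γ (O.ne_ref h)).norm.mul hfd.continuous.continuousAt.norm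
  set M := ‖gradient O.Γ ξ₀‖ * ‖f ξ₀‖ + 1
  set Q := (max 1 (Real.pi / 2 / δ)) ^ s
  refine ⟨M * (Q * (2 * Real.pi)), ?_⟩
  filter_upwards [nhdsWithin_le_nhds (continuousAt_const.eventually_lt hcont hδ),
    nhdsWithin_le_nhds (hM.eventually_lt continuousAt_const (lt_add_one _)),
    nhdsWithin_le_nhds (hcd.continuous.continuousAt.eventually_ne hc),
    nhdsWithin_le_nhds (hfd.continuous.continuousAt.eventually_ne hf), self_mem_nhdsWithin]
    with ξ a1 a2 a3 a4 a5
  have a5 : 1 ≤ O.Γ ξ := a5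
  have hδk : δ < deltaK O c ξ := a1.trans_le (norm_refDir_sub_le_deltaK O c hN a5 a3)
  have hk' : deltaK O c ξ ≠ 0 := (hδ0.trans hδk).ne'
  have hQ : smoothExp O c Re s ξ ≤ Q := by
    refine Real.rpow_le_rpow (by positivity) (max_le_max le_rfl ?_) hs.le
    exact div_le_div₀ (by positivity) (min_le_right _ _) hδ0 hδk.le
  have h1 := (one_sub_rotWeight_le O c Re s hs a5 hk').trans
    (mul_le_mul_of_nonneg_right hQ (sub_nonneg.mpr a5))
  have h2 := norm_rotDir_sub_pseudoTangent_le O f c Re s hN hRe hs a5 a4 a3 hk'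
  have h3 : 0 ≤ (inner ℝ (gradient O.Γ ξ) (pseudoTangent O c Re ξ) : ℝ) := by
    have := (pseudoTangent_spec O c Re hN hRe a5 a3 hk').2
    rw [← norm_smul_unitDir (gradient O.Γ ξ), inner_smul_left, conj_trivial]
    exact mul_nonneg (norm_nonneg _) this
  have h4 : -(‖gradient O.Γ ξ‖ * ((Q * (O.Γ ξ - 1)) * (2 * Real.pi))) ≤
      inner ℝ (gradient O.Γ ξ) (rotDir O f c Re s ξ) := by
    have e1 := abs_le.mp (abs_real_inner_le_norm (gradient O.Γ ξ)
      (rotDir O f c Re s ξ - pseudoTangent O c Re ξ))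
    rw [inner_sub_right] at e1
    have e2 := mul_le_mul_of_nonneg_left (h2.trans
      (mul_le_mul_of_nonneg_right h1 (by positivity))) (norm_nonneg (gradient O.Γ ξ))
    linarith [e1.1]
  have hh0 := magScale_nonneg O c Re (ξ := ξ)
  have hh1 := magScale_le_one O c Re (ξ := ξ)
  rw [dynamics, inner_smul_right]
  have hQ0 : 0 ≤ Q * (O.Γ ξ - 1) * (2 * Real.pi) :=
    mul_nonneg (mul_nonneg (by positivity) (by linarith)) (by positivity)
  calc -(M * (Q * (2 * Real.pi)) * (O.Γ ξ - 1))
      = -(M * (Q * (O.Γ ξ - 1) * (2 * Real.pi))) := by ring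
    _ ≤ -(1 * (‖gradient O.Γ ξ‖ * ‖f ξ‖) * (Q * (O.Γ ξ - 1) * (2 * Real.pi))) := by
        rw [one_mul]
        exact neg_le_neg (mul_le_mul_of_nonneg_right a2.le hQ0)
    _ ≤ -(magScale O c Re ξ * (‖gradient O.Γ ξ‖ * ‖f ξ‖) *
          (Q * (O.Γ ξ - 1) * (2 * Real.pi))) := by
        exact neg_le_neg (mul_le_mul_of_nonneg_right
          (mul_le_mul_of_nonneg_right hh1 (by positivity)) hQ0)
    _ = magScale O c Re ξ * ‖f ξ‖ *
          -(‖gradient O.Γ ξ‖ * ((Q * (O.Γ ξ - 1)) * (2 * Real.pi))) := by ring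
    _ ≤ _ := mul_le_mul_of_nonneg_left h4 (by positivity)

end Dynamics

/-- A function with `g' ≥ -C g` does not reach zero from positive values. -/
theorem pos_of_neg_mul_le_deriv {g g' : ℝ → ℝ} {a b C : ℝ} (hab : a ≤ b)
    (hg : ContinuousOn g (Icc a b)) (hd : ∀ t ∈ Ioo a b, HasDerivAt g (g' t) t)
    (hC : ∀ t ∈ Ioo a b, -(C * g t) ≤ g' t) (ha : 0 < g a) : 0 < g b := by
  -- The integrating factor `exp (C t)` turns the inequality into monotonicity.
  have hd' : ∀ t ∈ interior (Icc a b), HasDerivAt (fun t => g t * Real.exp (C * t))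
      (g' t * Real.exp (C * t) + g t * (Real.exp (C * t) * (C * 1))) t := by
    intro t ht
    rw [interior_Icc] at ht
    exact (hd t ht).mul ((hasDerivAt_id t).const_mul C).exp
  have hmono : MonotoneOn (fun t => g t * Real.exp (C * t)) (Icc a b) := by
    refine monotoneOn_of_deriv_nonneg (convex_Icc a b) (hg.mul (by fun_prop))
      (fun t ht => (hd' t ht).differentiableAt.differentiableWithinAt) fun t ht => ?_
    rw [(hd' t ht).deriv]
    rw [interior_Icc] at ht
    have := hC t ht
    have h2 := Real.exp_pos (C * t)
    nlinarith
  have h1 := hmono (left_mem_Icc.mpr hab) (right_mem_Icc.mpr hab) hab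
  have h2 := mul_pos ha (Real.exp_pos (C * a))
  exact pos_of_mul_pos_left (h2.trans_le h1) (Real.exp_pos _).le

theorem mem_free_of_integralCurve (hN : 2 ≤ N) (O : StarObstacle N) (f c : E N → E N)
    (hfd : ContDiff ℝ 1 f) (hcd : ContDiff ℝ 1 c) (hfc : NeverAnticollinear f c) (Re s : ℝ)
    (hRe : Re ∈ Icc (Real.pi / 2) Real.pi) (hs : 0 < s) (T : ℝ) (x : ℝ → E N)
    (hx : ContinuousOn x (Icc 0 T))
    (hd : IsIntegralCurveOn x (fun _ => dynamics O f c Re s) (Ico 0 T)) (h0 : x 0 ∈ O.free) :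
    ∀ t ∈ Icc 0 T, x t ∈ O.free := by
  by_contra! hcon
  obtain ⟨t₁, ht₁, hbad⟩ := hcon
  have hΓx : ContinuousOn (fun t => O.Γ (x t)) (Icc 0 T) := O.continuous.comp_continuousOn hx
  set B := {t ∈ Icc 0 T | O.Γ (x t) ≤ 1}
  have hBc : IsClosed B := isClosed_Icc.isClosed_le hΓx continuousOn_const
  have hBne : B.Nonempty := ⟨t₁, ht₁, not_lt.mp hbad⟩
  have hBb : BddBelow B := ⟨0, fun t ht => ht.1.1⟩
  set τ := sInf B
  have hτ : τ ∈ B := hBc.csInf_mem hBne hBb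
  have hτ0 : 0 < τ := by
    refine lt_of_le_of_ne hτ.1.1 fun h => ?_
    have := hτ.2
    rw [← h] at this
    exact absurd h0 (not_lt.mpr this)
  have hlt : ∀ t ∈ Ico 0 τ, 1 < O.Γ (x t) := by
    intro t ht
    by_contra! h
    exact absurd (csInf_le hBb ⟨⟨ht.1, ht.2.le.trans hτ.1.2⟩, h⟩) (not_le.mpr ht.2)
  have hτx : ContinuousWithinAt x (Ico 0 τ) τ :=
    (hx τ hτ.1).mono fun t ht => ⟨ht.1, ht.2.le.trans hτ.1.2⟩
  have hnb : (𝓝[Ico 0 τ] τ).NeBot := by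
    rw [← mem_closure_iff_nhdsWithin_neBot, closure_Ico hτ0.ne]
    exact right_mem_Icc.mpr hτ0.le
  have hΓτ : O.Γ (x τ) = 1 := by
    refine le_antisymm hτ.2 ?_
    refine ge_of_tendsto (O.continuous.continuousAt.tendsto.comp hτx) ?_
    filter_upwards [self_mem_nhdsWithin] with t ht
    exact (hlt t ht).le
  -- The derivative is used only before `τ`: for `τ = T` the motion is known to be continuous at `τ`
  -- but not to be differentiable there.
  have hderiv : ∀ t ∈ Ioo 0 τ, HasDerivAt x (dynamics O f c Re s (x t)) t := fun t ht =>
    (hd t ⟨ht.1.le, ht.2.trans_le hτ.1.2⟩).hasDerivAt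
      (Ico_mem_nhds ht.1 (ht.2.trans_le hτ.1.2))
  have hto : Tendsto x (𝓝[Ico 0 τ] τ) (𝓝[{ξ | 1 ≤ O.Γ ξ}] (x τ)) :=
    tendsto_nhdsWithin_iff.mpr ⟨hτx, by
      filter_upwards [self_mem_nhdsWithin] with t ht
      exact (hlt t ht).le⟩
  -- an eventual property near `x τ` holds on a final segment of time
  have hseg : ∀ P : E N → Prop, (∀ᶠ ξ in 𝓝[{ξ | 1 ≤ O.Γ ξ}] (x τ), P ξ) →
      ∃ a ∈ Ico 0 τ, ∀ t ∈ Ioo a τ, P (x t) := by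
    intro P hP
    have h1 := hto.eventually hP
    rw [nhdsWithin_Ico_eq_nhdsLT hτ0] at h1
    obtain ⟨a, ha, ha2⟩ := (mem_nhdsLT_iff_exists_mem_Ico_Ioo_subset hτ0).mp h1
    exact ⟨a, ha, fun t ht => ha2 ht⟩
  by_cases hcase : f (x τ) = 0 ∨ deltaK O c (x τ) = 0
  -- The squared distance to `x τ` decreases at a relative rate of at most `2 C`, so it cannot
  -- vanish at time `τ`.
  · obtain ⟨C, hC⟩ := (isBigO_dynamics O f c Re s hN hRe.1 hfd hcd hfc hΓτ hcase).bound
    obtain ⟨a, ha, hP⟩ := hseg _ hC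
    have hpos : 0 < ‖x a - x τ‖ ^ 2 := by
      have : x a ≠ x τ := fun h => by
        have h2 := hlt a ha
        rw [h, hΓτ] at h2
        exact lt_irrefl _ h2
      have := norm_pos_iff.mpr (sub_ne_zero.mpr this)
      positivity
    have := pos_of_neg_mul_le_deriv (g := fun t => ‖x t - x τ‖ ^ 2)
      (g' := fun t => 2 * inner ℝ (x t - x τ) (dynamics O f c Re s (x t))) (C := 2 * C)
      ha.2.le (by
        refine ContinuousOn.pow (ContinuousOn.norm (ContinuousOn.sub ?_ continuousOn_const)) 2
        exact hx.mono (Icc_subset_Icc ha.1 hτ.1.2))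
      (fun t ht => ((hderiv t ⟨ha.1.trans_lt ht.1, ht.2⟩).sub_const _).norm_sq)
      (fun t ht => by
        have h1 := hP t ht
        rw [norm_norm] at h1
        have h2 := (abs_le.mp (abs_real_inner_le_norm (x t - x τ)
          (dynamics O f c Re s (x t)))).1
        have h3 := mul_le_mul_of_nonneg_left h1 (norm_nonneg (x t - x τ))
        nlinarith) hpos
    simp at this
  · push Not at hcase
    obtain ⟨C, hC⟩ := exists_inner_gradient_dynamics_ge O f c Re s hN hRe hs hfd hcd hfc hΓτ.ge
      hcase.1 hcase.2
    obtain ⟨a, ha, hP⟩ := hseg _ hC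
    have := pos_of_neg_mul_le_deriv (g := fun t => O.Γ (x t) - 1)
      (g' := fun t => inner ℝ (gradient O.Γ (x t)) (dynamics O f c Re s (x t))) (C := C)
      ha.2.le ((hΓx.mono (Icc_subset_Icc ha.1 hτ.1.2)).sub continuousOn_const)
      (fun t ht => by
        have h1 := hderiv t ⟨ha.1.trans_lt ht.1, ht.2⟩
        have h2 := O.ne_ref (hlt t ⟨ha.1.trans ht.1.le, ht.2⟩).le
        have h3 := O.hasDerivWithinAt_Γ_comp h2 (h1.hasDerivWithinAt (s := univ))
        rw [hasDerivWithinAt_univ] at h3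
        exact h3.sub_const 1)
      (fun t ht => hP t ht) (sub_pos.mpr (hlt a ha))
    simp only [hΓτ, sub_self, lt_irrefl] at this

/-! ### Where a line in direction space meets a sphere -/

/-- The positive parameter at which the line from `k` in the direction `d` meets the sphere of
radius `R`, if `‖k‖ < R`. -/
noncomputable def hitParam (R : ℝ) (k d : E N) : ℝ :=
  (-inner ℝ k d + √((inner ℝ k d) ^ 2 + ‖d‖ ^ 2 * (R ^ 2 - ‖k‖ ^ 2))) / ‖d‖ ^ 2

theorem sq_sub_sq_pos {R : ℝ} {k : E N} (hk : ‖k‖ < R) : 0 < R ^ 2 - ‖k‖ ^ 2 := by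
  nlinarith [norm_nonneg k]

theorem lt_sqrt_hitParam {R : ℝ} {k d : E N} (hk : ‖k‖ < R) (hd : d ≠ 0) :
    |inner ℝ k d| < √((inner ℝ k d) ^ 2 + ‖d‖ ^ 2 * (R ^ 2 - ‖k‖ ^ 2)) := by
  rw [← Real.sqrt_sq_eq_abs]
  apply Real.sqrt_lt_sqrt (sq_nonneg _)
  have := norm_pos_iff.mpr hd
  have := sq_sub_sq_pos hk
  have : 0 < ‖d‖ ^ 2 * (R ^ 2 - ‖k‖ ^ 2) := by positivity
  linarith

theorem hitParam_pos {R : ℝ} {k d : E N} (hk : ‖k‖ < R) (hd : d ≠ 0) : 0 < hitParam R k d := by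
  have h1 := lt_sqrt_hitParam hk hd
  have h2 := norm_pos_iff.mpr hd
  have h3 := le_abs_self (inner ℝ k d : ℝ)
  exact div_pos (by linarith) (by positivity)

/-- The quadratic equation for `t` has roots of opposite signs because `‖k‖ < R`, so the positive
one is given by the positive square root. -/
theorem eq_hitParam {R : ℝ} {k d : E N} (hk : ‖k‖ < R) (hd : d ≠ 0) {t : ℝ} (ht : 0 < t)
    (h : ‖k + t • d‖ = R) : t = hitParam R k d := by
  have hd0 := norm_pos_iff.mpr hd
  have hp := sq_sub_sq_pos hk
  have h1 : ‖k + t • d‖ ^ 2 = R ^ 2 := by rw [h]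
  rw [norm_add_sq_real, inner_smul_right, norm_smul, Real.norm_of_nonneg ht.le] at h1
  have h2 : (inner ℝ k d) ^ 2 + ‖d‖ ^ 2 * (R ^ 2 - ‖k‖ ^ 2) = (t * ‖d‖ ^ 2 + inner ℝ k d) ^ 2 := by
    linear_combination (-‖d‖ ^ 2) * h1
  have h3 : 0 ≤ t * ‖d‖ ^ 2 + inner ℝ k d := by
    by_contra! hneg
    have h4 : t * (t * ‖d‖ ^ 2 + inner ℝ k d) + t * inner ℝ k d = R ^ 2 - ‖k‖ ^ 2 := by
      linear_combination h1
    have h5 : (inner ℝ k d : ℝ) < 0 := by nlinarith [mul_pos ht (pow_pos hd0 2)]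
    nlinarith
  rw [hitParam, h2, Real.sqrt_sq h3]
  field_simp
  ring

theorem tendsto_hitParam {X : Type*} {l : Filter X} {R : ℝ} {k d : X → E N} {k₀ d₀ : E N}
    (hk : Tendsto k l (𝓝 k₀)) (hd : Tendsto d l (𝓝 d₀)) (h0 : d₀ ≠ 0) :
    Tendsto (fun x => hitParam R (k x) (d x)) l (𝓝 (hitParam R k₀ d₀)) := by
  have hi := hk.inner (𝕜 := ℝ) hd
  refine Tendsto.div (hi.neg.add (Tendsto.sqrt ?_)) (hd.norm.pow 2)
    (pow_ne_zero 2 (norm_ne_zero_iff.mpr h0))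
  exact (hi.pow 2).add ((hd.norm.pow 2).mul ((hk.norm.pow 2).const_sub (R ^ 2)))

/-! ### The derivative of the inverse exponential map -/

/-- The derivative of `toDirSpace m` at `u` in the direction `w`. -/
noncomputable def toDirSpaceDeriv (m u w : E N) : E N :=
  logFactor (inner ℝ m u) • (w - (inner ℝ m w) • m) +
    ((inner ℝ m u * logFactor (inner ℝ m u) - 1) / (1 - (inner ℝ m u) ^ 2) * inner ℝ m w) •
      (u - (inner ℝ m u) • m)

theorem inner_sub_smul_sub_smul {m u w : E N} (hm : ‖m‖ = 1) :
    inner ℝ (u - (inner ℝ m u) • m) (w - (inner ℝ m w) • m) =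
      inner ℝ u w - inner ℝ m u * inner ℝ m w := by
  simp only [inner_sub_left, inner_sub_right, inner_smul_left, inner_smul_right, conj_trivial,
    real_inner_self_eq_norm_sq, hm, real_inner_comm m u]
  ring

/-- Write `c = ⟨m, u⟩`, `μ = ⟨m, w⟩`, `g = logFactor c`, `k` for the vector at `u`, `d` for the
derivative and `τ` for the hitting parameter. Then `⟨k, w⟩ = -g c μ` and `⟨k, d⟩ = -g μ`, so the
formula for `τ` gives `τ ‖d‖² > g μ`. The claim `τ ⟨d, w⟩ > g c μ` follows from signs if `μ ≤ 0`,
and from `⟨d, w⟩ ≥ c ‖d‖²` if `μ > 0`. -/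
theorem hit_toDirSpaceDeriv_pos (hN : 2 ≤ N) {m u w : E N} (hm : ‖m‖ = 1) (hu : ‖u‖ = 1)
    (hmu : 0 < (inner ℝ m u : ℝ)) (hw : ‖w‖ = 1) (huw : inner ℝ u w = 0) :
    toDirSpaceDeriv m u w ≠ 0 ∧
    0 < (inner ℝ (toDirSpace m u +
      hitParam (Real.pi / 2) (toDirSpace m u) (toDirSpaceDeriv m u w) • toDirSpaceDeriv m u w)
      w : ℝ) := by
  have hk : ‖toDirSpace m u‖ < Real.pi / 2 := by
    rw [norm_toDirSpace hN hm hu, Real.arccos_lt_pi_div_two]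
    exact hmu
  have hk0 := toDirSpace_eq_logFactor hm hu (by linarith)
  have hc1 := (inner_mem_Icc hm hu).2
  have huu := inner_sub_smul_sub_smul (u := u) (w := u) hm
  have huw' := inner_sub_smul_sub_smul (u := u) (w := w) hm
  have hww := inner_sub_smul_sub_smul (u := w) (w := w) hm
  have hkw : (inner ℝ (u - (inner ℝ m u) • m) w : ℝ) = -(inner ℝ m u * inner ℝ m w) := by
    rw [inner_sub_left, inner_smul_left, huw, conj_trivial]
    ring
  have hww' : (inner ℝ (w - (inner ℝ m w) • m) w : ℝ) = 1 - (inner ℝ m w) ^ 2 := by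
    rw [inner_sub_left, inner_smul_left, conj_trivial, real_inner_self_eq_norm_sq, hw]
    ring
  -- Bessel's inequality for `m` and the orthonormal pair `u`, `w`.
  have hbes : (inner ℝ m w : ℝ) ^ 2 ≤ 1 - (inner ℝ m u) ^ 2 := by
    have h1 : 0 ≤ ‖m - (inner ℝ m u) • u - (inner ℝ m w) • w‖ ^ 2 := by positivity
    rw [← real_inner_self_eq_norm_sq] at h1
    simp only [inner_sub_left, inner_sub_right, inner_smul_left, inner_smul_right, conj_trivial,
      real_inner_self_eq_norm_sq, hm, hu, hw, huw, real_inner_comm u w, real_inner_comm m u,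
      real_inner_comm m w] at h1
    nlinarith
  rw [real_inner_self_eq_norm_sq u, hu] at huu
  rw [real_inner_self_eq_norm_sq w, hw] at hww
  rw [huw] at huw'
  -- This also holds for `m = u`, where the quotient is `0 / 0 = 0` and both sides vanish.
  have hg1 : (inner ℝ m u * logFactor (inner ℝ m u) - 1) / (1 - (inner ℝ m u) ^ 2) *
      (1 - (inner ℝ m u : ℝ) ^ 2) = inner ℝ m u * logFactor (inner ℝ m u) - 1 := by
    rcases hc1.eq_or_lt with h | h
    · rw [h, logFactor_one]
      norm_num
    · exact div_mul_cancel₀ _ (by nlinarith)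
  have hg1' : (inner ℝ m u * logFactor (inner ℝ m u) - 1) / (1 - (inner ℝ m u) ^ 2) ≤ 0 :=
    div_nonpos_of_nonpos_of_nonneg (by linarith [mul_logFactor_le_one hmu.le hc1]) (by nlinarith)
  have hcg := mul_logFactor_le_one hmu.le hc1
  have hg := one_le_logFactor (by linarith : -1 < (inner ℝ m u : ℝ))
  have hpos := fun hd => hitParam_pos (d := toDirSpaceDeriv m u w) hk hd
  have hlt := fun hd => lt_sqrt_hitParam (d := toDirSpaceDeriv m u w) hk hd
  have hdef : hitParam (Real.pi / 2) (toDirSpace m u) (toDirSpaceDeriv m u w) =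
    (-inner ℝ (toDirSpace m u) (toDirSpaceDeriv m u w) +
      √((inner ℝ (toDirSpace m u) (toDirSpaceDeriv m u w)) ^ 2 +
      ‖toDirSpaceDeriv m u w‖ ^ 2 * ((Real.pi / 2) ^ 2 - ‖toDirSpace m u‖ ^ 2))) /
      ‖toDirSpaceDeriv m u w‖ ^ 2 := rfl
  set τ := hitParam (Real.pi / 2) (toDirSpace m u) (toDirSpaceDeriv m u w)
  have hiw : (inner ℝ (toDirSpace m u) w : ℝ) =
      -(logFactor (inner ℝ m u) * (inner ℝ m u * inner ℝ m w)) := by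
    rw [hk0, inner_smul_left, conj_trivial, hkw]
    ring
  -- Geometrically this is half the derivative of `arccos² ⟨m, u⟩`, the squared length of
  -- `toDirSpace m u`.
  have hid : (inner ℝ (toDirSpace m u) (toDirSpaceDeriv m u w) : ℝ) =
      -(logFactor (inner ℝ m u) * inner ℝ m w) := by
    rw [hk0, toDirSpaceDeriv]
    simp only [inner_smul_left, inner_add_right, inner_smul_right, conj_trivial, huu, huw']
    linear_combination (logFactor (inner ℝ m u) * inner ℝ m w) * hg1
  have hdw : (inner ℝ (toDirSpaceDeriv m u w) w : ℝ) =
      logFactor (inner ℝ m u) * (1 - (inner ℝ m w) ^ 2) -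
      (inner ℝ m u * logFactor (inner ℝ m u) - 1) / (1 - (inner ℝ m u) ^ 2) * inner ℝ m u *
        (inner ℝ m w) ^ 2 := by
    rw [toDirSpaceDeriv]
    simp only [inner_smul_left, inner_add_left, conj_trivial, hkw, hww']
    ring
  have hdd : ‖toDirSpaceDeriv m u w‖ ^ 2 =
      logFactor (inner ℝ m u) ^ 2 * (1 - (inner ℝ m w) ^ 2) -
      2 * logFactor (inner ℝ m u) *
        ((inner ℝ m u * logFactor (inner ℝ m u) - 1) / (1 - (inner ℝ m u) ^ 2)) * inner ℝ m u *
        (inner ℝ m w) ^ 2 +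
      ((inner ℝ m u * logFactor (inner ℝ m u) - 1) / (1 - (inner ℝ m u) ^ 2)) *
        (inner ℝ m w) ^ 2 * (inner ℝ m u * logFactor (inner ℝ m u) - 1) := by
    rw [← real_inner_self_eq_norm_sq, toDirSpaceDeriv]
    simp only [inner_smul_left, inner_smul_right, inner_add_left, inner_add_right, conj_trivial,
      huu, huw', hww, real_inner_comm (u - (inner ℝ m u) • m) (w - (inner ℝ m w) • m)]
    linear_combination ((inner ℝ m u * logFactor (inner ℝ m u) - 1) / (1 - (inner ℝ m u) ^ 2) *
      (inner ℝ m w) ^ 2) * hg1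
  rw [inner_add_left, inner_smul_left, conj_trivial, hiw]
  rw [hid] at hdef hlt
  generalize (inner ℝ m u * logFactor (inner ℝ m u) - 1) / (1 - (inner ℝ m u) ^ 2) = g₁ at *
  generalize logFactor (inner ℝ m u) = g at *
  have hdw0 : 0 < (inner ℝ (toDirSpaceDeriv m u w) w : ℝ) := by
    rw [hdw]
    have e1 : 0 < g * (1 - (inner ℝ m w) ^ 2) := by
      refine mul_pos (by linarith) ?_
      nlinarith [pow_pos hmu 2]
    have e2 : g₁ * inner ℝ m u * (inner ℝ m w) ^ 2 ≤ 0 :=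
      mul_nonpos_of_nonpos_of_nonneg (mul_nonpos_of_nonpos_of_nonneg hg1' hmu.le) (sq_nonneg _)
    linarith
  have hd0 : toDirSpaceDeriv m u w ≠ 0 := fun h => by simp [h] at hdw0
  refine ⟨hd0, ?_⟩
  have hdn : 0 < ‖toDirSpaceDeriv m u w‖ ^ 2 := pow_pos (norm_pos_iff.mpr hd0) 2
  rcases le_or_gt (inner ℝ m w : ℝ) 0 with hμ | hμ
  · have e1 : g * (inner ℝ m u * inner ℝ m w) ≤ 0 :=
      mul_nonpos_of_nonneg_of_nonpos (by linarith) (mul_nonpos_of_nonneg_of_nonpos hmu.le hμ)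
    linarith [mul_pos (hpos hd0) hdw0]
  · have hτ : g * inner ℝ m w < τ * ‖toDirSpaceDeriv m u w‖ ^ 2 := by
      rw [hdef, div_mul_cancel₀ _ hdn.ne']
      have e2 := hlt hd0
      have e3 := abs_nonneg (-(g * inner ℝ m w))
      linarith
    have hs2 : 0 < 1 - (inner ℝ m u : ℝ) ^ 2 := lt_of_lt_of_le (pow_pos hμ 2) hbes
    -- Multiplied by `1 - c²`, the difference factors as `g (1 - c g) (1 - c² - μ²)`; the factors
    -- are nonnegative by `mul_logFactor_le_one` and Bessel's inequality.
    have e4 : 0 ≤ inner ℝ (toDirSpaceDeriv m u w) w - inner ℝ m u * ‖toDirSpaceDeriv m u w‖ ^ 2 := by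
      refine nonneg_of_mul_nonneg_right ?_ hs2
      have e5 : (1 - (inner ℝ m u) ^ 2) *
          (inner ℝ (toDirSpaceDeriv m u w) w - inner ℝ m u * ‖toDirSpaceDeriv m u w‖ ^ 2) =
          g * (1 - inner ℝ m u * g) * ((1 - (inner ℝ m u) ^ 2) - (inner ℝ m w) ^ 2) := by
        rw [hdw, hdd]
        linear_combination (g * (inner ℝ m u) ^ 2 * (inner ℝ m w) ^ 2) * hg1
      rw [e5]
      exact mul_nonneg (mul_nonneg (by linarith) (by linarith)) (by linarith)
    refine pos_of_mul_pos_left (b := ‖toDirSpaceDeriv m u w‖ ^ 2) ?_ hdn.le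
    have hgμ : 0 < g * inner ℝ m w := mul_pos (by linarith) hμ
    nlinarith [mul_nonneg hgμ.le e4, mul_pos (sub_pos.mpr hτ) hdw0]

/-! ### Limits of direction space vectors and of their difference quotients, with a moving base. -/

section Limits

variable {X : Type*} {l : Filter X} {m r v w : X → E N} {κ : X → ℝ} {m₀ u w₀ : E N}

theorem tendsto_toDirSpace (hm₀ : ‖m₀‖ = 1) (hu : ‖u‖ = 1) (hmu : 0 < (inner ℝ m₀ u : ℝ))
    (hm1 : ∀ᶠ x in l, ‖m x‖ = 1) (hr1 : ∀ᶠ x in l, ‖r x‖ = 1)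
    (hm : Tendsto m l (𝓝 m₀)) (hr : Tendsto r l (𝓝 u)) :
    Tendsto (fun x => toDirSpace (m x) (r x)) l (𝓝 (toDirSpace m₀ u)) := by
  have hi : Tendsto (fun x => (inner ℝ (m x) (r x) : ℝ)) l (𝓝 (inner ℝ m₀ u)) :=
    hm.inner (𝕜 := ℝ) hr
  rw [toDirSpace_eq_logFactor hm₀ hu (by linarith)]
  have h1 := ((continuousAt_logFactor (by linarith : -1 < (inner ℝ m₀ u : ℝ))).tendsto.comp
    hi).smul (hr.sub (hi.smul hm))
  refine h1.congr' ?_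
  filter_upwards [hm1, hr1, hi.eventually (lt_mem_nhds hmu)] with x h1 h2 h3
  exact (toDirSpace_eq_logFactor h1 h2 (by linarith)).symm

/-- Both arguments move, so the strict derivative is what gives the limit of the quotient. -/
theorem tendsto_logFactor_slope {a b : X → ℝ} {c d : ℝ} (hc : c ∈ Ioo (-1 : ℝ) 1)
    (ha : Tendsto a l (𝓝 c)) (hb : Tendsto b l (𝓝 c))
    (hd : Tendsto (fun x => (κ x)⁻¹ * (a x - b x)) l (𝓝 d)) :
    Tendsto (fun x => (κ x)⁻¹ * (logFactor (a x) - logFactor (b x))) l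
      (𝓝 ((c * logFactor c - 1) / (1 - c ^ 2) * d)) := by
  have h1 := (hasStrictDerivAt_logFactor hc.1 hc.2).isLittleO
  have h2 := h1.comp_tendsto (ha.prodMk_nhds hb)
  have h3 := (Asymptotics.isBigO_refl (fun x => (κ x)⁻¹) l).mul_isLittleO h2
  have h4 := (h3.trans_isBigO (hd.isBigO_one ℝ)).tendsto_div_nhds_zero
  have h5 := h4.add (hd.const_mul ((c * logFactor c - 1) / (1 - c ^ 2)))
  rw [zero_add] at h5
  refine h5.congr fun x => ?_
  simp only [Function.comp, ContinuousLinearMap.toSpanSingleton_apply, smul_eq_mul, div_one]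
  ring

theorem tendsto_toDirSpace_slope (hm₀ : ‖m₀‖ = 1) (hu : ‖u‖ = 1)
    (hmu : 0 < (inner ℝ m₀ u : ℝ)) (hm1 : ∀ᶠ x in l, ‖m x‖ = 1) (hr1 : ∀ᶠ x in l, ‖r x‖ = 1)
    (hv1 : ∀ᶠ x in l, ‖v x‖ = 1) (hm : Tendsto m l (𝓝 m₀)) (hr : Tendsto r l (𝓝 u))
    (hv : Tendsto v l (𝓝 u)) (hδ : Tendsto (fun x => (κ x)⁻¹ • (v x - r x)) l (𝓝 w₀)) :
    Tendsto (fun x => (κ x)⁻¹ • (toDirSpace (m x) (v x) - toDirSpace (m x) (r x))) l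
      (𝓝 (toDirSpaceDeriv m₀ u w₀)) := by
  have hir : Tendsto (fun x => (inner ℝ (m x) (r x) : ℝ)) l (𝓝 (inner ℝ m₀ u)) :=
    hm.inner (𝕜 := ℝ) hr
  have hiv : Tendsto (fun x => (inner ℝ (m x) (v x) : ℝ)) l (𝓝 (inner ℝ m₀ u)) :=
    hm.inner (𝕜 := ℝ) hv
  have hiδ : Tendsto (fun x => (inner ℝ (m x) ((κ x)⁻¹ • (v x - r x)) : ℝ)) l
      (𝓝 (inner ℝ m₀ w₀)) := hm.inner (𝕜 := ℝ) hδ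
  have hslope : Tendsto (fun x => (κ x)⁻¹ * ((inner ℝ (m x) (v x) : ℝ) - inner ℝ (m x) (r x))) l
      (𝓝 (inner ℝ m₀ w₀)) := by
    refine hiδ.congr fun x => ?_
    rw [inner_smul_right, inner_sub_right]
  have h1 := ((continuousAt_logFactor (by linarith : -1 < (inner ℝ m₀ u : ℝ))).tendsto.comp
    hir).smul (hδ.sub (hiδ.smul hm))
  have h2 : Tendsto (fun x => ((κ x)⁻¹ *
      (logFactor (inner ℝ (m x) (v x)) - logFactor (inner ℝ (m x) (r x)))) •
      (v x - (inner ℝ (m x) (v x) : ℝ) • m x)) l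
      (𝓝 (((inner ℝ m₀ u * logFactor (inner ℝ m₀ u) - 1) / (1 - (inner ℝ m₀ u) ^ 2) *
        inner ℝ m₀ w₀) • (u - (inner ℝ m₀ u : ℝ) • m₀))) := by
    have h3 := hv.sub (hiv.smul hm)
    -- For `u = m₀` the function `logFactor` has no derivative at `1`, but its difference quotients
    -- are bounded by the Lipschitz estimate and are multiplied by a vector that tends to zero.
    rcases (inner_mem_Icc hm₀ hu).2.eq_or_lt with h | h
    · have h0 : u - (inner ℝ m₀ u : ℝ) • m₀ = 0 := by
        rw [← norm_eq_zero, norm_sub_inner_smul hm₀ hu, h]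
        norm_num
      rw [h0] at h3 ⊢
      rw [smul_zero]
      have h5 := (hslope.abs.const_mul 2).mul h3.norm
      rw [norm_zero, mul_zero] at h5
      refine squeeze_zero_norm' ?_ h5
      filter_upwards [hm1, hr1, hv1, hir.eventually (lt_mem_nhds hmu),
        hiv.eventually (lt_mem_nhds hmu)] with x a1 a2 a3 a4 a5
      rw [norm_smul, Real.norm_eq_abs, abs_mul, abs_mul]
      have h6 := abs_logFactor_sub_le ⟨a5.le, (inner_mem_Icc a1 a3).2⟩
        ⟨a4.le, (inner_mem_Icc a1 a2).2⟩
      refine mul_le_mul_of_nonneg_right ?_ (norm_nonneg _)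
      nlinarith [mul_le_mul_of_nonneg_left h6 (abs_nonneg (κ x)⁻¹)]
    · exact (tendsto_logFactor_slope ⟨by linarith, h⟩ hiv hir hslope).smul h3
  refine (h1.add h2).congr' ?_
  filter_upwards [hm1, hr1, hv1, hir.eventually (lt_mem_nhds hmu),
    hiv.eventually (lt_mem_nhds hmu)] with x a1 a2 a3 a4 a5
  rw [toDirSpace_sub_toDirSpace a1 a3 a2 (by linarith) (by linarith)]
  simp only [Function.comp, inner_smul_right]
  module

end Limits

theorem continuous_toDirSpaceDeriv (m u : E N) : Continuous (toDirSpaceDeriv m u) := by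
  unfold toDirSpaceDeriv
  fun_prop

/-- Two unit vectors `r`, `v` near `u` that differ, to leading order, by a multiple of a vector `w`
orthogonal to `u` give a line in direction space that leaves the ball of radius `π / 2` at a point
with a positive component along `w`. -/
theorem exists_inner_line_ge (hN : 2 ≤ N) {m₀ u : E N} (hm₀ : ‖m₀‖ = 1) (hu : ‖u‖ = 1)
    (hmu : 0 < (inner ℝ m₀ u : ℝ)) {X : Type*} {l : Filter X} {m r v w : X → E N} {κ : X → ℝ}
    (hm1 : ∀ᶠ x in l, ‖m x‖ = 1) (hr1 : ∀ᶠ x in l, ‖r x‖ = 1) (hv1 : ∀ᶠ x in l, ‖v x‖ = 1)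
    (hw1 : ∀ᶠ x in l, ‖w x‖ = 1 ∧ inner ℝ u (w x) = 0) (hκ : ∀ᶠ x in l, 0 < κ x)
    (hm : Tendsto m l (𝓝 m₀)) (hr : Tendsto r l (𝓝 u)) (hv : Tendsto v l (𝓝 u))
    (hδ : Tendsto (fun x => (κ x)⁻¹ • (v x - r x) - w x) l (𝓝 0)) :
    ∃ a : ℝ, 0 < a ∧ ∀ᶠ x in l, ∀ b : ℝ, 0 < b →
      ‖toDirSpace (m x) (r x) + b • (toDirSpace (m x) (v x) - toDirSpace (m x) (r x))‖ =
        Real.pi / 2 →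
      a ≤ inner ℝ (toDirSpace (m x) (r x) +
        b • (toDirSpace (m x) (v x) - toDirSpace (m x) (r x))) (w x) := by
  have hk : ‖toDirSpace m₀ u‖ < Real.pi / 2 := by
    rw [norm_toDirSpace hN hm₀ hu, Real.arccos_lt_pi_div_two]
    exact hmu
  set K : Set (E N) := {w | ‖w‖ = 1 ∧ inner ℝ u w = 0}
  have hK : IsCompact K := by
    have : K = Metric.sphere 0 1 ∩ {w | inner ℝ u w = 0} := by
      ext w
      simp [K]
    rw [this]
    exact (isCompact_sphere 0 1).inter_right
      (isClosed_eq (continuous_const.inner continuous_id) continuous_const)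
  set Ψ : E N → ℝ := fun w => inner ℝ (toDirSpace m₀ u +
    hitParam (Real.pi / 2) (toDirSpace m₀ u) (toDirSpaceDeriv m₀ u w) • toDirSpaceDeriv m₀ u w) w
  have hΨpos : ∀ w ∈ K, 0 < Ψ w := fun w hw =>
    (hit_toDirSpaceDeriv_pos hN hm₀ hu hmu hw.1 hw.2).2
  have hΨc : ContinuousOn Ψ K := by
    intro w hw
    have h1 := (continuous_toDirSpaceDeriv m₀ u).tendsto w
    have h2 := tendsto_hitParam (R := Real.pi / 2) (tendsto_const_nhds (x := toDirSpace m₀ u)) h1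
      (hit_toDirSpaceDeriv_pos hN hm₀ hu hmu hw.1 hw.2).1
    have h3 : Tendsto Ψ (𝓝 w) (𝓝 (Ψ w)) :=
      (tendsto_const_nhds.add (h2.smul h1)).inner (𝕜 := ℝ) tendsto_id
    exact h3.mono_left nhdsWithin_le_nhds
  obtain ⟨a, ha, haK⟩ : ∃ a : ℝ, 0 < a ∧ ∀ w ∈ K, a < Ψ w := by
    obtain ⟨w, hw, hmin⟩ := hK.exists_isMinOn
      ⟨perpUnit u, perpUnit_spec hN u⟩ hΨc
    exact ⟨Ψ w / 2, half_pos (hΨpos w hw), fun z hz =>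
      (half_lt_self (hΨpos w hw)).trans_le (hmin hz)⟩
  -- The directions `w x` need not converge along `l`. Along each finer ultrafilter they do, by
  -- compactness of `K`, and the bound `a` does not depend on the limit.
  refine ⟨a, ha, mem_iff_ultrafilter.mpr fun 𝒰 h𝒰 => ?_⟩
  obtain ⟨w₀, hw₀, hlim⟩ := hK.ultrafilter_le_nhds (𝒰.map w) (by
    rw [le_principal_iff]
    exact h𝒰 hw1)
  have hw : Tendsto w 𝒰 (𝓝 w₀) := hlim
  have hδ' : Tendsto (fun x => (κ x)⁻¹ • (v x - r x)) 𝒰 (𝓝 w₀) := by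
    simpa using (hδ.mono_left h𝒰).add hw
  have hd := tendsto_toDirSpace_slope hm₀ hu hmu (h𝒰 hm1) (h𝒰 hr1) (h𝒰 hv1)
    (hm.mono_left h𝒰) (hr.mono_left h𝒰) (hv.mono_left h𝒰) hδ'
  have hkr := tendsto_toDirSpace hm₀ hu hmu (h𝒰 hm1) (h𝒰 hr1) (hm.mono_left h𝒰) (hr.mono_left h𝒰)
  have hd0 := (hit_toDirSpaceDeriv_pos hN hm₀ hu hmu hw₀.1 hw₀.2).1
  have hΨ := (hkr.add ((tendsto_hitParam (R := Real.pi / 2) hkr hd hd0).smul hd)).inner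
    (𝕜 := ℝ) hw
  filter_upwards [hΨ.eventually (lt_mem_nhds (haK w₀ hw₀)), h𝒰 hκ, hd.eventually_ne hd0,
    hkr.norm.eventually (gt_mem_nhds hk)] with x h1 h2 h3 h4 b hb hbn
  -- Rescaling the direction by `κ` leaves the line unchanged and only changes its parameter; the
  -- rescaled direction has the nonzero limit `toDirSpaceDeriv m₀ u w₀`.
  have h5 : b • (toDirSpace (m x) (v x) - toDirSpace (m x) (r x)) = (b * κ x) •
      ((κ x)⁻¹ • (toDirSpace (m x) (v x) - toDirSpace (m x) (r x))) := by
    rw [smul_smul, mul_assoc, mul_inv_cancel₀ h2.ne', mul_one]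
  rw [h5] at hbn ⊢
  rw [eq_hitParam h4 h3 (mul_pos hb h2) hbn]
  exact h1.le

/-- The component of `x` orthogonal to the unit vector `u`. -/
noncomputable def orthPart (u x : E N) : E N := x - (inner ℝ u x) • u

theorem inner_orthPart {u : E N} (hu : ‖u‖ = 1) (x : E N) : inner ℝ u (orthPart u x) = 0 :=
  inner_sub_inner_smul hu x

theorem continuous_orthPart (u : E N) : Continuous (orthPart u) := by
  unfold orthPart
  fun_prop

theorem orthPart_sub (u x y : E N) : orthPart u (x - y) = orthPart u x - orthPart u y := by
  simp only [orthPart, inner_sub_right]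
  module

theorem orthPart_smul (u x : E N) (a : ℝ) : orthPart u (a • x) = a • orthPart u x := by
  simp only [orthPart, inner_smul_right]
  module

theorem orthPart_self {u : E N} (hu : ‖u‖ = 1) : orthPart u u = 0 := by
  simp [orthPart, hu]

theorem eq_inner_smul_add_orthPart (u x : E N) : x = (inner ℝ u x) • u + orthPart u x := by
  simp [orthPart]

/-! ### Straight convergence dynamics -/

section Straight

variable {O : StarObstacle N} {c : E N → E N} {S : Set (E N)} {p ξ : E N}

theorem StarObstacle.ne_of_mem {a ξ : E N} (ha : a ∈ O.free) (hξ : ξ ∈ O.boundary) : a ≠ ξ := by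
  rintro rfl
  exact absurd hξ (ne_of_gt ha)

theorem StraightOn.ne_zero (h : StraightOn c S O.free) (hξ : ξ ∈ S) (hb : ξ ∈ O.boundary) :
    c ξ ≠ 0 := by
  rcases h with ⟨a, ha, q, -, hS⟩ | ⟨v, hv, q, -, hS⟩
  · rw [(hS ξ hξ).2]
    exact smul_ne_zero (hS ξ hξ).1 (sub_ne_zero.mpr (O.ne_of_mem ha hb))
  · rw [(hS ξ hξ).2]
    exact smul_ne_zero (hS ξ hξ).1 hv

/-- A point on the segment from the reference point to a boundary point is not free. -/
theorem StarObstacle.not_free_of_segment {a ξ : E N} (ha : a ∈ O.free) (hξ : ξ ∈ O.boundary)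
    {t : ℝ} (ht0 : 0 ≤ t) (ht1 : t ≤ 1) : a ≠ O.ref + t • (ξ - O.ref) := by
  intro h
  have h1 := O.ne_ref (ge_of_eq hξ)
  have h2 : O.Γ a ≤ 1 := by
    rw [h, ← show O.Γ ξ = 1 from hξ, ← O.Γ_ray_one ξ]
    exact (O.radial_mono _ (sub_ne_zero.mpr h1)).monotoneOn (mem_Ici.mpr ht0)
      (mem_Ici.mpr zero_le_one) ht1
  exact absurd ha (not_lt.mpr h2)

/-- An attractor `a` must lie beyond the reference point as seen from `ξ`, so the ray points from
`a` through the reference point. A repelling `a` must lie behind `ξ`, so the ray points towards `a`.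
The remaining positions would put the free point `a` on a segment from the reference point to the
surface. In the collinear case the ray is opposite to the direction of `c`. -/
theorem StraightOn.exists_direction (hN : 2 ≤ N) (h : StraightOn c O.boundary O.free) :
    ∃ g : E N, g ≠ 0 ∧ ∀ ξ ∈ O.boundary,
      (unitDir (c ξ) = O.refDir ξ ↔ ∃ t : ℝ, 0 < t ∧ ξ - O.ref = t • g) := by
  have hr : ∀ ξ ∈ O.boundary, O.ref - ξ ≠ 0 := fun ξ hξ =>
    sub_ne_zero.mpr (O.ne_ref (ge_of_eq hξ)).symm
  rcases h with ⟨a, ha, q, hq, hS⟩ | ⟨v, hv, q, hq, hS⟩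
  · have har : a ≠ O.ref := O.ne_ref (le_of_lt ha)
    rcases O.sign_of_continuousOn_boundary hN hq fun ξ hξ => (hS ξ hξ).1 with hpos | hneg
    · refine ⟨O.ref - a, sub_ne_zero.mpr har.symm, fun ξ hξ => ?_⟩
      rw [(hS ξ hξ).2, unitDir_smul_of_pos (hpos ξ hξ), StarObstacle.refDir, eq_comm,
        unitDir_eq_iff (hr ξ hξ)]
      constructor
      · rintro ⟨t, ht, h1⟩
        have ht1 : 1 < t := by
          by_contra! hle
          refine O.not_free_of_segment ha hξ (t := 1 - t) (by linarith) (by linarith) ?_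
          have : a = ξ + t • (O.ref - ξ) := by rw [← h1]; abel
          rw [this]
          module
        refine ⟨(t - 1)⁻¹, inv_pos.mpr (by linarith), ?_⟩
        have : O.ref - a = (t - 1) • (ξ - O.ref) := by
          have : a = ξ + t • (O.ref - ξ) := by rw [← h1]; abel
          rw [this]
          module
        rw [this, smul_smul, inv_mul_cancel₀ (by linarith), one_smul]
      · rintro ⟨t, ht, h1⟩
        refine ⟨1 + t⁻¹, by positivity, ?_⟩
        have h2 : ξ = O.ref + t • (O.ref - a) := by rw [← h1]; abel
        have h3 : O.ref - ξ = t • (a - O.ref) := by rw [h2]; module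
        have h5 : t⁻¹ • (O.ref - ξ) = a - O.ref := by
          rw [h3, smul_smul, inv_mul_cancel₀ ht.ne', one_smul]
        rw [add_smul, h5, one_smul]
        abel
    · refine ⟨a - O.ref, sub_ne_zero.mpr har, fun ξ hξ => ?_⟩
      rw [(hS ξ hξ).2, unitDir_smul_of_neg (hneg ξ hξ), neg_sub, StarObstacle.refDir, eq_comm,
        unitDir_eq_iff (hr ξ hξ)]
      constructor
      · rintro ⟨t, ht, h1⟩
        refine ⟨(1 + t)⁻¹, by positivity, ?_⟩
        have : a - O.ref = (1 + t) • (ξ - O.ref) := by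
          have : a = ξ - t • (O.ref - ξ) := by rw [← h1]; abel
          rw [this]
          module
        rw [this, smul_smul, inv_mul_cancel₀ (by positivity), one_smul]
      · rintro ⟨t, ht, h1⟩
        have h2 : a - O.ref = t⁻¹ • (ξ - O.ref) := by
          rw [h1, smul_smul, inv_mul_cancel₀ ht.ne', one_smul]
        have ht1 : 1 < t⁻¹ := by
          by_contra! hle
          refine O.not_free_of_segment ha hξ (inv_pos.mpr ht).le hle ?_
          rw [← h2]
          abel
        refine ⟨t⁻¹ - 1, by linarith, ?_⟩
        have h3 : a = O.ref + t⁻¹ • (ξ - O.ref) := by rw [← h2]; abel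
        rw [h3]
        module
  · have key : ∀ w : E N, w ≠ 0 → (∀ ξ ∈ O.boundary, unitDir (c ξ) = unitDir w) →
        ∃ g : E N, g ≠ 0 ∧ ∀ ξ ∈ O.boundary,
          (unitDir (c ξ) = O.refDir ξ ↔ ∃ t : ℝ, 0 < t ∧ ξ - O.ref = t • g) := by
      intro w hw hcw
      refine ⟨-w, neg_ne_zero.mpr hw, fun ξ hξ => ?_⟩
      rw [hcw ξ hξ, StarObstacle.refDir, unitDir_eq_iff hw]
      have e : ∀ t : ℝ, O.ref - ξ = t • w ↔ ξ - O.ref = t • -w := by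
        intro t
        rw [smul_neg, ← neg_sub, neg_eq_iff_eq_neg]
      simp only [e]
    rcases O.sign_of_continuousOn_boundary hN hq fun ξ hξ => (hS ξ hξ).1 with hpos | hneg
    · exact key v hv fun ξ hξ => by rw [(hS ξ hξ).2, unitDir_smul_of_pos (hpos ξ hξ)]
    · exact key (-v) (neg_ne_zero.mpr hv) fun ξ hξ => by
        rw [(hS ξ hξ).2, unitDir_smul_of_neg (hneg ξ hξ)]

theorem StraightOn.exists_point (hN : 2 ≤ N) (h : StraightOn c O.boundary O.free) :
    ∃ p ∈ O.boundary, ∀ ξ ∈ O.boundary, (unitDir (c ξ) = O.refDir ξ ↔ ξ = p) := by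
  obtain ⟨g, hg, hiff⟩ := h.exists_direction hN
  obtain ⟨b, hb, hb1⟩ := O.exists_boundary g hg
  refine ⟨O.ref + b • g, hb1, fun ξ hξ => (hiff ξ hξ).trans ⟨?_, ?_⟩⟩
  · rintro ⟨t, ht, h1⟩
    have h2 : ξ = O.ref + t • g := by rw [← h1]; abel
    have h3 : t = b := (O.radial_mono g hg).injOn (mem_Ici.mpr ht.le) (mem_Ici.mpr hb.le) (by
      rw [hb1, ← h2]
      exact hξ)
    rw [h2, h3]
  · rintro rfl
    exact ⟨b, hb, add_sub_cancel_left _ _⟩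

theorem unitDir_sub_eq {u a : E N} (hap : orthPart u (a - p) = 0) (ξ : E N) :
    unitDir (a - ξ) =
      (inner ℝ u (unitDir (a - ξ))) • u - ‖a - ξ‖⁻¹ • orthPart u (ξ - p) := by
  have h : orthPart u (unitDir (a - ξ)) = -(‖a - ξ‖⁻¹ • orthPart u (ξ - p)) := by
    rw [unitDir, orthPart_smul, ← sub_sub_sub_cancel_right a ξ p, orthPart_sub, hap, zero_sub,
      smul_neg]
  conv_lhs => rw [eq_inner_smul_add_orthPart u (unitDir (a - ξ)), h, ← sub_eq_add_neg]

theorem orthPart_eq_zero_of_unitDir {u x : E N} (hu : ‖u‖ = 1) (h : unitDir x = u) :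
    orthPart u x = 0 := by
  rw [← norm_smul_unitDir x, h, orthPart_smul, orthPart_self hu, smul_zero]

/-- Near the point where it has the reference direction, a straight field diverges from the
axis, relative to the reference direction. -/
theorem StraightOn.local_form (h : StraightOn c S O.free) (hpS : p ∈ S) (hp : p ∈ O.boundary)
    (hdir : unitDir (c p) = O.refDir p) :
    ∃ B : E N → ℝ, ContinuousWithinAt B S p ∧ B p < ‖O.ref - p‖⁻¹ ∧ ∀ᶠ ξ in 𝓝[S] p,
      unitDir (c ξ) =
        (inner ℝ (O.refDir p) (unitDir (c ξ))) • O.refDir p -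
          B ξ • orthPart (O.refDir p) (ξ - p) := by
  have hu := O.norm_refDir (O.ne_ref (ge_of_eq hp))
  have hrp : 0 < ‖O.ref - p‖ :=
    norm_pos_iff.mpr (sub_ne_zero.mpr (O.ne_ref (ge_of_eq hp)).symm)
  have hru : unitDir (O.ref - p) = O.refDir p := rfl
  set u := O.refDir p
  have hline : ∀ x : E N, unitDir x = u → x = ‖x‖ • u := by
    intro x hx
    rw [← hx, norm_smul_unitDir]
  rcases h with ⟨a, ha, q, hq, hS⟩ | ⟨v, hv, q, hq, hS⟩
  · have hap : a - p ≠ 0 := sub_ne_zero.mpr (O.ne_of_mem ha hp)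
    have hcont : ContinuousAt (fun ξ => ‖a - ξ‖⁻¹) p :=
      ContinuousAt.inv₀ (by fun_prop) (norm_ne_zero_iff.mpr hap)
    rcases lt_or_gt_of_ne (hS p hpS).1 with hneg | hpos
    · have h1 : unitDir (p - a) = u := by
        rw [← hdir, (hS p hpS).2, unitDir_smul_of_neg hneg, neg_sub]
      have h2 : orthPart u (a - p) = 0 := by
        rw [← neg_sub, ← neg_one_smul ℝ, orthPart_smul, orthPart_eq_zero_of_unitDir hu h1, smul_zero]
      refine ⟨fun ξ => -‖a - ξ‖⁻¹, hcont.neg.continuousWithinAt, ?_, ?_⟩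
      · have : 0 < ‖O.ref - p‖⁻¹ := inv_pos.mpr hrp
        have : 0 ≤ ‖a - p‖⁻¹ := by positivity
        linarith
      · filter_upwards [(hq p hpS).eventually (gt_mem_nhds hneg), self_mem_nhdsWithin] with ξ h3 h4
        rw [(hS ξ h4).2, unitDir_smul_of_neg h3, unitDir_neg, inner_neg_right]
        conv_lhs => rw [unitDir_sub_eq h2 ξ]
        module
    · have h1 : unitDir (a - p) = u := by
        rw [← hdir, (hS p hpS).2, unitDir_smul_of_pos hpos]
      refine ⟨fun ξ => ‖a - ξ‖⁻¹, hcont.continuousWithinAt, ?_, ?_⟩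
      -- An attractor on the axis lies beyond the reference point, hence farther from `p`, since it
      -- is free.
      · refine inv_strictAnti₀ hrp ?_
        by_contra! hle
        have h2 := hline _ h1
        have h3 := hline _ hru
        refine O.not_free_of_segment ha hp (t := 1 - ‖a - p‖ / ‖O.ref - p‖)
          (sub_nonneg.mpr ((div_le_one hrp).mpr hle)) (sub_le_self _ (by positivity)) ?_
        have h4 : (‖a - p‖ / ‖O.ref - p‖) • (O.ref - p) = a - p := by
          rw [div_eq_mul_inv, mul_smul, ← unitDir, hru, ← h2]
        have h5 : a = p + (‖a - p‖ / ‖O.ref - p‖) • (O.ref - p) := by rw [h4]; abel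
        rw [← sub_eq_zero]
        nth_rw 1 [h5]
        module
      · filter_upwards [(hq p hpS).eventually (lt_mem_nhds hpos), self_mem_nhdsWithin] with ξ h3 h4
        rw [(hS ξ h4).2, unitDir_smul_of_pos h3]
        exact unitDir_sub_eq (orthPart_eq_zero_of_unitDir hu h1) ξ
  · refine ⟨fun _ => 0, continuousWithinAt_const, inv_pos.mpr hrp, ?_⟩
    have key : ∀ᶠ ξ in 𝓝[S] p, unitDir (c ξ) = u := by
      rcases lt_or_gt_of_ne (hS p hpS).1 with hneg | hpos
      · filter_upwards [(hq p hpS).eventually (gt_mem_nhds hneg), self_mem_nhdsWithin] with ξ h3 h4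
        rw [← hdir, (hS ξ h4).2, (hS p hpS).2, unitDir_smul_of_neg h3, unitDir_smul_of_neg hneg]
      · filter_upwards [(hq p hpS).eventually (lt_mem_nhds hpos), self_mem_nhdsWithin] with ξ h3 h4
        rw [← hdir, (hS ξ h4).2, (hS p hpS).2, unitDir_smul_of_pos h3, unitDir_smul_of_pos hpos]
    filter_upwards [key] with ξ h3
    rw [h3, real_inner_self_eq_norm_sq, hu]
    simp

end Straight

/-! ### The pseudo-tangent near `p`, and the field on the surface. -/

section Saddle

variable {O : StarObstacle N} {f c : E N → E N} {S : Set (E N)} {p : E N} {s : ℝ}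

theorem norm_sq_inner_smul_sub {u y : E N} {A B : ℝ} (hu : ‖u‖ = 1) (hy : inner ℝ u y = 0) :
    ‖A • u - B • y‖ ^ 2 = A ^ 2 + B ^ 2 * ‖y‖ ^ 2 := by
  rw [norm_sub_sq_real, inner_smul_left, inner_smul_right, hy, norm_smul, norm_smul, hu]
  simp only [Real.norm_eq_abs, mul_pow, sq_abs]
  ring

/-- Near the axis, a straight field with the reference direction at `p` has a pseudo-tangent that
points away from the axis. -/
theorem exists_inner_pseudoTangent_ge (hN : 2 ≤ N) (hcd : ContDiff ℝ 1 c)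
    (h : StraightOn c S O.free) (hpS : p ∈ S) (hp : p ∈ O.boundary)
    (hdir : unitDir (c p) = O.refDir p) :
    ∃ a : ℝ, 0 < a ∧ ∀ᶠ ξ in 𝓝[S] p, 1 ≤ O.Γ ξ → orthPart (O.refDir p) (ξ - p) ≠ 0 →
      deltaK O c ξ ≠ 0 ∧ ‖pseudoTangent O c (Real.pi / 2) ξ‖ = 1 ∧
      -1 < (inner ℝ (unitDir (c ξ)) (pseudoTangent O c (Real.pi / 2) ξ) : ℝ) ∧
      a * ‖orthPart (O.refDir p) (ξ - p)‖ ≤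
        inner ℝ (pseudoTangent O c (Real.pi / 2) ξ) (orthPart (O.refDir p) (ξ - p)) := by
  have hpΓ : 1 ≤ O.Γ p := ge_of_eq hp
  have hpr := O.ne_ref hpΓ
  have hu := O.norm_refDir hpr
  have hc := h.ne_zero hpS hp
  obtain ⟨B, hBc, hBp, hB⟩ := h.local_form hpS hp hdir
  have hmu := O.inner_neg_normal_refDir_pos hpΓ
  have hm₀ := O.norm_neg_normal hpΓ
  have hru : unitDir (O.ref - p) = O.refDir p := rfl
  have hrform := unitDir_sub_eq (u := O.refDir p) (p := p) (a := O.ref)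
    (orthPart_eq_zero_of_unitDir hu hru)
  have hrdef : ∀ ξ, unitDir (O.ref - ξ) = O.refDir ξ := fun ξ => rfl
  simp only [hrdef] at hrform
  have hr := (O.contDiffAt_refDir hpr).continuousAt.tendsto
  have hv := (continuousAt_unitDir_comp c hcd hc).tendsto
  simp only [hdir] at hv
  have hm := (O.continuousAt_normal hpΓ).neg.tendsto
  generalize O.refDir p = u at *
  set y : E N → E N := fun ξ => orthPart u (ξ - p)
  have hyc : Continuous y := (continuous_orthPart u).comp (by fun_prop)
  have hy0 : y p = 0 := by simp [y, orthPart]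
  have huy : ∀ ξ, inner ℝ u (y ξ) = 0 := fun ξ => inner_orthPart hu _
  set T : Set (E N) := {ξ | 1 ≤ O.Γ ξ ∧ y ξ ≠ 0}
  -- The side conditions `1 ≤ Γ` and `y ≠ 0` are built into the filter, so that limits can be taken
  -- under them.
  set l := 𝓝[S] p ⊓ 𝓟 T
  have hlS : l ≤ 𝓝[S] p := inf_le_left
  have hl : l ≤ 𝓝 p := hlS.trans nhdsWithin_le_nhds
  have hT : ∀ᶠ ξ in l, ξ ∈ T := (inf_le_right : l ≤ 𝓟 T) (mem_principal_self T)
  have hBl : Tendsto B l (𝓝 (B p)) := hBc.mono_left hlS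
  have hB'c : ContinuousAt (fun ξ => ‖O.ref - ξ‖⁻¹) p :=
    ContinuousAt.inv₀ (by fun_prop) (norm_ne_zero_iff.mpr (sub_ne_zero.mpr hpr.symm))
  have hB' : Tendsto (fun ξ => ‖O.ref - ξ‖⁻¹) l (𝓝 ‖O.ref - p‖⁻¹) := hB'c.tendsto.mono_left hl
  have hBlt : ∀ᶠ ξ in l, 0 < ‖O.ref - ξ‖⁻¹ - B ξ :=
    (hB'.sub hBl).eventually (lt_mem_nhds (sub_pos.mpr hBp))
  have hcne : ∀ᶠ ξ in l, c ξ ≠ 0 := hl (hcd.continuous.continuousAt.eventually_ne hc)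
  have hA : Tendsto (fun ξ => (inner ℝ u (unitDir (c ξ)) : ℝ)) l (𝓝 1) := by
    have := (tendsto_const_nhds (x := u)).inner (𝕜 := ℝ) (hv.mono_left hl)
    rwa [real_inner_self_eq_norm_sq, hu, one_pow] at this
  have hA' : Tendsto (fun ξ => (inner ℝ u (O.refDir ξ) : ℝ)) l (𝓝 1) := by
    have := (tendsto_const_nhds (x := u)).inner (𝕜 := ℝ) (hr.mono_left hl)
    rwa [real_inner_self_eq_norm_sq, hu, one_pow] at this
  have hyl : Tendsto (fun ξ => ‖y ξ‖) l (𝓝 0) := by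
    have := (hyc.norm.tendsto p).mono_left hl
    rwa [hy0, norm_zero] at this
  have hm1 : ∀ᶠ ξ in l, ‖-O.normal ξ‖ = 1 := hT.mono fun ξ hξ => O.norm_neg_normal hξ.1
  have hr1 : ∀ᶠ ξ in l, ‖O.refDir ξ‖ = 1 := hT.mono fun ξ hξ => O.norm_refDir (O.ne_ref hξ.1)
  have hv1 : ∀ᶠ ξ in l, ‖unitDir (c ξ)‖ = 1 := hcne.mono fun ξ hξ => norm_unitDir hξ
  have hκ : ∀ᶠ ξ in l, 0 < (‖O.ref - ξ‖⁻¹ - B ξ) * ‖y ξ‖ := by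
    filter_upwards [hBlt, hT] with ξ h1 h2
    exact mul_pos h1 (norm_pos_iff.mpr h2.2)
  -- The parts along `y` differ by `(‖ref - ξ‖⁻¹ - B) y`, linear in `y`. Since both directions are
  -- unit vectors, their components `A`, `A'` along `u` satisfy `(A - A')(A + A') = (‖ref - ξ‖⁻² -
  -- B²) ‖y‖²`, so these differ only to second order.
  have hδ : Tendsto (fun ξ => ((‖O.ref - ξ‖⁻¹ - B ξ) * ‖y ξ‖)⁻¹ •
      (unitDir (c ξ) - O.refDir ξ) - unitDir (y ξ)) l (𝓝 0) := by
    have h1 : Tendsto (fun ξ => ((‖O.ref - ξ‖⁻¹ + B ξ) * ‖y ξ‖ /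
        ((inner ℝ u (unitDir (c ξ)) : ℝ) + inner ℝ u (O.refDir ξ))) • u) l (𝓝 0) := by
      have := (((hB'.add hBl).mul hyl).div (hA.add hA') (by norm_num)).smul
        (tendsto_const_nhds (x := u))
      rw [mul_zero, zero_div, zero_smul] at this
      exact this
    refine h1.congr' ?_
    filter_upwards [hlS hB, hT, hBlt, hκ, hr1, hv1, hA.eventually (lt_mem_nhds one_pos),
      hA'.eventually (lt_mem_nhds one_pos)] with ξ b1 b2 b3 b4 b5 b6 b7 b8
    have hyn : 0 < ‖y ξ‖ := norm_pos_iff.mpr b2.2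
    have e1 := norm_sq_inner_smul_sub (A := inner ℝ u (unitDir (c ξ))) (B := B ξ) hu (huy ξ)
    have e2 := norm_sq_inner_smul_sub (A := inner ℝ u (O.refDir ξ)) (B := ‖O.ref - ξ‖⁻¹) hu (huy ξ)
    rw [← b1, b6] at e1
    rw [← hrform ξ, b5] at e2
    have e3 : unitDir (c ξ) - O.refDir ξ =
        ((inner ℝ u (unitDir (c ξ)) : ℝ) - inner ℝ u (O.refDir ξ)) • u +
          (‖O.ref - ξ‖⁻¹ - B ξ) • y ξ := by
      conv_lhs => rw [b1, hrform ξ]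
      module
    rw [e3]
    generalize (inner ℝ u (unitDir (c ξ)) : ℝ) = A at *
    generalize (inner ℝ u (O.refDir ξ) : ℝ) = A' at *
    generalize ‖O.ref - ξ‖⁻¹ = b' at *
    have e4 : (b' + B ξ) * ‖y ξ‖ / (A + A') = ((b' - B ξ) * ‖y ξ‖)⁻¹ * (A - A') := by
      rw [inv_mul_eq_div, div_eq_div_iff (by positivity) b4.ne']
      linear_combination e1 - e2
    have e5 : ((b' - B ξ) * ‖y ξ‖)⁻¹ • (b' - B ξ) • y ξ = unitDir (y ξ) := by
      rw [unitDir, smul_smul]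
      congr 1
      field_simp
    rw [e4, smul_add, e5, smul_smul, add_sub_cancel_right]
  obtain ⟨a, ha, hline⟩ := exists_inner_line_ge hN hm₀ hu hmu hm1 hr1 hv1
    (w := fun ξ => unitDir (y ξ)) (hT.mono fun ξ hξ => ⟨norm_unitDir hξ.2, by
      rw [inner_unitDir_right, huy, mul_zero]⟩) hκ (hm.mono_left hl) (hr.mono_left hl)
    (hv.mono_left hl) hδ
  refine ⟨2 / Real.pi * a, by positivity, ?_⟩
  have hmv : ∀ᶠ ξ in l, 0 < (inner ℝ (-O.normal ξ) (unitDir (c ξ)) : ℝ) :=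
    ((hm.mono_left hl).inner (𝕜 := ℝ) (hv.mono_left hl)).eventually (lt_mem_nhds hmu)
  have hgoal : ∀ᶠ ξ in l, deltaK O c ξ ≠ 0 ∧ ‖pseudoTangent O c (Real.pi / 2) ξ‖ = 1 ∧
      -1 < (inner ℝ (unitDir (c ξ)) (pseudoTangent O c (Real.pi / 2) ξ) : ℝ) ∧
      2 / Real.pi * a * ‖y ξ‖ ≤ inner ℝ (pseudoTangent O c (Real.pi / 2) ξ) (y ξ) := by
    filter_upwards [hline, hT, hcne, hmv, hlS hB, hBlt] with ξ b1 b2 b3 b4 b5 b6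
    have hyn : 0 < ‖y ξ‖ := norm_pos_iff.mpr b2.2
    have hk : deltaK O c ξ ≠ 0 := by
      intro h0
      rw [deltaK_eq_zero_iff O c hN b2.1 b3] at h0
      have b7 := congrArg (fun x => (inner ℝ x (y ξ) : ℝ)) (b5.symm.trans (h0.trans (hrform ξ)))
      change inner ℝ (_ - B ξ • y ξ) (y ξ) = inner ℝ (_ - _ • y ξ) (y ξ) at b7
      simp only [inner_sub_left, inner_smul_left, huy, conj_trivial] at b7
      rw [real_inner_self_eq_norm_sq] at b7
      nlinarith [mul_pos b6 (pow_pos hyn 2)]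
    have hkc : ‖kConv O c ξ‖ < Real.pi / 2 := by
      rw [norm_kConv O c hN b2.1 b3, Real.arccos_lt_pi_div_two]
      exact b4
    obtain ⟨b, hb, hbn, he⟩ := pseudoTangent_eq O c (Real.pi / 2) hN le_rfl b2.1 hk hkc
    -- At angle `π / 2` the exponential map just normalizes, which is where the factor `2 / π` in
    -- the constant comes from.
    have he' : pseudoTangent O c (Real.pi / 2) ξ = (2 / Real.pi) • kLine O c ξ b := by
      rw [he, ofDirSpace, unitDir, hbn, Real.cos_pi_div_two, Real.sin_pi_div_two, inv_div]
      simp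
    have hen := (pseudoTangent_spec O c (Real.pi / 2) hN
      ⟨le_rfl, by linarith [Real.pi_pos]⟩ b2.1 b3 hk).1
    refine ⟨hk, hen, ?_, ?_⟩
    -- The pseudo-tangent is orthogonal to `-n`, whereas `c` has a positive component along `-n`; so
    -- they are not opposite.
    · refine lt_of_le_of_ne (inner_mem_Icc (norm_unitDir b3) hen).1 fun h1 => ?_
      have h2 : ‖unitDir (c ξ) + pseudoTangent O c (Real.pi / 2) ξ‖ ^ 2 = 0 := by
        rw [norm_add_sq_real, norm_unitDir b3, hen, ← h1]
        norm_num
      have h3 := norm_eq_zero.mp (pow_eq_zero_iff two_ne_zero |>.mp h2)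
      have h4 : (inner ℝ (-O.normal ξ) (pseudoTangent O c (Real.pi / 2) ξ) : ℝ) = 0 := by
        rw [he', inner_smul_right, inner_normal_kLine O c hN b2.1, mul_zero]
      have h5 := congrArg (fun x => (inner ℝ (-O.normal ξ) x : ℝ)) h3
      simp only [inner_add_right, inner_zero_right] at h5
      linarith
    · have h1 := b1 b hb (by
        have := hbn
        rw [kLine_eq] at this
        exact this)
      have h2 : (inner ℝ (kLine O c ξ b) (y ξ) : ℝ) =
          ‖y ξ‖ * inner ℝ (kRef O ξ + b • (kConv O c ξ - kRef O ξ)) (unitDir (y ξ)) := by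
        rw [← kLine_eq, inner_unitDir_right, mul_inv_cancel_left₀ hyn.ne']
      rw [he', inner_smul_left, conj_trivial, h2, mul_assoc]
      refine mul_le_mul_of_nonneg_left ?_ (by positivity)
      rw [mul_comm]
      exact mul_le_mul_of_nonneg_left h1 hyn.le
  rw [eventually_inf_principal] at hgoal
  filter_upwards [hgoal] with ξ h1 h2 h3
  exact h1 ⟨h2, h3⟩

theorem refDir_eq_of_orthPart_eq_zero {ξ : E N} (hpr : p ≠ O.ref)
    (h0 : orthPart (O.refDir p) (ξ - p) = 0)
    (hpos : 0 < (inner ℝ (O.refDir p) (O.ref - ξ) : ℝ)) :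
    O.ref - ξ = (inner ℝ (O.refDir p) (O.ref - ξ) : ℝ) • O.refDir p ∧
      O.refDir ξ = O.refDir p := by
  have hu := O.norm_refDir hpr
  have h1 : orthPart (O.refDir p) (O.ref - ξ) = 0 := by
    have h2 : orthPart (O.refDir p) (O.ref - p) = 0 := orthPart_eq_zero_of_unitDir hu rfl
    rw [← sub_sub_sub_cancel_right O.ref ξ p, orthPart_sub, h2, h0, sub_zero]
  have h3 : O.ref - ξ = (inner ℝ (O.refDir p) (O.ref - ξ) : ℝ) • O.refDir p := by
    conv_lhs => rw [eq_inner_smul_add_orthPart (O.refDir p) (O.ref - ξ), h1, add_zero]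
  refine ⟨h3, ?_⟩
  change unitDir (O.ref - ξ) = _
  rw [h3, unitDir_smul_of_pos hpos, unitDir_of_norm_eq_one hu]

theorem eventually_inner_refDir_pos (hpr : p ≠ O.ref) :
    ∀ᶠ ξ in 𝓝 p, 0 < (inner ℝ (O.refDir p) (O.ref - ξ) : ℝ) := by
  have hc : Continuous fun ξ => (inner ℝ (O.refDir p) (O.ref - ξ) : ℝ) := by fun_prop
  refine hc.continuousAt.eventually (lt_mem_nhds ?_)
  have h1 : O.ref - p = ‖O.ref - p‖ • O.refDir p := (norm_smul_unitDir _).symm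
  change 0 < inner ℝ (O.refDir p) (O.ref - p)
  rw [h1, inner_smul_right, real_inner_self_eq_norm_sq, O.norm_refDir hpr]
  have := norm_pos_iff.mpr (sub_ne_zero.mpr hpr.symm)
  linarith

theorem eq_of_orthPart_eq_zero {ξ : E N} (hp : p ∈ O.boundary) (hξ : ξ ∈ O.boundary)
    (h0 : orthPart (O.refDir p) (ξ - p) = 0)
    (hpos : 0 < (inner ℝ (O.refDir p) (O.ref - ξ) : ℝ)) : ξ = p := by
  have hpr := O.ne_ref (ge_of_eq hp)
  have h1 := (refDir_eq_of_orthPart_eq_zero hpr h0 hpos).2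
  obtain ⟨t, ht, h2⟩ := (unitDir_eq_iff (sub_ne_zero.mpr hpr.symm)).mp h1.symm
  have h3 : ξ = O.ref + t • (p - O.ref) := by
    have : ξ = O.ref - t • (O.ref - p) := by rw [← h2]; abel
    rw [this]
    module
  have h4 : t = 1 := O.eq_of_Γ_ray_eq hpr ht.le zero_le_one (by
    rw [← h3, O.Γ_ray_one]
    exact Eq.trans hξ hp.symm)
  rw [h3, h4, one_smul, add_sub_cancel]

theorem rotDir_of_boundary (hN : 2 ≤ N) {Re : ℝ} {ξ : E N} (hξ : ξ ∈ O.boundary) (hc : c ξ ≠ 0)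
    (hk : deltaK O c ξ ≠ 0) (he : ‖pseudoTangent O c Re ξ‖ = 1) :
    rotDir O f c Re s ξ = pseudoTangent O c Re ξ := by
  have hξ' : O.Γ ξ = 1 := hξ
  have h1 : rotWeight O c Re s ξ = 1 := by
    rw [rotWeight, if_neg hk, hξ', div_one, Real.one_rpow]
  rw [rotDir, h1, sub_self, zero_smul, one_smul, zero_add,
    ofDirSpace_toDirSpace hN (norm_unitDir hc) he]

theorem pointsAwayOn_boundary (hN : 2 ≤ N) (hfd : ContDiff ℝ 1 f) (hcd : ContDiff ℝ 1 c)
    (h : StraightOn c O.boundary O.free) (hp : p ∈ O.boundary)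
    (hdir : unitDir (c p) = O.refDir p) (hfp : f p ≠ 0) :
    PointsAwayOn (dynamics O f c (Real.pi / 2) s) O.boundary p (O.refDir p) := by
  obtain ⟨a, ha, hK⟩ := exists_inner_pseudoTangent_ge hN hcd h hp hp hdir
  have hle : 𝓝[O.boundary \ {p}] p ≤ 𝓝[O.boundary] p := nhdsWithin_mono p sdiff_subset
  filter_upwards [hle hK, nhdsWithin_le_nhds (hfd.continuous.continuousAt.eventually_ne hfp),
    nhdsWithin_le_nhds (eventually_inner_refDir_pos (O.ne_ref (ge_of_eq hp))),
    self_mem_nhdsWithin] with ξ h1 h2 h3 h4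
  have hy : orthPart (O.refDir p) (ξ - p) ≠ 0 := fun h0 =>
    h4.2 (eq_of_orthPart_eq_zero hp h4.1 h0 h3)
  have hΓ : 1 ≤ O.Γ ξ := ge_of_eq h4.1
  obtain ⟨hk, he, -, hge⟩ := h1 hΓ hy
  have hh : 0 < magScale O c (Real.pi / 2) ξ :=
    lt_of_le_of_ne (magScale_nonneg O c _) fun h0 =>
      hk ((magScale_eq_zero_iff O c _ hN le_rfl hΓ).mp h0.symm).1
  change 0 < inner ℝ _ (orthPart (O.refDir p) (ξ - p))
  rw [dynamics, rotDir_of_boundary hN h4.1 (h.ne_zero h4.1 h4.1) hk he, inner_smul_left,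
    conj_trivial]
  have := norm_pos_iff.mpr h2
  have := norm_pos_iff.mpr hy
  have : 0 < a * ‖orthPart (O.refDir p) (ξ - p)‖ := by positivity
  exact mul_pos (by positivity) (this.trans_le hge)

end Saddle

/-! ### A scalar differential equation with a degenerate equilibrium -/

theorem exists_time_function {φ : ℝ → ℝ} {ε K : ℝ} (hε : 0 < ε)
    (hφc : ContinuousOn φ (Ioo 0 ε)) (hφ0 : ∀ z ∈ Ioo 0 ε, 0 < φ z)
    (hφK : ∀ z ∈ Ioo 0 ε, φ z ≤ K * z) :
    -- `Φ` is the travel time for `z' = -φ(z)`. It diverges at zero because `φ(z) ≤ K z` makes `Φ +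
    -- K⁻¹ log` nonincreasing.
    ∃ Φ : ℝ → ℝ, (∀ z ∈ Ioo 0 ε, HasDerivAt Φ (-(φ z)⁻¹) z) ∧ Tendsto Φ (𝓝[>] 0) atTop := by
  have hψ : ContinuousOn (fun z => (φ z)⁻¹) (Ioo 0 ε) := hφc.inv₀ fun z hz => (hφ0 z hz).ne'
  have hmid : ε / 2 ∈ Ioo 0 ε := ⟨by linarith, by linarith⟩
  have hK : 0 < K := by
    have := (hφ0 _ hmid).trans_le (hφK _ hmid)
    exact pos_of_mul_pos_left this hmid.1.le
  set Φ : ℝ → ℝ := fun z => -∫ ζ in (ε / 2)..z, (φ ζ)⁻¹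
  have hΦ : ∀ z ∈ Ioo 0 ε, HasDerivAt Φ (-(φ z)⁻¹) z := by
    intro z hz
    refine (intervalIntegral.integral_hasDerivAt_right ?_ ?_ ?_).neg
    · exact (hψ.mono (ordConnected_Ioo.uIcc_subset hmid hz)).intervalIntegrable
    · exact hψ.stronglyMeasurableAtFilter isOpen_Ioo z hz
    · exact hψ.continuousAt (isOpen_Ioo.mem_nhds hz)
  refine ⟨Φ, hΦ, ?_⟩
  have hd : ∀ z ∈ Ioo 0 ε, HasDerivAt (fun z => Φ z + K⁻¹ * Real.log z)
      (-(φ z)⁻¹ + K⁻¹ * z⁻¹) z := fun z hz =>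
    (hΦ z hz).add ((Real.hasDerivAt_log hz.1.ne').const_mul K⁻¹)
  have hanti : AntitoneOn (fun z => Φ z + K⁻¹ * Real.log z) (Ioo 0 ε) := by
    refine antitoneOn_of_deriv_nonpos (convex_Ioo 0 ε)
      (fun z hz => (hd z hz).continuousAt.continuousWithinAt) ?_ ?_
    · rw [interior_Ioo]
      exact fun z hz => (hd z hz).differentiableAt.differentiableWithinAt
    · rw [interior_Ioo]
      intro z hz
      rw [(hd z hz).deriv, ← mul_inv]
      have := inv_anti₀ (hφ0 z hz) (hφK z hz)
      linarith
  have hlog : Tendsto (fun z => (Φ (ε / 2) + K⁻¹ * Real.log (ε / 2)) + K⁻¹ * -Real.log z)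
      (𝓝[>] 0) atTop :=
    tendsto_atTop_add_const_left _ _
      ((tendsto_neg_atBot_atTop.comp Real.tendsto_log_nhdsGT_zero).const_mul_atTop
        (inv_pos.mpr hK))
  refine tendsto_atTop_mono' _ ?_ hlog
  filter_upwards [Ioo_mem_nhdsGT hmid.1] with z hz
  have := hanti ⟨hz.1, hz.2.trans hmid.2⟩ hmid hz.2.le
  simp only at this
  linarith

theorem strictAntiOn_time {φ Φ : ℝ → ℝ} {ε : ℝ} (hφ0 : ∀ z ∈ Ioo 0 ε, 0 < φ z)
    (hΦ : ∀ z ∈ Ioo 0 ε, HasDerivAt Φ (-(φ z)⁻¹) z) : StrictAntiOn Φ (Ioo 0 ε) := by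
  refine strictAntiOn_of_deriv_neg (convex_Ioo 0 ε)
    (fun z hz => (hΦ z hz).continuousAt.continuousWithinAt) ?_
  rw [interior_Ioo]
  intro z hz
  rw [(hΦ z hz).deriv]
  exact neg_neg_of_pos (inv_pos.mpr (hφ0 z hz))

/-- The solution is the inverse function of the strictly decreasing time function. -/
theorem exists_scalar_solution {φ Φ : ℝ → ℝ} {ε : ℝ} (hε : 0 < ε)
    (hφ0 : ∀ z ∈ Ioo 0 ε, 0 < φ z) (hΦ : ∀ z ∈ Ioo 0 ε, HasDerivAt Φ (-(φ z)⁻¹) z)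
    (hΦt : Tendsto Φ (𝓝[>] 0) atTop) :
    ∃ z : ℝ → ℝ, (∀ t, 0 ≤ t → z t ∈ Ioo 0 ε ∧ HasDerivAt z (-φ (z t)) t) ∧
      Tendsto z atTop (𝓝 0) := by
  have hanti := strictAntiOn_time hφ0 hΦ
  have hmid : ε / 2 ∈ Ioo 0 ε := ⟨by linarith, by linarith⟩
  have hcont : ContinuousOn Φ (Ioo 0 ε) := fun z hz => (hΦ z hz).continuousAt.continuousWithinAt
  set τ := Φ (ε / 2)
  have hsurj : ∀ t, τ ≤ t → ∃ z ∈ Ioo 0 ε, Φ z = t := by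
    intro t ht
    obtain ⟨z₁, h1, h2⟩ := ((hΦt.eventually_ge_atTop t).and
      (Ioo_mem_nhdsGT hmid.1)).exists
    have hsub : Icc z₁ (ε / 2) ⊆ Ioo 0 ε := fun z hz =>
      ⟨h2.1.trans_le hz.1, hz.2.trans_lt hmid.2⟩
    obtain ⟨z, hz, hz2⟩ := intermediate_value_Icc' h2.2.le (hcont.mono hsub) ⟨ht, h1⟩
    exact ⟨z, hsub hz, hz2⟩
  choose! Z hZ hΦZ using hsurj
  have hlt : ∀ t, τ ≤ t → ∀ a ∈ Ioo 0 ε, (a < Z t ↔ t < Φ a) ∧ (Z t < a ↔ Φ a < t) := by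
    intro t ht a ha
    have h1 := hanti.lt_iff_gt ha (hZ t ht)
    have h2 := hanti.lt_iff_gt (hZ t ht) ha
    rw [hΦZ t ht] at h1 h2
    exact ⟨h2.symm, h1.symm⟩
  have hZc : ∀ t, τ < t → ContinuousAt Z t := by
    intro t ht
    have hev : ∀ᶠ t' in 𝓝 t, τ ≤ t' := (lt_mem_nhds ht).mono fun _ h => h.le
    refine tendsto_order.mpr ⟨fun a ha => ?_, fun a ha => ?_⟩
    · rcases le_or_gt a 0 with h0 | h0
      · exact hev.mono fun t' h => h0.trans_lt (hZ t' h).1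
      · have ha' : a ∈ Ioo 0 ε := ⟨h0, ha.trans (hZ t ht.le).2⟩
        filter_upwards [hev, gt_mem_nhds ((hlt t ht.le a ha').1.mp ha)] with t' h1 h2
        exact (hlt t' h1 a ha').1.mpr h2
    · rcases le_or_gt ε a with h0 | h0
      · exact hev.mono fun t' h => (hZ t' h).2.trans_le h0
      · have ha' : a ∈ Ioo 0 ε := ⟨(hZ t ht.le).1.trans ha, h0⟩
        filter_upwards [hev, lt_mem_nhds ((hlt t ht.le a ha').2.mp ha)] with t' h1 h2
        exact (hlt t' h1 a ha').2.mpr h2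
  have hZd : ∀ t, τ < t → HasDerivAt Z (-φ (Z t)) t := by
    intro t ht
    have hz := hZ t ht.le
    have h1 := HasDerivAt.of_local_left_inverse (hZc t ht) (hΦ _ hz)
      (neg_ne_zero.mpr (inv_ne_zero (hφ0 _ hz).ne'))
      ((lt_mem_nhds ht).mono fun t' h => hΦZ t' h.le)
    rwa [inv_neg, inv_inv] at h1
  have hZt : Tendsto Z atTop (𝓝 0) := by
    refine tendsto_order.mpr ⟨fun a ha => ?_, fun a ha => ?_⟩
    · filter_upwards [eventually_ge_atTop τ] with t ht
      exact ha.trans (hZ t ht).1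
    · have hb : min a (ε / 2) ∈ Ioo 0 ε :=
        ⟨lt_min ha hmid.1, (min_le_right _ _).trans_lt hmid.2⟩
      filter_upwards [eventually_ge_atTop τ, eventually_gt_atTop (Φ (min a (ε / 2)))]
        with t h1 h2
      exact ((hlt t h1 _ hb).2.mpr h2).trans_le (min_le_left _ _)
  -- The inverse has a two-sided derivative only after `τ`; the extra `1` makes time `0` an interior
  -- point.
  refine ⟨fun t => Z (t + (τ + 1)), fun t ht => ⟨hZ _ (by linarith), ?_⟩, ?_⟩
  · have := (hZd (t + (τ + 1)) (by linarith)).comp_add_const t (τ + 1)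
    exact this
  · exact hZt.comp (tendsto_atTop_add_const_right _ _ tendsto_id)

theorem scalar_solution_unique {φ Φ : ℝ → ℝ} {ε T : ℝ} (hφ0 : ∀ z ∈ Ioo 0 ε, 0 < φ z)
    (hΦ : ∀ z ∈ Ioo 0 ε, HasDerivAt Φ (-(φ z)⁻¹) z) {z₁ z₂ : ℝ → ℝ}
    (h₁ : ∀ t, T ≤ t → z₁ t ∈ Ioo 0 ε ∧ HasDerivAt z₁ (-φ (z₁ t)) t)
    (h₂ : ∀ t, T ≤ t → z₂ t ∈ Ioo 0 ε ∧ HasDerivAt z₂ (-φ (z₂ t)) t) :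
    ∃ t₁ t₂ : ℝ, T ≤ t₁ ∧ T ≤ t₂ ∧ ∀ t, 0 ≤ t → z₁ (t₁ + t) = z₂ (t₂ + t) := by
  have hanti := strictAntiOn_time hφ0 hΦ
  have key : ∀ z : ℝ → ℝ, (∀ t, T ≤ t → z t ∈ Ioo 0 ε ∧ HasDerivAt z (-φ (z t)) t) →
      ∀ t, T ≤ t → Φ (z t) = Φ (z T) + (t - T) := by
    intro z hz t ht
    have hd : ∀ t', T ≤ t' → HasDerivAt (fun t => Φ (z t) - t) 0 t' := by
      intro t' ht'
      have h1 := ((hΦ _ (hz t' ht').1).comp t' (hz t' ht').2).sub (hasDerivAt_id t')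
      have h2 := hφ0 _ (hz t' ht').1
      refine h1.congr_deriv ?_
      rw [neg_mul_neg, inv_mul_cancel₀ h2.ne', sub_self]
    have := constant_of_has_deriv_right_zero (a := T) (b := t)
      (fun t' ht' => (hd t' ht'.1).continuousAt.continuousWithinAt)
      (fun t' ht' => (hd t' ht'.1).hasDerivWithinAt) t (right_mem_Icc.mpr ht)
    linarith
  set a₁ := Φ (z₁ T)
  set a₂ := Φ (z₂ T)
  -- Along a solution `Φ` advances at unit rate. The solution with the smaller value is given the
  -- head start that brings both clocks to `max a₁ a₂`.
  refine ⟨T + max 0 (a₂ - a₁), T + max 0 (a₁ - a₂), by linarith [le_max_left 0 (a₂ - a₁)],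
    by linarith [le_max_left 0 (a₁ - a₂)], fun t ht => ?_⟩
  have e1 : T ≤ T + max 0 (a₂ - a₁) + t := by linarith [le_max_left 0 (a₂ - a₁)]
  have e2 : T ≤ T + max 0 (a₁ - a₂) + t := by linarith [le_max_left 0 (a₁ - a₂)]
  refine hanti.injOn (h₁ _ e1).1 (h₂ _ e2).1 ?_
  rw [key z₁ h₁ _ e1, key z₂ h₂ _ e2]
  rcases le_total a₁ a₂ with h | h
  · rw [max_eq_right (by linarith), max_eq_left (by linarith)]
    ring
  · rw [max_eq_left (by linarith), max_eq_right (by linarith)]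
    ring

/-! ### Rotation between two directions -/

theorem mul_sinc (x : ℝ) : x * Real.sinc x = Real.sin x := by
  rcases eq_or_ne x 0 with rfl | h
  · simp
  · rw [Real.sinc_of_ne_zero h, mul_div_cancel₀ _ h]

/-- Spherical interpolation: for angle `θ > 0` the coefficients are `sin ((1 - t) θ) / sin θ` and
`sin (t θ) / sin θ`, nonnegative because `θ < π`. Writing them with `sinc` covers `θ = 0`. -/
theorem exists_ofDirSpace_smul_eq (hN : 2 ≤ N) {b v : E N} (hb : ‖b‖ = 1) (hv : ‖v‖ = 1)
    (h : -1 < (inner ℝ b v : ℝ)) {t : ℝ} (ht : t ∈ Icc (0 : ℝ) 1) :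
    ∃ A B : ℝ, 0 ≤ A ∧ 0 ≤ B ∧ ofDirSpace b (t • toDirSpace b v) = A • b + B • v := by
  have hx := inner_mem_Icc hb hv
  have hn := norm_toDirSpace hN hb hv
  have hk := toDirSpace_eq_logFactor hb hv h
  have hg : logFactor (inner ℝ b v) = (Real.sinc (Real.arccos (inner ℝ b v)))⁻¹ := rfl
  have hsp := sinc_arccos_pos h
  have hcos := Real.cos_arccos hx.1 hx.2
  have hθ0 := Real.arccos_nonneg (inner ℝ b v)
  have hθπ := arccos_lt_pi h
  rw [ofDirSpace_eq_sinc, norm_smul, Real.norm_of_nonneg ht.1, hn, hk, hg]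
  generalize Real.arccos (inner ℝ b v) = θ at *
  rw [← hcos]
  have hs0 : 0 ≤ Real.sinc (t * θ) := by
    rcases (mul_nonneg ht.1 hθ0).eq_or_lt with h0 | h0
    · rw [← h0, Real.sinc_zero]
      exact zero_le_one
    · rw [Real.sinc_of_ne_zero h0.ne']
      exact div_nonneg (Real.sin_nonneg_of_nonneg_of_le_pi h0.le (by nlinarith [ht.2])) h0.le
  refine ⟨Real.cos (t * θ) - Real.sinc (t * θ) * t * (Real.sinc θ)⁻¹ * Real.cos θ,
    Real.sinc (t * θ) * t * (Real.sinc θ)⁻¹, ?_, ?_, by module⟩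
  · rcases hθ0.eq_or_lt with h0 | h0
    · rw [← h0]
      simp [ht.2]
    · have e1 : Real.cos (t * θ) - Real.sinc (t * θ) * t * (Real.sinc θ)⁻¹ * Real.cos θ =
          Real.sin (θ - t * θ) / (θ * Real.sinc θ) := by
        rw [Real.sin_sub, ← mul_sinc θ, ← mul_sinc (t * θ)]
        field_simp
      rw [e1]
      refine div_nonneg (Real.sin_nonneg_of_nonneg_of_le_pi ?_ ?_) (by positivity)
      · nlinarith [ht.2]
      · nlinarith [ht.1]
  · have := ht.1
    positivity

/-! ### Trajectories that converge to `p` from free space. -/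

section Trajectories

variable {O : StarObstacle N} {f c : E N → E N} {S : Set (E N)} {p : E N} {s : ℝ}

/-- Near `p`, motion off the axis either leaves the axis or advances along it. -/
theorem exists_drift (hN : 2 ≤ N) (hs : 0 < s) (hcd : ContDiff ℝ 1 c)
    (h : StraightOn c S O.free) (hpS : S ∈ 𝓝 p) (hp : p ∈ O.boundary)
    (hdir : unitDir (c p) = O.refDir p) (hfc : ∀ᶠ ξ in 𝓝 p, unitDir (f ξ) = unitDir (c ξ)) :
    ∃ C : ℝ, ∀ᶠ ξ in 𝓝 p, 1 ≤ O.Γ ξ →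
      0 ≤ inner ℝ (orthPart (O.refDir p) (ξ - p)) (dynamics O f c (Real.pi / 2) s ξ) +
        C * ‖orthPart (O.refDir p) (ξ - p)‖ ^ 2 *
          inner ℝ (O.refDir p) (dynamics O f c (Real.pi / 2) s ξ) := by
  have hpmem := mem_of_mem_nhds hpS
  have hu := O.norm_refDir (O.ne_ref (ge_of_eq hp))
  have hc := h.ne_zero hpmem hp
  obtain ⟨a, ha, hK⟩ := exists_inner_pseudoTangent_ge hN hcd h hpmem hp hdir
  obtain ⟨B, hBc, -, hB⟩ := h.local_form hpmem hp hdir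
  have hv := (continuousAt_unitDir_comp c hcd hc).tendsto
  simp only [hdir] at hv
  rw [nhdsWithin_eq_nhds.mpr hpS] at hK hB
  rw [ContinuousWithinAt, nhdsWithin_eq_nhds.mpr hpS] at hBc
  generalize O.refDir p = u at *
  -- Near `p` one has `B ξ ≤ |B p| + 1` and `⟨u, c / ‖c‖⟩ > 1 / 2`, so this `C` compensates the pull
  -- of `c` towards the axis. For the pseudo-tangent, the outward component `a ‖y‖` dominates `C
  -- ‖y‖²` once `C ‖y‖ < a`.
  set C := 2 * (|B p| + 1)
  have hC : 0 < C := by positivity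
  refine ⟨C, ?_⟩
  have hA : Tendsto (fun ξ => (inner ℝ u (unitDir (c ξ)) : ℝ)) (𝓝 p) (𝓝 1) := by
    have := (tendsto_const_nhds (x := u)).inner (𝕜 := ℝ) hv
    rwa [real_inner_self_eq_norm_sq, hu, one_pow] at this
  have hyc : Tendsto (fun ξ => C * ‖orthPart u (ξ - p)‖) (𝓝 p) (𝓝 0) := by
    have h1 : Continuous fun ξ => C * ‖orthPart u (ξ - p)‖ :=
      continuous_const.mul ((continuous_orthPart u).comp (by fun_prop)).norm
    have h2 := h1.tendsto p
    simpa [orthPart] using h2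
  filter_upwards [hK, hB, hBc.abs.eventually (gt_mem_nhds (lt_add_one |B p|)),
    hA.eventually (lt_mem_nhds one_half_lt_one), hyc.eventually (gt_mem_nhds ha),
    hcd.continuous.continuousAt.eventually_ne hc, hfc] with ξ b1 b2 b3 b4 b5 b6 b7 hΓ
  set y := orthPart u (ξ - p)
  have huy : inner ℝ u y = 0 := inner_orthPart hu _
  by_cases hy : y = 0
  · simp [hy]
  obtain ⟨hk, he, hce, hge⟩ := b1 hΓ hy
  have hb := norm_unitDir b6
  obtain ⟨A', B', hA', hB', hrot⟩ := exists_ofDirSpace_smul_eq hN hb he hce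
    (rotWeight_mem O c (Real.pi / 2) s hs hΓ)
  have hrot' : rotDir O f c (Real.pi / 2) s ξ =
      A' • unitDir (c ξ) + B' • pseudoTangent O c (Real.pi / 2) ξ := by
    rw [rotDir, b7, toDirSpace_self hb, smul_zero, zero_add, hrot]
  have hyn : 0 < ‖y‖ := norm_pos_iff.mpr hy
  have e1 : (0 : ℝ) ≤ inner ℝ y (unitDir (c ξ)) + C * ‖y‖ ^ 2 * inner ℝ u (unitDir (c ξ)) := by
    have h1 : (inner ℝ y (unitDir (c ξ)) : ℝ) = -(B ξ * ‖y‖ ^ 2) := by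
      conv_lhs => rw [b2]
      rw [inner_sub_right, inner_smul_right, inner_smul_right, real_inner_comm u y, huy,
        real_inner_self_eq_norm_sq]
      ring
    have h2 : B ξ ≤ |B p| + 1 := (le_abs_self _).trans b3.le
    have h3 : |B p| + 1 ≤ C * inner ℝ u (unitDir (c ξ)) := by
      have : C * (1 / 2) ≤ C * inner ℝ u (unitDir (c ξ)) :=
        mul_le_mul_of_nonneg_left b4.le hC.le
      have hC' : C * (1 / 2) = |B p| + 1 := by ring
      linarith
    rw [h1]
    have := mul_le_mul_of_nonneg_right (h2.trans h3) (sq_nonneg ‖y‖)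
    linarith
  have e2 : (0 : ℝ) ≤ inner ℝ y (pseudoTangent O c (Real.pi / 2) ξ) +
      C * ‖y‖ ^ 2 * inner ℝ u (pseudoTangent O c (Real.pi / 2) ξ) := by
    rw [real_inner_comm] at hge
    have h1 := (inner_mem_Icc hu he).1
    have h2 : C * ‖y‖ ^ 2 ≤ a * ‖y‖ := by nlinarith
    have h3 : C * ‖y‖ ^ 2 * (-1) ≤
        C * ‖y‖ ^ 2 * inner ℝ u (pseudoTangent O c (Real.pi / 2) ξ) :=
      mul_le_mul_of_nonneg_left h1 (by positivity)
    linarith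
  have e3 : (0 : ℝ) ≤ inner ℝ y (rotDir O f c (Real.pi / 2) s ξ) +
      C * ‖y‖ ^ 2 * inner ℝ u (rotDir O f c (Real.pi / 2) s ξ) := by
    rw [hrot']
    simp only [inner_add_right, inner_smul_right]
    nlinarith [mul_nonneg hA' e1, mul_nonneg hB' e2]
  rw [dynamics, inner_smul_right, inner_smul_right]
  have := mul_nonneg (mul_nonneg (magScale_nonneg O c (Real.pi / 2) (ξ := ξ)) (norm_nonneg (f ξ))) e3
  linarith

theorem Γ_axis (hp : p ∈ O.boundary) {z : ℝ} (hz : 0 ≤ z) :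
    O.Γ (p - z • O.refDir p) = 1 + z / O.d₀ := by
  have hpr := O.ne_ref (ge_of_eq hp)
  have hn : 0 < ‖p - O.ref‖ := norm_pos_iff.mpr (sub_ne_zero.mpr hpr)
  have h1 : p - z • O.refDir p = O.ref + (1 + z / ‖p - O.ref‖) • (p - O.ref) := by
    have h2 : O.refDir p = -(‖p - O.ref‖⁻¹ • (p - O.ref)) := by
      rw [StarObstacle.refDir, ← neg_sub p O.ref, unitDir_neg, unitDir]
    rw [h2, div_eq_mul_inv]
    module
  rw [h1, O.Γ_ray (ge_of_eq hp) (by have := div_nonneg hz hn.le; linarith),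
    show O.Γ p = 1 from hp]
  field_simp
  ring

/-- The speed on the axis through `p`. -/
noncomputable def axisSpeed (O : StarObstacle N) (f : E N → E N) (p : E N) (z : ℝ) : ℝ :=
  (1 - 1 / (1 + z / O.d₀)) ^ 2 * ‖f (p - z • O.refDir p)‖

theorem exists_axis (hN : 2 ≤ N) (hfd : ContDiff ℝ 1 f) (hcd : ContDiff ℝ 1 c)
    (h : StraightOn c S O.free) (hpS : S ∈ 𝓝 p) (hp : p ∈ O.boundary)
    (hdir : unitDir (c p) = O.refDir p) (hfc : ∀ᶠ ξ in 𝓝 p, unitDir (f ξ) = unitDir (c ξ))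
    (hfp : f p ≠ 0) :
    ∃ ε : ℝ, 0 < ε ∧ ContinuousOn (axisSpeed O f p) (Ioo 0 ε) ∧
      (∀ z ∈ Ioo 0 ε, 0 < axisSpeed O f p z) ∧
      (∃ K : ℝ, ∀ z ∈ Ioo 0 ε, axisSpeed O f p z ≤ K * z) ∧
      (∀ z ∈ Ioo 0 ε, dynamics O f c (Real.pi / 2) s (p - z • O.refDir p) =
        axisSpeed O f p z • O.refDir p) := by
  have hpmem := mem_of_mem_nhds hpS
  have hpr := O.ne_ref (ge_of_eq hp)
  have hu := O.norm_refDir hpr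
  have hc := h.ne_zero hpmem hp
  obtain ⟨B, -, -, hB⟩ := h.local_form hpmem hp hdir
  rw [nhdsWithin_eq_nhds.mpr hpS] at hB
  have hv := (continuousAt_unitDir_comp c hcd hc).tendsto
  simp only [hdir] at hv
  have hA : Tendsto (fun ξ => (inner ℝ (O.refDir p) (unitDir (c ξ)) : ℝ)) (𝓝 p) (𝓝 1) := by
    have := (tendsto_const_nhds (x := O.refDir p)).inner (𝕜 := ℝ) hv
    rwa [real_inner_self_eq_norm_sq, hu, one_pow] at this
  have hline : Continuous fun z : ℝ => p - z • O.refDir p := by fun_prop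
  have hlim : Tendsto (fun z : ℝ => p - z • O.refDir p) (𝓝 0) (𝓝 p) := by
    simpa using hline.tendsto 0
  have hgood : ∀ᶠ ξ in 𝓝 p, (orthPart (O.refDir p) (ξ - p) = 0 →
      unitDir (c ξ) = O.refDir p ∧ O.refDir ξ = O.refDir p) ∧ c ξ ≠ 0 ∧ f ξ ≠ 0 ∧
      unitDir (f ξ) = unitDir (c ξ) ∧ ‖f ξ‖ < ‖f p‖ + 1 := by
    filter_upwards [hB, hA.eventually (lt_mem_nhds one_pos), eventually_inner_refDir_pos hpr,
      hcd.continuous.continuousAt.eventually_ne hc, hfd.continuous.continuousAt.eventually_ne hfp,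
      hfc, hfd.continuous.norm.continuousAt.eventually (gt_mem_nhds (lt_add_one ‖f p‖))]
      with ξ b1 b2 b3 b4 b5 b6 b7
    refine ⟨fun h0 => ⟨?_, (refDir_eq_of_orthPart_eq_zero hpr h0 b3).2⟩, b4, b5, b6, b7⟩
    rw [h0, smul_zero, sub_zero] at b1
    rw [← unitDir_of_norm_eq_one (norm_unitDir b4), b1, unitDir_smul_of_pos b2,
      unitDir_of_norm_eq_one hu]
  obtain ⟨ε, hε, hball⟩ := Metric.eventually_nhds_iff.mp (hlim.eventually hgood)
  have hmem : ∀ z ∈ Ioo 0 ε, dist z 0 < ε := fun z hz => by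
    rw [Real.dist_eq, sub_zero, abs_of_pos hz.1]
    exact hz.2
  have hd := O.d₀_pos
  have hw : ∀ z ∈ Ioo 0 ε, 0 < 1 - 1 / (1 + z / O.d₀) ∧ 1 - 1 / (1 + z / O.d₀) ≤ z / O.d₀ ∧
      1 - 1 / (1 + z / O.d₀) ≤ 1 := by
    intro z hz
    have h1 : 0 < z / O.d₀ := div_pos hz.1 hd
    have h2 : 1 - 1 / (1 + z / O.d₀) = (z / O.d₀) / (1 + z / O.d₀) := by
      have : 1 + z / O.d₀ ≠ 0 := by positivity
      rw [eq_div_iff this, sub_mul, one_div_mul_cancel this]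
      ring
    refine ⟨h2 ▸ by positivity, ?_, sub_le_self _ (by positivity)⟩
    rw [h2]
    exact div_le_self h1.le (by linarith)
  refine ⟨ε, hε, ?_, fun z hz => ?_, ⟨(‖f p‖ + 1) / O.d₀, fun z hz => ?_⟩, fun z hz => ?_⟩
  · unfold axisSpeed
    refine ContinuousOn.mul (ContinuousOn.pow (continuousOn_const.sub ?_) 2)
      (hfd.continuous.comp hline).norm.continuousOn
    refine continuousOn_const.div (by fun_prop) fun z hz => ?_
    have := div_pos hz.1 hd
    positivity
  · have h1 := (hw z hz).1
    have h2 := norm_pos_iff.mpr (hball (hmem z hz)).2.2.1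
    unfold axisSpeed
    positivity
  · obtain ⟨h1, h2, h3⟩ := hw z hz
    have h4 := (hball (hmem z hz)).2.2.2.2
    have h5 : (1 - 1 / (1 + z / O.d₀)) ^ 2 ≤ z / O.d₀ := by nlinarith
    calc axisSpeed O f p z ≤ z / O.d₀ * (‖f p‖ + 1) :=
          mul_le_mul h5 h4.le (norm_nonneg _) (div_pos hz.1 hd).le
      _ = (‖f p‖ + 1) / O.d₀ * z := by ring
  · obtain ⟨h1, h2, -, h4, -⟩ := hball (hmem z hz)
    have hy : orthPart (O.refDir p) (p - z • O.refDir p - p) = 0 := by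
      rw [sub_sub_cancel_left, ← neg_smul, orthPart_smul, orthPart_self hu, smul_zero]
    obtain ⟨h5, h6⟩ := h1 hy
    have hΓ := Γ_axis hp hz.1.le
    have hk : deltaK O c (p - z • O.refDir p) = 0 := by
      rw [deltaK_eq_zero_iff O c hN (by rw [hΓ]; linarith [div_pos hz.1 hd]) h2, h5, h6]
    have hrot : rotDir O f c (Real.pi / 2) s (p - z • O.refDir p) = O.refDir p := by
      rw [rotDir, rotWeight, if_pos hk, h4, h5, toDirSpace_self hu, smul_zero, zero_smul,
        zero_add, ofDirSpace_zero]
    obtain ⟨h7, -, h8⟩ := hw z hz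
    have hh : magScale O c (Real.pi / 2) (p - z • O.refDir p) = (1 - 1 / (1 + z / O.d₀)) ^ 2 := by
      rw [magScale, hk, hΓ, zero_div, zero_pow two_ne_zero, zero_add]
      exact min_eq_right (pow_le_one₀ h7.le h8)
    rw [dynamics, hrot, hh, axisSpeed]

/-- The drift inequality says that `‖y‖² exp(2C⟨u, x - p⟩)` is nondecreasing in time. Its limit is
zero, so a nonnegative quantity is bounded above by zero. -/
theorem eventually_orthPart_eq_zero {F : E N → E N} {u : E N} {C : ℝ} (hu : ‖u‖ = 1)
    (hdrift : ∀ᶠ ξ in 𝓝 p, 1 ≤ O.Γ ξ → 0 ≤ inner ℝ (orthPart u (ξ - p)) (F ξ) +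
      C * ‖orthPart u (ξ - p)‖ ^ 2 * inner ℝ u (F ξ)) {x : ℝ → E N}
    (hx : ConvergesTo F O.free p x) : ∀ᶠ t in atTop, orthPart u (x t - p) = 0 := by
  obtain ⟨hfree, hint, hlim⟩ := hx
  obtain ⟨T, hT⟩ := eventually_atTop.mp
    ((hlim.eventually hdrift).and (eventually_gt_atTop (0 : ℝ)))
  have hd : ∀ t, T ≤ t → HasDerivAt x (F (x t)) t := fun t ht =>
    (hint t (hT t ht).2.le).hasDerivAt (Ici_mem_nhds (hT t ht).2)
  set g : ℝ → ℝ := fun t =>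
    (‖x t - p‖ ^ 2 - (inner ℝ u (x t - p)) ^ 2) * Real.exp (2 * C * inner ℝ u (x t - p))
  have hsq : ∀ ξ : E N, ‖orthPart u ξ‖ ^ 2 = ‖ξ‖ ^ 2 - (inner ℝ u ξ) ^ 2 := by
    intro ξ
    rw [orthPart, norm_sub_sq_real, norm_smul, inner_smul_right, real_inner_comm, hu, mul_one,
      Real.norm_eq_abs, sq_abs]
    ring
  have hgd : ∀ t, T ≤ t → HasDerivAt g ((2 * inner ℝ (x t - p) (F (x t)) -
      2 * inner ℝ u (x t - p) * inner ℝ u (F (x t))) * Real.exp (2 * C * inner ℝ u (x t - p)) +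
      (‖x t - p‖ ^ 2 - (inner ℝ u (x t - p)) ^ 2) *
        (Real.exp (2 * C * inner ℝ u (x t - p)) * (2 * C * inner ℝ u (F (x t))))) t := by
    intro t ht
    have h1 := (hd t ht).sub_const p
    have h2 : HasDerivAt (fun t => (inner ℝ u (x t - p) : ℝ)) (inner ℝ u (F (x t))) t := by
      simpa using (hasDerivAt_const t u).inner ℝ h1
    have h3 := (h1.norm_sq.sub (h2.pow 2)).mul (h2.const_mul (2 * C)).exp
    refine h3.congr_deriv ?_
    simp only [Pi.sub_apply, Pi.pow_apply]
    push_cast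
    ring
  have hmono : MonotoneOn g (Ici T) := by
    refine monotoneOn_of_deriv_nonneg (convex_Ici T)
      (fun t ht => (hgd t ht).continuousAt.continuousWithinAt)
      (fun t ht => (hgd t (interior_subset ht)).differentiableAt.differentiableWithinAt)
      fun t ht => ?_
    have ht' : T ≤ t := interior_subset ht
    rw [(hgd t ht').deriv]
    have h1 := (hT t ht').1 (le_of_lt (hfree t (hT t ht').2.le))
    rw [hsq, orthPart, inner_sub_left, inner_smul_left, conj_trivial] at h1
    have h2 := Real.exp_pos (2 * C * inner ℝ u (x t - p))
    nlinarith [mul_nonneg h2.le h1]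
  have hglim : Tendsto g atTop (𝓝 0) := by
    have h1 : Continuous fun ξ : E N => (‖ξ - p‖ ^ 2 - (inner ℝ u (ξ - p)) ^ 2) *
        Real.exp (2 * C * inner ℝ u (ξ - p)) := by fun_prop
    have h2 := (h1.tendsto p).comp hlim
    simpa [Function.comp_def, g] using h2
  filter_upwards [eventually_ge_atTop T] with t ht
  have h1 : g t ≤ 0 := ge_of_tendsto hglim (by
    filter_upwards [eventually_ge_atTop t] with t' ht'
    exact hmono ht (ht.trans ht') ht')
  have h2 : ‖orthPart u (x t - p)‖ ^ 2 ≤ 0 := by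
    rw [hsq]
    exact nonpos_of_mul_nonpos_left h1 (Real.exp_pos _)
  exact norm_eq_zero.mp (pow_eq_zero_iff two_ne_zero |>.mp (le_antisymm h2 (sq_nonneg _)))

/-- Otherwise `ξ` would lie on the segment from the reference point to `p`, which contains no free
point. -/
theorem axis_coordinate_pos {ξ : E N} (hp : p ∈ O.boundary) (hξ : ξ ∈ O.free)
    (h0 : orthPart (O.refDir p) (ξ - p) = 0)
    (hpos : 0 < (inner ℝ (O.refDir p) (O.ref - ξ) : ℝ)) :
    0 < (inner ℝ (O.refDir p) (p - ξ) : ℝ) := by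
  have hpr := O.ne_ref (ge_of_eq hp)
  have hu := O.norm_refDir hpr
  have h1 := (refDir_eq_of_orthPart_eq_zero hpr h0 hpos).1
  have hn : 0 < ‖O.ref - p‖ := norm_pos_iff.mpr (sub_ne_zero.mpr hpr.symm)
  have h2 : O.ref - p = ‖O.ref - p‖ • O.refDir p := (norm_smul_unitDir _).symm
  by_contra! hle
  set τ := (inner ℝ (O.refDir p) (O.ref - ξ) : ℝ)
  have h3 : (inner ℝ (O.refDir p) (p - ξ) : ℝ) = τ - ‖O.ref - p‖ := by
    have h4 : p - ξ = (O.ref - ξ) - (O.ref - p) := by abel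
    rw [h4, inner_sub_right, h2, inner_smul_right, real_inner_self_eq_norm_sq, hu, norm_smul, hu,
      norm_norm]
    ring
  refine O.not_free_of_segment hξ hp (t := τ / ‖O.ref - p‖) (by positivity)
    ((div_le_one hn).mpr (by linarith)) ?_
  have h5 : (τ / ‖O.ref - p‖) • (O.ref - p) = O.ref - ξ := by
    rw [h1, h2, smul_smul, norm_smul, norm_norm, hu, mul_one, div_mul_cancel₀ _ hn.ne']
  rw [← neg_sub O.ref p, smul_neg, h5]
  abel

theorem singleConvergentTrajectory (hN : 2 ≤ N) (hs : 0 < s) (hfd : ContDiff ℝ 1 f)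
    (hcd : ContDiff ℝ 1 c) (h : StraightOn c S O.free) (hpS : S ∈ 𝓝 p) (hp : p ∈ O.boundary)
    (hdir : unitDir (c p) = O.refDir p) (hfc : ∀ᶠ ξ in 𝓝 p, unitDir (f ξ) = unitDir (c ξ))
    (hfp : f p ≠ 0) :
    SingleConvergentTrajectory (dynamics O f c (Real.pi / 2) s) O.free p := by
  have hpr := O.ne_ref (ge_of_eq hp)
  have hu := O.norm_refDir hpr
  obtain ⟨ε, hε, hφc, hφ0, ⟨K, hφK⟩, hF⟩ := exists_axis (s := s) hN hfd hcd h hpS hp hdir hfc hfp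
  obtain ⟨Φ, hΦ, hΦt⟩ := exists_time_function hε hφc hφ0 hφK
  constructor
  · obtain ⟨z, hz, hz0⟩ := exists_scalar_solution hε hφ0 hΦ hΦt
    refine ⟨fun t => p - z t • O.refDir p, fun t ht => ?_, fun t ht => ?_, ?_⟩
    · have h1 := (hz t ht).1.1
      change 1 < O.Γ _
      rw [Γ_axis hp h1.le]
      linarith [div_pos h1 O.d₀_pos]
    · have h1 := (((hz t ht).2.smul_const (O.refDir p)).const_sub p).hasDerivWithinAt (s := Ici 0)
      refine h1.congr_deriv ?_
      beta_reduce
      rw [hF _ (hz t ht).1, neg_smul, neg_neg]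
    · simpa using (hz0.smul_const (O.refDir p)).const_sub p
  · obtain ⟨C, hdrift⟩ := exists_drift (f := f) hN hs hcd h hpS hp hdir hfc
    have key : ∀ x, ConvergesTo (dynamics O f c (Real.pi / 2) s) O.free p x →
        ∀ᶠ t in atTop, x t = p - (inner ℝ (O.refDir p) (p - x t) : ℝ) • O.refDir p ∧
          inner ℝ (O.refDir p) (p - x t) ∈ Ioo 0 ε ∧
          HasDerivAt (fun t => (inner ℝ (O.refDir p) (p - x t) : ℝ))
            (-axisSpeed O f p (inner ℝ (O.refDir p) (p - x t))) t := by
      intro x hx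
      have hc : Tendsto (fun t => (inner ℝ (O.refDir p) (p - x t) : ℝ)) atTop (𝓝 0) := by
        have := (tendsto_const_nhds (x := O.refDir p)).inner (𝕜 := ℝ) (hx.2.2.const_sub p)
        simpa using this
      filter_upwards [eventually_orthPart_eq_zero hu hdrift hx,
        hx.2.2.eventually (eventually_inner_refDir_pos hpr), hc.eventually (gt_mem_nhds hε),
        eventually_gt_atTop 0] with t b1 b2 b3 b4
      have h1 : x t = p - (inner ℝ (O.refDir p) (p - x t) : ℝ) • O.refDir p := by
        have h2 := eq_inner_smul_add_orthPart (O.refDir p) (x t - p)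
        rw [b1, add_zero] at h2
        rw [← neg_sub (x t) p, inner_neg_right, neg_smul, ← h2]
        abel
      have h3 : (inner ℝ (O.refDir p) (p - x t) : ℝ) ∈ Ioo 0 ε :=
        ⟨axis_coordinate_pos hp (hx.1 t b4.le) b1 b2, b3⟩
      refine ⟨h1, h3, ?_⟩
      have h4 := (hx.2.1 t b4.le).hasDerivAt (Ici_mem_nhds b4)
      have h5 := (hasDerivAt_const t (O.refDir p)).inner ℝ (h4.const_sub p)
      refine h5.congr_deriv ?_
      have h6 := hF _ h3
      rw [← h1] at h6
      beta_reduce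
      rw [h6, inner_zero_left, add_zero, inner_neg_right, inner_smul_right,
        real_inner_self_eq_norm_sq, hu]
      ring
    intro x y hx hy
    obtain ⟨T, hT⟩ := eventually_atTop.mp
      (((key x hx).and (key y hy)).and (eventually_ge_atTop (0 : ℝ)))
    obtain ⟨t₁, t₂, ht₁, ht₂, heq⟩ := scalar_solution_unique (T := T) hφ0 hΦ
      (fun t ht => (hT t ht).1.1.2) (fun t ht => (hT t ht).1.2.2)
    have hT0 := (hT T le_rfl).2
    refine ⟨t₁, t₂, hT0.trans ht₁, hT0.trans ht₂, fun t ht => ?_⟩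
    rw [(hT (t₁ + t) (by linarith)).1.1.1, (hT (t₂ + t) (by linarith)).1.2.1, heq t ht]

end Trajectories

end ROAM

/-! ### Assembly of the claims. -/

theorem mainTheorem1 (N : ℕ) (hN : 2 ≤ N) (O : ROAM.StarObstacle N)
    (f c : ROAM.E N → ROAM.E N) (hf : ContDiff ℝ 1 f) (hc : ContDiff ℝ 1 c)
    (hfc : ROAM.NeverAnticollinear f c)
    (Re s : ℝ) (hRe : Re ∈ Set.Icc (Real.pi / 2) Real.pi) (hs : 0 < s) :
    -- motions that start in free space stay in free space
    (∀ (T : ℝ) (x : ℝ → ROAM.E N), 0 ≤ T → ContinuousOn x (Set.Icc 0 T) →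
      IsIntegralCurveOn x (fun _ => ROAM.dynamics O f c Re s) (Set.Ico 0 T) →
      x 0 ∈ O.free → ∀ t ∈ Set.Icc 0 T, x t ∈ O.free) ∧
    -- stationary points of `f` are preserved, and no others appear in free space
    (∀ ξ, f ξ = 0 → ROAM.dynamics O f c Re s ξ = 0) ∧
    (∀ ξ ∈ O.free, ROAM.dynamics O f c Re s ξ = 0 → f ξ = 0) ∧
    -- if `c` is straight on the surface, there is a single spurious stationary point, a saddle
    (ROAM.StraightOn c O.boundary O.free →
      ∃ p ∈ O.boundary,
        (∀ ξ ∈ O.boundary, ROAM.deltaK O c ξ = 0 ↔ ξ = p) ∧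
        (∀ ξ ∈ O.free ∪ O.boundary, ROAM.magScale O c Re ξ = 0 ↔ ξ = p) ∧
        Filter.Tendsto (ROAM.magScale O c Re) (nhdsWithin p (O.free ∪ O.boundary)) (nhds 0) ∧
        (∀ ξ ∈ O.free ∪ O.boundary, ROAM.dynamics O f c Re s ξ = 0 ↔ f ξ = 0 ∨ ξ = p) ∧
        (Re = Real.pi / 2 →
          (f p ≠ 0 → ROAM.PointsAwayOn (ROAM.dynamics O f c Re s) O.boundary p (O.refDir p)) ∧
          ((∃ U ∈ nhds p, ROAM.StraightOn c (O.boundary ∪ U) O.free ∧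
              ∀ ξ ∈ U, ∃ m : ℝ, 0 < m ∧ f ξ = m • c ξ) →
            ROAM.SingleConvergentTrajectory (ROAM.dynamics O f c Re s) O.free p))) := by
  refine ⟨fun T x hT hx hd h0 => ROAM.mem_free_of_integralCurve hN O f c hf hc hfc Re s hRe hs T x hx
    hd h0, fun ξ h => (ROAM.dynamics_eq_zero_iff O f c Re s hN hfc).mpr (Or.inl h),
    fun ξ hξ h => ?_, fun hstr => ?_⟩
  · refine ((ROAM.dynamics_eq_zero_iff O f c Re s hN hfc).mp h).resolve_right fun h1 => ?_
    have hξ' : 1 < O.Γ ξ := hξ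
    exact hξ'.ne' ((ROAM.magScale_eq_zero_iff O c Re hN hRe.1 hξ'.le).mp h1).2
  · obtain ⟨p, hp, huniq⟩ := hstr.exists_point hN
    have hpΓ : O.Γ p = 1 := hp
    have hdir : ROAM.unitDir (c p) = O.refDir p := (huniq p hp).mpr rfl
    have hk : ∀ ξ ∈ O.boundary, ROAM.deltaK O c ξ = 0 ↔ ξ = p := fun ξ hξ =>
      (ROAM.deltaK_eq_zero_iff O c hN (ge_of_eq hξ) (hstr.ne_zero hξ hξ)).trans (huniq ξ hξ)
    have hcp := hstr.ne_zero hp hp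
    have hm : ∀ ξ ∈ O.free ∪ O.boundary, ROAM.magScale O c Re ξ = 0 ↔ ξ = p := by
      intro ξ hξ
      rw [ROAM.magScale_eq_zero_iff O c Re hN hRe.1 (O.one_le_of_mem hξ)]
      constructor
      · rintro ⟨h1, h2⟩
        exact (hk ξ h2).mp h1
      · rintro rfl
        exact ⟨(hk ξ hp).mpr rfl, hp⟩
    refine ⟨p, hp, hk, hm, ?_, fun ξ hξ => ?_, ?_⟩
    · have h1 := ROAM.isBigO_magScale O c Re hN hRe.1 hc hpΓ hcp ((hk p hp).mpr rfl)
      have h2 : Tendsto (fun ξ : ROAM.E N => ‖ξ - p‖ ^ 2) (𝓝[{ξ | 1 ≤ O.Γ ξ}] p) (𝓝 0) := by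
        have h3 : Continuous fun ξ : ROAM.E N => ‖ξ - p‖ ^ 2 := by fun_prop
        simpa using (h3.tendsto p).mono_left nhdsWithin_le_nhds
      exact (h1.trans_tendsto h2).mono_left (nhdsWithin_mono p fun ξ hξ => O.one_le_of_mem hξ)
    · rw [ROAM.dynamics_eq_zero_iff O f c Re s hN hfc, hm ξ hξ]
    · rintro rfl
      refine ⟨fun hfp => ROAM.pointsAwayOn_boundary hN hf hc hstr hp hdir hfp, ?_⟩
      rintro ⟨U, hU, hstrU, hfU⟩
      have hfc' : ∀ᶠ ξ in 𝓝 p, ROAM.unitDir (f ξ) = ROAM.unitDir (c ξ) := by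
        filter_upwards [hU] with ξ hξ
        obtain ⟨m, hm0, h1⟩ := hfU ξ hξ
        rw [h1, ROAM.unitDir_smul_of_pos hm0]
      obtain ⟨m, hm0, h1⟩ := hfU p (mem_of_mem_nhds hU)
      -- Here `f p ≠ 0` because it is a positive multiple of `c p`, which is nonzero by straightness
      -- at a surface point.
      exact ROAM.singleConvergentTrajectory hN hs hf hc hstrU
        (mem_of_superset hU subset_union_right) hp hdir hfc'
        (h1 ▸ smul_ne_zero hm0.ne' hcp)
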